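/- Let $\sigma\in\mathbb{R}\setminus\{0\}$, let $\phi_n$ ($n\ge 0$) be the $L^2$-normalised Hermite functions, $K_{n,n_1,n_2,n_3}=\int_{\mathbb{R}}\phi_n\phi_{n_1}\phi_{n_2}\phi_{n_3}\,dx$, let $l^2_s(\mathbb{N})$ be the space of real sequences with $\|{\bf a}\|_{l^2_s}^2=\sum_{n\ge0}(1+n)^{2s}|a_n|^2<\infty$, and let $\langle\cdot,\cdot\rangle$ be the inner product of $l^2(\mathbb{N})$. A *dark soliton family* is a pair of maps $\varepsilon\mapsto{\bf A}(\varepsilon)\in l^2_{1/2}(\mathbb{N})$, $\varepsilon\mapsto\mu(\varepsilon)\in\mathbb{R}$ which, for $\varepsilon$ in a neighbourhood of $0$, are $C^\infty$ and satisfy $$(\mu-n)A_n-\sigma\sum_{n_1,n_2,n_3}K_{n,n_1,n_2,n_3}A_{n_1}A_{n_2}A_{n_3}=0\quad(n\ge 0),$$ $$\|{\bf A}-\varepsilon{\bf e}_1\|_{l^2_{1/2}}\le C_1|\varepsilon|^3,\qquad \Big|\mu-1-\frac{3\sigma\varepsilon^2}{\sqrt{32\pi}}\Big|\le C_2\varepsilon^4$$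 with constants $C_1,C_2$ independent of $\varepsilon$. Write $\partial_\mu{\bf A}=(d\mu/d\varepsilon)^{-1}\,d{\bf A}/d\varepsilon$. With $V_{n,n_1}=\sum_{n_2,n_3}K_{n,n_1,n_2,n_3}A_{n_2}A_{n_3}$ let $$(L_+{\bf B})_n=(n-\mu)B_n+3\sigma\sum_{n_1}V_{n,n_1}B_{n_1},\qquad (L_-{\bf C})_n=(n-\mu)C_n+\sigma\sum_{n_1}V_{n,n_1}C_{n_1}$$ on the domain $l^2_1(\mathbb{N})$, and consider the eigenvalue problem $$L_+{\bf B}=\Omega{\bf C},\qquad L_-{\bf C}=\Omega{\bf B},\qquad ({\bf B},{\bf C})\ne(0,0).$$ (Multiple sums are read as iterated sums.) **Lemma.** Dark soliton families exist. For every dark soliton family there is $\varepsilon_0>0$ such that for all $0<|\varepsilon|<\varepsilon_0$: 1. $d\mu/d\varepsilon\ne0$, the sequences ${\bf A}$ and $\partial_\mu{\bf A}$ lie in $l^2_1(\mathbb{N})$, $L_-{\bf A}=0$, $L_+\partial_\mu{\bf A}={\bf A}$, and $\langle{\bf A},\partial_\mu{\bf A}\rangle\ne0$. 2. The positive eigenvalues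 can be listed, each once, as a sequence $\{\Omega_m\}_{m=0}^\infty$. For any such listing and any real eigenvectors $[{\bf B}_m,{\bf C}_m]^T$ for $\Omega_m$: - $\langle{\bf B}_{m'},{\bf C}_m\rangle=0$ for all $m'\ne m$, and $\langle{\bf B}_m,{\bf C}_m\rangle\ne0$ for all $m$; - all vectors $[{\bf B}_m,\pm{\bf C}_m]^T$ are orthogonal to $[{\bf 0},{\bf A}]^T$ and $[\partial_\mu{\bf A},{\bf 0}]^T$ with respect to the symplectic form $\omega([{\bf B},{\bf C}],[{\bf B}',{\bf C}'])=\langle{\bf B},{\bf C}'\rangle-\langle{\bf C},{\bf B}'\rangle$; - the set $$\{[{\bf B}_m,{\bf C}_m]^T\}_{m=0}^\infty\cup\{[{\bf B}_m,-{\bf C}_m]^T\}_{m=0}^\infty\cup\{[{\bf 0},{\bf A}]^T,[\partial_\mu{\bf A},{\bf 0}]^T\}$$ is an (unconditional Schauder) basis of $l^2(\mathbb{N},\mathbb{R}^2)$, and after normalising its members to unit length it is a Riesz basis. -/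

import Mathlib

open scoped ContDiff

noncomputable section

namespace DarkSoliton

/-- The real sequence space `l²(ℕ)`. -/
abbrev Ell2 := lp (fun _ : ℕ => ℝ) 2

/-- The Hilbert space `l²(ℕ, ℝ²)`, written as the `l²` sum of two copies of `l²(ℕ)`. -/
abbrev Ell2Pair := WithLp 2 (Ell2 × Ell2)

/-- The element `[B, C]ᵀ` of `l²(ℕ, ℝ²)`. -/
def pair (B C : Ell2) : Ell2Pair := WithLp.toLp 2 (B, C)

/-- Physicists' Hermite polynomials `H₀ = 1`, `H₁ = 2x`, `H₂ = 4x² - 2`, …, obtained from Mathlib's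
probabilists' polynomials by `Hₙ(x) = 2^{n/2} Heₙ(√2 x)`. -/
def physHermite (n : ℕ) (x : ℝ) : ℝ :=
  √2 ^ n * Polynomial.aeval (√2 * x) (Polynomial.hermite n)

/-- The `L²`-normalised Hermite functions `φₙ`. -/
def hermiteFun (n : ℕ) (x : ℝ) : ℝ :=
  1 / √(2 ^ n * (n.factorial : ℝ) * √Real.pi) * physHermite n x * Real.exp (-x ^ 2 / 2)

/-- `K_{n,n₁,n₂,n₃} = (φₙ, φₙ₁ φₙ₂ φₙ₃)`, the inner product being that of `L²(ℝ)`. -/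
def K (n n₁ n₂ n₃ : ℕ) : ℝ :=
  ∫ x : ℝ, hermiteFun n x * (hermiteFun n₁ x * hermiteFun n₂ x * hermiteFun n₃ x)

/-- Membership in the weighted space `l²_s(ℕ)`. -/
def MemWeighted (s : ℝ) (a : ℕ → ℝ) : Prop :=
  Summable fun n : ℕ => (1 + (n : ℝ)) ^ (2 * s) * |a n| ^ 2

/-- The norm of `l²_s(ℕ)` (meaningful on members of `l²_s(ℕ)`). -/
def weightedNorm (s : ℝ) (a : ℕ → ℝ) : ℝ :=
  √(∑' n : ℕ, (1 + (n : ℝ)) ^ (2 * s) * |a n| ^ 2)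

/-- The family `A : ℝ → l²(ℕ)` takes its values over `S` in `l²_s(ℕ)` and is smooth there with
respect to the norm of `l²_s(ℕ)`: the map `a ↦ ((1 + n)^s aₙ)ₙ` is an isometry of `l²_s(ℕ)` onto
`l²(ℕ)`, and the family is smooth after composition with it. -/
def SmoothInWeighted (s : ℝ) (A : ℝ → Ell2) (S : Set ℝ) : Prop :=
  ∃ W : ℝ → Ell2, (∀ ε ∈ S, ∀ n : ℕ, W ε n = (1 + (n : ℝ)) ^ s * A ε n) ∧ ContDiffOn ℝ ∞ W S

/-- The stationary vector field `F(A, μ)`, for real-valued `A`. -/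
def stationaryField (σ : ℝ) (A : ℕ → ℝ) (μ : ℝ) (n : ℕ) : ℝ :=
  (μ - n) * A n - σ * ∑' n₁ : ℕ, ∑' n₂ : ℕ, ∑' n₃ : ℕ, K n n₁ n₂ n₃ * A n₁ * A n₂ * A n₃

/-- The potential matrix `V_{n,n₁}`. -/
def V (A : ℕ → ℝ) (n n₁ : ℕ) : ℝ :=
  ∑' n₂ : ℕ, ∑' n₃ : ℕ, K n n₁ n₂ n₃ * A n₂ * A n₃

/-- The matrix operator `L₊` at `(A, μ)`. -/
def Lplus (σ : ℝ) (A : ℕ → ℝ) (μ : ℝ) (B : ℕ → ℝ) (n : ℕ) : ℝ :=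
  ((n : ℝ) - μ) * B n + 3 * σ * ∑' n₁ : ℕ, V A n n₁ * B n₁

/-- The matrix operator `L₋` at `(A, μ)`. -/
def Lminus (σ : ℝ) (A : ℕ → ℝ) (μ : ℝ) (C : ℕ → ℝ) (n : ℕ) : ℝ :=
  ((n : ℝ) - μ) * C n + σ * ∑' n₁ : ℕ, V A n n₁ * C n₁

/-- `[B, C]ᵀ` is a real-valued eigenvector of the linear problem `L₊ B = Ω C`, `L₋ C = Ω B` for the
real eigenvalue `Ω`; the domain of both operators is `l²_1(ℕ)`. -/
structure IsEigenvector (σ : ℝ) (A : ℕ → ℝ) (μ Ω : ℝ) (B C : Ell2) : Prop where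
  ne_zero : pair B C ≠ 0
  mem_left : MemWeighted 1 B
  mem_right : MemWeighted 1 C
  left_eq : ∀ n, Lplus σ A μ B n = Ω * C n
  right_eq : ∀ n, Lminus σ A μ C n = Ω * B n

/-- The set of positive eigenvalues of the linear problem. -/
def posEigenvalues (σ : ℝ) (A : ℕ → ℝ) (μ : ℝ) : Set ℝ :=
  {Ω | 0 < Ω ∧ ∃ B C : Ell2, IsEigenvector σ A μ Ω B C}

/-- `Ω` lists the positive eigenvalues, each of them once. -/
def ListsPosEigenvalues (σ : ℝ) (A : ℕ → ℝ) (μ : ℝ) (Ω : ℕ → ℝ) : Prop :=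
  Function.Injective Ω ∧ Set.range Ω = posEigenvalues σ A μ

/-- `ε ↦ (A(ε), μ(ε))` is, near `ε = 0`, the family of dark solitons bifurcating from
`(0, 1)` along `e₁`: a smooth family of real roots of the stationary vector field in `l²_{1/2}(ℕ)`
with `‖A - ε e₁‖ ≤ C₁ |ε|³` in `l²_{1/2}(ℕ)` and `|μ - 1 - 3 σ ε² / √(32 π)| ≤ C₂ ε⁴`. -/
def IsDarkSolitonFamily (σ : ℝ) (A : ℝ → Ell2) (μ : ℝ → ℝ) : Prop :=
  ∃ r > 0, ∃ C₁ C₂ : ℝ,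
    SmoothInWeighted (1 / 2) A (Set.Ioo (-r) r) ∧
    ContDiffOn ℝ ∞ μ (Set.Ioo (-r) r) ∧
    ∀ ε ∈ Set.Ioo (-r) r,
      (∀ n, stationaryField σ (A ε) (μ ε) n = 0) ∧
      weightedNorm (1 / 2) (A ε - lp.single 2 1 ε : Ell2) ≤ C₁ * |ε| ^ 3 ∧
      |μ ε - 1 - 3 * σ * ε ^ 2 / √(32 * Real.pi)| ≤ C₂ * ε ^ 4

/-- The derivative `∂_μ A` along the family, `(dA/dε) / (dμ/dε)`. -/
def dMu (A : ℝ → Ell2) (μ : ℝ → ℝ) (ε : ℝ) : Ell2 :=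
  (deriv μ ε)⁻¹ • deriv A ε

/-- The standard symplectic form on `l²(ℕ, ℝ²)`. -/
def symp (x y : Ell2Pair) : ℝ :=
  inner ℝ x.fst y.snd - inner ℝ x.snd y.fst

/-- The set of vectors `[B_m, C_m]`, `[B_m, -C_m]`, `m ∈ ℕ`, together with `[0, A]` and
`[A', 0]`. -/
def completeSet (B C : ℕ → Ell2) (A A' : Ell2) : ℕ ⊕ ℕ ⊕ Fin 2 → Ell2Pair :=
  Sum.elim (fun m => pair (B m) (C m))
    (Sum.elim (fun m => pair (B m) (-C m)) ![pair 0 A, pair A' 0])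

/-- `v` is an unconditional Schauder basis. -/
def IsUnconditionalBasis {ι E : Type*} [NormedAddCommGroup E] [NormedSpace ℝ E] (v : ι → E) :
    Prop :=
  ∃ b : UnconditionalSchauderBasis ι ℝ E, ∀ i, b i = v i

/-- `v` is a Riesz basis: the image of a Hilbert basis under a bounded invertible operator. -/
def IsRieszBasis {ι E : Type*} [NormedAddCommGroup E] [InnerProductSpace ℝ E] (v : ι → E) :
    Prop :=
  ∃ (b : HilbertBasis ι ℝ E) (T : E ≃L[ℝ] E), ∀ i, v i = T (b i)

end DarkSoliton

end

/-! Write the eigenvalue problem as the single operator `[B, C] ↦ [L₋ C, L₊ B]`. At `ε = 0` it is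
diagonal in the vectors `(eₙ, ±eₙ)/√2`, with integer eigenvalues `±(n - 1)`: the frequencies `0` and
`±1` are double, all others simple. For `ε ≠ 0` it is perturbed by a bounded operator of size
`O(ε²)`. Boundedness is the one-dimensional Sobolev embedding: sequences in `l²_{1/2}` are
coefficients of bounded functions, so multiplication by the square of the profile is bounded on `l²`
(`sum_hermiteFun_sq_le`, `pot`).

A small bounded perturbation of a diagonal operator with integer spectrum is similar, through some
`1 + X` with `X` small in norm, to an operator preserving each unperturbed eigenspace
(`exists_block_diagonalisation`). This is uniform over the infinitely many blocks because division
of matrix entries by integer differences is a bounded Schur multiplier (`exists_schur_div`). On a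
one-dimensional block the eigenvalue only moves slightly, so the three two-dimensional blocks decide
everything.

The block of frequency `0` is spanned by the Jordan chain `[0, A]`, `[∂_μ A, 0]`, which comes from
the stationary equation and its derivative along the family. In the block of frequency `1` the
levels `0` and `2` meet with opposite signs, so a Jordan block or a complex pair could appear. Two
facts exclude this. The oscillation of the soliton in the harmonic trap gives an eigenvector with
eigenvalue exactly `1` (`dipole_mode`). The trace of the perturbation on the block is `2σ(K₂₂₁₁ -
K₀₀₁₁)ε²` to leading order, with nonzero coefficient (`K_2211_sub_K_0011`), so the second
eigenvalue, `1` plus the trace of the reduced block, differs from `1`. The block of frequency `-1`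
is obtained by the reflection `C ↦ -C`.

Up to scalars the modes are therefore the images of a Hilbert basis under a bounded invertible
operator: a change of basis in the three double blocks followed by `1 + X`. This gives both basis
statements, and shows that the modes exhaust the positive eigenvalues. The orthogonality relations
follow from the symmetry of `L₊` and `L₋`; `⟨B_m, C_m⟩ ≠ 0` holds because otherwise `[C_m, B_m]`
would be orthogonal to the whole basis. Existence of a family is a Lyapunov–Schmidt reduction in the
parameter `s = ε²`. -/

namespace DarkSoliton

/-- The real space `l²(ι)`. -/
abbrev L2 (ι : Type*) := lp (fun _ : ι => ℝ) 2

/-! ### Coordinates and matrix entries in `l²`. -/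

section L2Basic

variable {ι : Type*}

theorem hasSum_sq (x : L2 ι) : HasSum (fun i => x i ^ 2) (‖x‖ ^ 2) := by
  have := lp.hasSum_inner (𝕜 := ℝ) x x
  simpa [real_inner_self_eq_norm_sq, ← sq] using this

theorem abs_apply_le (x : L2 ι) (i : ι) : |x i| ≤ ‖x‖ := by
  have := lp.norm_apply_le_norm (p := 2) (by simp) x i
  simpa using this

theorem sum_sq_le (x : L2 ι) (s : Finset ι) : ∑ i ∈ s, x i ^ 2 ≤ ‖x‖ ^ 2 :=
  sum_le_hasSum _ (fun _ _ => sq_nonneg _) (hasSum_sq x)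

theorem memℓp_iff (f : ι → ℝ) : Memℓp f 2 ↔ Summable fun i => f i ^ 2 := by
  rw [memℓp_gen_iff (by norm_num)]
  simp

/-- Testing the form with `x = a y` gives `N ≤ C √N ‖y‖` for `N = ‖a y‖²`, and one factor `√N`
cancels. -/
theorem row_sum_sq_le {κ : Type*} {a : ι → κ → ℝ} {C : ℝ}
    (h : ∀ (s : Finset ι) (t : Finset κ) (x : ι → ℝ) (y : κ → ℝ),
      |∑ i ∈ s, ∑ j ∈ t, x i * a i j * y j| ≤ C * √(∑ i ∈ s, x i ^ 2) * √(∑ j ∈ t, y j ^ 2))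
    (s : Finset ι) (t : Finset κ) (y : κ → ℝ) :
    ∑ i ∈ s, (∑ j ∈ t, a i j * y j) ^ 2 ≤ C ^ 2 * ∑ j ∈ t, y j ^ 2 := by
  set N := ∑ i ∈ s, (∑ j ∈ t, a i j * y j) ^ 2 with hN
  have h0 := h s t (fun i => ∑ j ∈ t, a i j * y j) y
  have h1 : ∑ i ∈ s, ∑ j ∈ t, (∑ j ∈ t, a i j * y j) * a i j * y j = N := by
    rw [hN]
    refine Finset.sum_congr rfl fun i _ => ?_
    simp_rw [mul_assoc]
    rw [← Finset.mul_sum, sq]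
  have hN0 : 0 ≤ N := Finset.sum_nonneg fun _ _ => sq_nonneg _
  rw [h1, abs_of_nonneg hN0, ← hN] at h0
  have hy0 : 0 ≤ ∑ j ∈ t, y j ^ 2 := Finset.sum_nonneg fun _ _ => sq_nonneg _
  rcases hN0.eq_or_lt with h2 | h2
  · rw [← h2]; positivity
  · have h3 : √N ≤ C * √(∑ j ∈ t, y j ^ 2) := by
      have h4 : 0 < √N := Real.sqrt_pos.2 h2
      have : √N * √N ≤ √N * (C * √(∑ j ∈ t, y j ^ 2)) := by
        rw [Real.mul_self_sqrt hN0]; linarith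
      exact le_of_mul_le_mul_left this h4
    calc N = √N ^ 2 := (Real.sq_sqrt hN0).symm
      _ ≤ (C * √(∑ j ∈ t, y j ^ 2)) ^ 2 := by gcongr
      _ = _ := by rw [mul_pow, Real.sq_sqrt hy0]

variable [DecidableEq ι]

/-- The coordinate vector of `l²(ι)`. -/
noncomputable def ev (i : ι) : L2 ι := lp.single 2 i (1 : ℝ)

theorem ev_apply (i j : ι) : ev i j = if j = i then (1 : ℝ) else 0 := by
  simp [ev, Pi.single_apply]

@[simp] theorem ev_self (i : ι) : ev i i = (1 : ℝ) := by simp [ev_apply]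

theorem ev_ne {i j : ι} (h : j ≠ i) : ev i j = (0 : ℝ) := by simp [ev_apply, h]

@[simp] theorem norm_ev (i : ι) : ‖ev i‖ = 1 := by
  simp [ev, lp.norm_single]

theorem inner_ev_left (i : ι) (x : L2 ι) : inner ℝ (ev i) x = x i := by
  simp [ev, lp.inner_single_left]

theorem inner_ev_right (i : ι) (x : L2 ι) : inner ℝ x (ev i) = x i := by
  simp [ev, lp.inner_single_right]

theorem hasSum_ev (x : L2 ι) : HasSum (fun i => x i • ev i) x := by
  have := lp.hasSum_single (E := fun _ : ι => ℝ) (p := 2) (by simp) x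
  convert! this using 2 with i
  rw [ev, ← lp.single_smul]; simp

/-- The coordinate functional. -/
noncomputable def coordCLM (i : ι) : L2 ι →L[ℝ] ℝ := innerSL ℝ (ev i)

@[simp] theorem coordCLM_apply (i : ι) (x : L2 ι) : coordCLM i x = x i := by
  simp [coordCLM, inner_ev_left]

/-- The element of `l²(ι)` with prescribed coordinates in a finite set. -/
noncomputable def finVec (s : Finset ι) (x : ι → ℝ) : L2 ι := ∑ i ∈ s, x i • ev i

theorem finVec_apply (s : Finset ι) (x : ι → ℝ) (j : ι) :
    finVec s x j = if j ∈ s then x j else 0 := by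
  rw [← coordCLM_apply, finVec, map_sum]
  simp [ev_apply]

theorem norm_sq_finVec (s : Finset ι) (x : ι → ℝ) : ‖finVec s x‖ ^ 2 = ∑ i ∈ s, x i ^ 2 := by
  rw [← (hasSum_sq (finVec s x)).tsum_eq, tsum_eq_sum (s := s)]
  · exact Finset.sum_congr rfl fun i hi => by simp [finVec_apply, hi]
  · intro i hi; simp [finVec_apply, hi]

theorem norm_finVec (s : Finset ι) (x : ι → ℝ) : ‖finVec s x‖ = √(∑ i ∈ s, x i ^ 2) := by
  rw [← norm_sq_finVec, Real.sqrt_sq (norm_nonneg _)]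

theorem inner_finVec (s : Finset ι) (x : ι → ℝ) (y : L2 ι) :
    inner ℝ (finVec s x) y = ∑ i ∈ s, x i * y i := by
  simp [finVec, sum_inner, inner_smul_left, inner_ev_left]

/-- Matrix entries of an operator on `l²`. -/
theorem hasSum_entries {κ : Type*} [DecidableEq κ] (T : L2 ι →L[ℝ] L2 κ) (x : L2 ι) (k : κ) :
    HasSum (fun i => T (ev i) k * x i) (T x k) := by
  have := ((coordCLM k).comp T).hasSum (hasSum_ev x)
  simpa [mul_comm] using this

theorem clm_ext_entries {κ : Type*} [DecidableEq κ] {S T : L2 ι →L[ℝ] L2 κ}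
    (h : ∀ i k, S (ev i) k = T (ev i) k) : S = T := by
  ext x k
  refine (hasSum_entries S x k).unique ?_
  simpa [h] using hasSum_entries T x k

theorem sum_entries_le (T : L2 ι →L[ℝ] L2 ι) (s t : Finset ι) (x y : ι → ℝ) :
    |∑ i ∈ s, ∑ j ∈ t, x i * T (ev j) i * y j| ≤ ‖T‖ * √(∑ i ∈ s, x i ^ 2) * √(∑ j ∈ t, y j ^ 2) := by
  have h : ∑ i ∈ s, ∑ j ∈ t, x i * T (ev j) i * y j = inner ℝ (finVec s x) (T (finVec t y)) := by
    rw [inner_finVec]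
    refine Finset.sum_congr rfl fun i _ => ?_
    rw [← coordCLM_apply i (T _), finVec, map_sum, map_sum, Finset.mul_sum]
    refine Finset.sum_congr rfl fun j _ => ?_
    simp; ring
  rw [h, ← norm_finVec, ← norm_finVec]
  calc _ ≤ ‖finVec s x‖ * ‖T (finVec t y)‖ := abs_real_inner_le_norm _ _
    _ ≤ ‖finVec s x‖ * (‖T‖ * ‖finVec t y‖) := by gcongr; exact T.le_opNorm _
    _ = _ := by ring

end L2Basic

/-! ### Bounded operators from matrices and multipliers. -/

section L2Operators

variable {ι : Type*}

/-- A matrix whose bilinear form is bounded on finitely supported vectors is the matrix of a bounded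
operator. -/
theorem exists_clm_of_matrix {κ : Type*} [DecidableEq κ] {a : ι → κ → ℝ} {C : ℝ} (hC : 0 ≤ C)
    (h : ∀ (s : Finset ι) (t : Finset κ) (x : ι → ℝ) (y : κ → ℝ),
      |∑ i ∈ s, ∑ j ∈ t, x i * a i j * y j| ≤ C * √(∑ i ∈ s, x i ^ 2) * √(∑ j ∈ t, y j ^ 2)) :
    ∃ T : L2 κ →L[ℝ] L2 ι, ‖T‖ ≤ C ∧ ∀ i j, T (ev j) i = a i j := by
  have hrow := row_sum_sq_le h
  have hrowmem (i : ι) : Memℓp (fun j => a i j) 2 := by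
    rw [memℓp_iff]
    refine summable_of_sum_le (c := C ^ 2) (fun _ => sq_nonneg _) fun t => ?_
    have h1 := hrow {i} t (fun j => a i j)
    simp only [Finset.sum_singleton, ← sq] at h1
    by_contra! h2
    nlinarith [sq_nonneg C]
  let r (i : ι) : L2 κ := ⟨fun j => a i j, hrowmem i⟩
  have hsum (i : ι) (y : L2 κ) : HasSum (fun j => a i j * y j) (inner ℝ (r i) y) := by
    have := lp.hasSum_inner (𝕜 := ℝ) (r i) y
    simpa [r, mul_comm] using this
  have hbd (y : L2 κ) (s : Finset ι) : ∑ i ∈ s, (inner ℝ (r i) y) ^ 2 ≤ C ^ 2 * ‖y‖ ^ 2 := by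
    have : Filter.Tendsto (fun t : Finset κ => ∑ i ∈ s, (∑ j ∈ t, a i j * y j) ^ 2) Filter.atTop
        (nhds (∑ i ∈ s, (inner ℝ (r i) y) ^ 2)) :=
      tendsto_finsetSum _ fun i _ => (hsum i y).pow 2
    refine le_of_tendsto this (Filter.Eventually.of_forall fun t => (hrow s t y).trans ?_)
    gcongr
    exact sum_sq_le y t
  have hmem (y : L2 κ) : Memℓp (fun i => inner ℝ (r i) y) 2 := by
    rw [memℓp_iff]
    exact summable_of_sum_le (fun _ => sq_nonneg _) (hbd y)
  let T0 : L2 κ →ₗ[ℝ] L2 ι :=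
    { toFun := fun y => ⟨fun i => inner ℝ (r i) y, hmem y⟩
      map_add' := fun x y => by ext i; exact inner_add_right _ _ _
      map_smul' := fun c x => by ext i; simp [inner_smul_right] }
  have hT (y : L2 κ) : ‖T0 y‖ ≤ C * ‖y‖ := by
    refine le_of_sq_le_sq ?_ (by positivity)
    rw [mul_pow]
    exact hasSum_le_of_sum_le (hasSum_sq (T0 y)) (hbd y)
  refine ⟨T0.mkContinuous C hT, T0.mkContinuous_norm_le hC hT, fun i j => ?_⟩
  change inner ℝ (r i) (ev j) = a i j
  rw [inner_ev_right]

/-- Multiplication by a bounded function. -/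
theorem exists_diag (f : ι → ℝ) {C : ℝ} (hC : 0 ≤ C) (hf : ∀ i, |f i| ≤ C) :
    ∃ T : L2 ι →L[ℝ] L2 ι, ‖T‖ ≤ C ∧ ∀ x i, T x i = f i * x i := by
  have hbd (x : L2 ι) (i : ι) : (f i * x i) ^ 2 ≤ C ^ 2 * x i ^ 2 := by
    rw [mul_pow]
    exact mul_le_mul_of_nonneg_right (sq_le_sq.2 (by rw [abs_of_nonneg hC]; exact hf i)) (sq_nonneg _)
  have hs (x : L2 ι) : HasSum (fun i => C ^ 2 * x i ^ 2) (C ^ 2 * ‖x‖ ^ 2) :=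
    (hasSum_sq x).mul_left _
  have hmem (x : L2 ι) : Memℓp (fun i => f i * x i) 2 := by
    rw [memℓp_iff]
    exact (hs x).summable.of_nonneg_of_le (fun _ => sq_nonneg _) (hbd x)
  let T0 : L2 ι →ₗ[ℝ] L2 ι :=
    { toFun := fun y => ⟨fun i => f i * y i, hmem y⟩
      map_add' := fun x y => by ext i; exact mul_add _ _ _
      map_smul' := fun c x => by ext i; simp; ring }
  have hT (y : L2 ι) : ‖T0 y‖ ≤ C * ‖y‖ := by
    refine le_of_sq_le_sq ?_ (by positivity)
    rw [mul_pow]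
    exact hasSum_le (hbd y) (hasSum_sq (T0 y)) (hs y)
  exact ⟨T0.mkContinuous C hT, T0.mkContinuous_norm_le hC hT, fun x i => rfl⟩

end L2Operators
end DarkSoliton

namespace DarkSoliton

/-! ### Schur multipliers depending on integer energy differences. -/

section Schur

variable {ι : Type*} [DecidableEq ι]

/-- Schur multiplication by the matrix `∫ αᵢ βⱼ` is bounded. -/
theorem exists_schur_integral (α β : ι → ℝ → ℝ) {G T : ℝ} (hT : 0 ≤ T) (hα : ∀ i, Continuous (α i))
    (hβ : ∀ i, Continuous (β i)) (hG : 0 ≤ G) (hαb : ∀ i, ∀ t ∈ Set.uIoc 0 T, |α i t| ≤ G)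
    (hβb : ∀ i, ∀ t ∈ Set.uIoc 0 T, |β i t| ≤ 1) :
    ∃ S : (L2 ι →L[ℝ] L2 ι) →L[ℝ] (L2 ι →L[ℝ] L2 ι), ∀ Y i j,
      S Y (ev j) i = (∫ t in 0..T, α i t * β j t) * Y (ev j) i := by
  have key (Y : L2 ι →L[ℝ] L2 ι) : ∃ S : L2 ι →L[ℝ] L2 ι, ‖S‖ ≤ G * T * ‖Y‖ ∧ ∀ i j,
      S (ev j) i = (∫ t in 0..T, α i t * β j t) * Y (ev j) i := by
    refine exists_clm_of_matrix (by positivity) fun s t x y => ?_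
    have h1 : ∑ i ∈ s, ∑ j ∈ t, x i * ((∫ θ in 0..T, α i θ * β j θ) * Y (ev j) i) * y j =
        ∫ θ in 0..T, ∑ i ∈ s, ∑ j ∈ t, (α i θ * x i) * Y (ev j) i * (β j θ * y j) := by
      rw [intervalIntegral.integral_finsetSum]
      · refine Finset.sum_congr rfl fun i _ => ?_
        rw [intervalIntegral.integral_finsetSum]
        · refine Finset.sum_congr rfl fun j _ => ?_
          rw [← intervalIntegral.integral_mul_const, ← intervalIntegral.integral_const_mul,
            ← intervalIntegral.integral_mul_const]
          exact intervalIntegral.integral_congr fun θ _ => by ring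
        · exact fun j _ => Continuous.intervalIntegrable (by fun_prop) _ _
      · exact fun i _ => Continuous.intervalIntegrable (by fun_prop) _ _
    rw [h1, ← Real.norm_eq_abs]
    -- For fixed `θ` the multiplier separates: the sum is the form of `Y` at the vectors `α x` and
    -- `β y`, whose norms grow by at most the factors `G` and `1`.
    have h2 : ∀ θ ∈ Set.uIoc 0 T,
        ‖∑ i ∈ s, ∑ j ∈ t, (α i θ * x i) * Y (ev j) i * (β j θ * y j)‖ ≤
          ‖Y‖ * (G * √(∑ i ∈ s, x i ^ 2)) * √(∑ j ∈ t, y j ^ 2) := by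
      intro θ hθ
      refine (sum_entries_le Y s t _ _).trans ?_
      refine mul_le_mul (mul_le_mul_of_nonneg_left ?_ (norm_nonneg _)) (Real.sqrt_le_sqrt
        (Finset.sum_le_sum fun j _ => ?_)) (by positivity) (by positivity)
      · rw [← Real.sqrt_sq hG, ← Real.sqrt_mul (sq_nonneg _), Finset.mul_sum]
        refine Real.sqrt_le_sqrt (Finset.sum_le_sum fun i _ => ?_)
        rw [mul_pow, ← sq_abs (α i θ)]
        have := hαb i θ hθ
        gcongr
      · rw [mul_pow, ← sq_abs (β j θ)]
        have := hβb j θ hθ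
        exact mul_le_of_le_one_left (sq_nonneg _) (pow_le_one₀ (abs_nonneg _) this)
    refine (intervalIntegral.norm_integral_le_of_norm_le_const h2).trans (le_of_eq ?_)
    rw [sub_zero, abs_of_nonneg hT]; ring
  choose S hS hSe using key
  let S0 : (L2 ι →L[ℝ] L2 ι) →ₗ[ℝ] (L2 ι →L[ℝ] L2 ι) :=
    { toFun := S
      map_add' := fun x y => clm_ext_entries fun i k => by simp [hSe, mul_add]
      map_smul' := fun c x => clm_ext_entries fun i k => by simp [hSe]; ring }
  exact ⟨S0.mkContinuous (G * T) hS, fun Y i j => hSe Y i j⟩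

/-- The sawtooth `π - t` has sine coefficients `1/k`, which turns division by an integer into an
integral of oscillations. At `k = 0` both sides vanish, the inverse of `0` being `0`. -/
theorem integral_sub_mul_sin (k : ℤ) :
    ∫ t in 0..(2 * Real.pi), (Real.pi - t) * Real.sin (k * t) = 2 * Real.pi * (k : ℝ)⁻¹ := by
  rcases eq_or_ne k 0 with rfl | hk
  · simp
  have hk' : (k : ℝ) ≠ 0 := by exact_mod_cast hk
  rw [intervalIntegral.integral_eq_sub_of_hasDerivAt
    (f := fun t => -(Real.pi - t) * Real.cos (k * t) / k - Real.sin (k * t) / k ^ 2)]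
  · have h1 : Real.cos (k * (2 * Real.pi)) = 1 := by
      simp
    have h2 : Real.sin (k * (2 * Real.pi)) = 0 := by
      have := Real.sin_int_mul_pi (k * 2)
      push_cast at this
      rwa [mul_assoc] at this
    simp [h1, h2]
    field_simp; ring
  · intro t _
    have h1 : HasDerivAt (fun t : ℝ => (k : ℝ) * t) k t := by
      simpa using (hasDerivAt_id t).const_mul (k : ℝ)
    have := ((((hasDerivAt_id t).const_sub Real.pi).neg.mul h1.cos).div_const (k : ℝ)).sub
      (h1.sin.div_const ((k : ℝ) ^ 2))
    refine this.congr_deriv ?_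
    simp only [Pi.neg_apply, id]
    field_simp; ring
  · exact Continuous.intervalIntegrable (by fun_prop) _ _

theorem integral_cos_int (k : ℤ) :
    ∫ t in 0..(2 * Real.pi), Real.cos (k * t) = if k = 0 then 2 * Real.pi else 0 := by
  split_ifs with hk
  · simp [hk]
  have hk' : (k : ℝ) ≠ 0 := by exact_mod_cast hk
  rw [intervalIntegral.integral_comp_mul_left (fun t => Real.cos t) hk', integral_cos]
  have h2 : Real.sin (k * (2 * Real.pi)) = 0 := by
    have := Real.sin_int_mul_pi (k * 2)
    push_cast at this
    rwa [mul_assoc] at this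
  simp [h2]

/-- Division of matrix entries by differences of integer energies. -/
theorem exists_schur_div (lam : ι → ℤ) :
    ∃ S : (L2 ι →L[ℝ] L2 ι) →L[ℝ] (L2 ι →L[ℝ] L2 ι), ∀ Y i j,
      S Y (ev j) i = ((lam i : ℝ) - lam j)⁻¹ * Y (ev j) i := by
  have hpi := Real.pi_pos
  have hb : ∀ t ∈ Set.uIoc 0 (2 * Real.pi), |Real.pi - t| ≤ Real.pi := by
    intro t ht
    rw [Set.uIoc_of_le (by positivity)] at ht
    rw [abs_le]; constructor <;> linarith [ht.1, ht.2]
  obtain ⟨S₁, h₁⟩ := exists_schur_integral (ι := ι) (T := 2 * Real.pi) (G := Real.pi)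
    (fun i t => (Real.pi - t) * Real.sin (lam i * t)) (fun j t => Real.cos (lam j * t))
    (by positivity) (by fun_prop) (by fun_prop) hpi.le
    (fun i t ht => by
      rw [abs_mul]
      exact (mul_le_of_le_one_right (abs_nonneg _) (Real.abs_sin_le_one _)).trans (hb t ht))
    (fun i t _ => Real.abs_cos_le_one _)
  obtain ⟨S₂, h₂⟩ := exists_schur_integral (ι := ι) (T := 2 * Real.pi) (G := Real.pi)
    (fun i t => (Real.pi - t) * Real.cos (lam i * t)) (fun j t => Real.sin (lam j * t))
    (by positivity) (by fun_prop) (by fun_prop) hpi.le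
    (fun i t ht => by
      rw [abs_mul]
      exact (mul_le_of_le_one_right (abs_nonneg _) (Real.abs_cos_le_one _)).trans (hb t ht))
    (fun i t _ => Real.abs_sin_le_one _)
  -- The addition formula for `sin((λᵢ - λⱼ) t)` separates `i` from `j`. Entries with equal energies
  -- are sent to `0`.
  refine ⟨(2 * Real.pi)⁻¹ • (S₁ - S₂), fun Y i j => ?_⟩
  have h := integral_sub_mul_sin (lam i - lam j)
  have h3 : ∫ t in 0..(2 * Real.pi), (Real.pi - t) * Real.sin (((lam i - lam j : ℤ) : ℝ) * t) =
      (∫ t in 0..(2 * Real.pi), (Real.pi - t) * Real.sin (lam i * t) * Real.cos (lam j * t)) -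
      ∫ t in 0..(2 * Real.pi), (Real.pi - t) * Real.cos (lam i * t) * Real.sin (lam j * t) := by
    rw [← intervalIntegral.integral_sub]
    · refine intervalIntegral.integral_congr fun t _ => ?_
      push_cast
      rw [sub_mul (lam i : ℝ), Real.sin_sub]; ring
    · exact Continuous.intervalIntegrable (by fun_prop) _ _
    · exact Continuous.intervalIntegrable (by fun_prop) _ _
  rw [h3] at h
  simp only [smul_apply, sub_apply, lp.coeFn_smul,
    lp.coeFn_sub, Pi.smul_apply, Pi.sub_apply, h₁, h₂, smul_eq_mul]
  rw [← sub_mul, h]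
  push_cast
  field_simp

/-- Restriction of a matrix to its diagonal blocks. -/
theorem exists_schur_diag (lam : ι → ℤ) :
    ∃ S : (L2 ι →L[ℝ] L2 ι) →L[ℝ] (L2 ι →L[ℝ] L2 ι), ∀ Y i j,
      S Y (ev j) i = if lam i = lam j then Y (ev j) i else 0 := by
  have hpi := Real.pi_pos
  obtain ⟨S₁, h₁⟩ := exists_schur_integral (ι := ι) (T := 2 * Real.pi) (G := 1)
    (fun i t => Real.cos (lam i * t)) (fun j t => Real.cos (lam j * t))
    (by positivity) (by fun_prop) (by fun_prop) zero_le_one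
    (fun i t _ => Real.abs_cos_le_one _) (fun i t _ => Real.abs_cos_le_one _)
  obtain ⟨S₂, h₂⟩ := exists_schur_integral (ι := ι) (T := 2 * Real.pi) (G := 1)
    (fun i t => Real.sin (lam i * t)) (fun j t => Real.sin (lam j * t))
    (by positivity) (by fun_prop) (by fun_prop) zero_le_one
    (fun i t _ => Real.abs_sin_le_one _) (fun i t _ => Real.abs_sin_le_one _)
  refine ⟨(2 * Real.pi)⁻¹ • (S₁ + S₂), fun Y i j => ?_⟩
  have h := integral_cos_int (lam i - lam j)
  have h3 : ∫ t in 0..(2 * Real.pi), Real.cos (((lam i - lam j : ℤ) : ℝ) * t) =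
      (∫ t in 0..(2 * Real.pi), Real.cos (lam i * t) * Real.cos (lam j * t)) +
      ∫ t in 0..(2 * Real.pi), Real.sin (lam i * t) * Real.sin (lam j * t) := by
    rw [← intervalIntegral.integral_add]
    · refine intervalIntegral.integral_congr fun t _ => ?_
      push_cast
      rw [sub_mul (lam i : ℝ), Real.cos_sub]
    · exact Continuous.intervalIntegrable (by fun_prop) _ _
    · exact Continuous.intervalIntegrable (by fun_prop) _ _
  rw [h3] at h
  simp only [smul_apply, add_apply, lp.coeFn_smul,
    lp.coeFn_add, Pi.smul_apply, Pi.add_apply, h₁, h₂, smul_eq_mul]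
  rw [← add_mul, h]
  simp only [sub_eq_zero]
  split_ifs
  · field_simp
  · simp

end Schur

/-! ### Block diagonalisation by the implicit function theorem. -/

section BlockDiagonal

variable {ι : Type*} [DecidableEq ι]

/-- A small bounded perturbation of a diagonal operator with integer spectrum is block diagonalised
by a near-identity similarity. -/
theorem exists_block_diagonalisation (lam : ι → ℤ) :
    ∃ δ > 0, ∃ c > 0, ∀ R : L2 ι →L[ℝ] L2 ι, ‖R‖ < δ → ∃ X D : L2 ι →L[ℝ] L2 ι,
      ‖X‖ ≤ 1 / 2 ∧ ‖X‖ ≤ c * ‖R‖ ∧ ‖D‖ ≤ c * ‖R‖ ∧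
      (∀ i j, lam i ≠ lam j → D (ev j) i = 0) ∧
      (∀ i j, lam i = lam j → D (ev j) i = R (ev j) i + R (X (ev j)) i) ∧
      (∀ i j, lam i * X (ev j) i - X (ev j) i * lam j + R (ev j) i + R (X (ev j)) i =
        D (ev j) i + X (D (ev j)) i) := by
  obtain ⟨S, hS⟩ := exists_schur_div lam
  obtain ⟨P, hP⟩ := exists_schur_diag lam
  -- With `Λ = diag(lam)`, the aim is `(Λ + R)(1 + X) = (1 + X)(Λ + D)`. Taking `X` without diagonal
  -- blocks forces `D = P(R + RX)`, and off the diagonal blocks `[Λ, X] = -(R + RX - XD)`. Dividing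
  -- by the energy differences with `S` gives `f(R, X) = 0`.
  let f : (L2 ι →L[ℝ] L2 ι) × (L2 ι →L[ℝ] L2 ι) → (L2 ι →L[ℝ] L2 ι) := fun u =>
    u.2 + S (u.1 + u.1 * u.2 - u.2 * P (u.1 + u.1 * u.2))
  have hf : ContDiff ℝ 1 f := by
    have h : ContDiff ℝ 1 fun u : (L2 ι →L[ℝ] L2 ι) × (L2 ι →L[ℝ] L2 ι) => u.1 + u.1 * u.2 :=
      contDiff_fst.add (contDiff_fst.mul contDiff_snd)
    exact contDiff_snd.add (S.contDiff.comp (h.sub (contDiff_snd.mul (P.contDiff.comp h))))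
  -- Every term inside `S` contains `R`, so `f(0, X) = X`.
  have hd : fderiv ℝ f (0, 0) ∘L .inr ℝ _ _ = .id ℝ (L2 ι →L[ℝ] L2 ι) := by
    have h1 : HasFDerivAt (fun v : L2 ι →L[ℝ] L2 ι => f (0, v))
        (fderiv ℝ f (0, 0) ∘L .inr ℝ _ _) 0 :=
      HasFDerivAt.comp (g := f) (f := fun v : L2 ι →L[ℝ] L2 ι => (0, v)) 0
        (hf.differentiable one_ne_zero (0, 0)).hasFDerivAt (hasFDerivAt_prodMk_right _ _)
    have h2 : (fun v : L2 ι →L[ℝ] L2 ι => f (0, v)) = id := by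
      funext v; simp [f]
    rw [h2] at h1
    exact h1.unique (hasFDerivAt_id _)
  have hinv : (fderiv ℝ f (0, 0) ∘L .inr ℝ _ _).IsInvertible := by
    rw [hd]; exact ⟨.refl ℝ _, rfl⟩
  have hfa : ContDiffAt ℝ 1 f (0, 0) := hf.contDiffAt
  let ψ := hfa.implicitFunction one_ne_zero hinv
  have hψ0 : ψ 0 = 0 := hfa.implicitFunction_apply_self one_ne_zero hinv
  have hψ1 : ∀ᶠ R in nhds 0, f (R, ψ R) = f (0, 0) :=
    hfa.eventually_apply_implicitFunction one_ne_zero hinv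
  have hψ2 : ContDiffAt ℝ 1 ψ 0 := hfa.contDiffAt_implicitFunction one_ne_zero hinv
  obtain ⟨c, hc⟩ := (hψ2.differentiableAt one_ne_zero).isBigO_sub.bound
  simp only [hψ0, sub_zero] at hc
  have hc' : ∀ᶠ R in nhds (0 : L2 ι →L[ℝ] L2 ι), ‖ψ R‖ < 1 / 2 := by
    have := hψ2.continuousAt.norm
    rw [ContinuousAt, hψ0, norm_zero] at this
    exact this.eventually_lt_const (by norm_num)
  obtain ⟨δ, hδ, H⟩ := Metric.eventually_nhds_iff.1 (hψ1.and (hc.and hc'))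
  -- `|c|` controls `X`, by differentiability of the implicit function at `0`; the second entry
  -- controls `D = P(R + RX)`, using `‖X‖ < 1/2`.
  refine ⟨δ, hδ, max |c| (‖P‖ * 2 + 1), by positivity, fun R hR => ?_⟩
  obtain ⟨h1, h2, h3⟩ := H (by simpa using hR : dist R 0 < δ)
  refine ⟨ψ R, P (R + R * ψ R), h3.le, h2.trans ?_, ?_, ?_, ?_, ?_⟩
  · gcongr; exact (le_abs_self c).trans (le_max_left _ _)
  · refine (P.le_opNorm _).trans ?_
    calc ‖P‖ * ‖R + R * ψ R‖ ≤ ‖P‖ * (‖R‖ + ‖R‖ * (1 / 2)) := by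
          gcongr
          refine (norm_add_le _ _).trans ?_
          gcongr
          exact (norm_mul_le _ _).trans (by gcongr)
      _ ≤ (‖P‖ * 2 + 1) * ‖R‖ := by nlinarith [norm_nonneg P, norm_nonneg R, mul_nonneg (norm_nonneg P) (norm_nonneg R)]
      _ ≤ _ := by gcongr; exact le_max_right _ _
  · intro i j hij
    simp [hP, hij]
  · intro i j hij
    simp [hP, hij]
  · intro i j
    have h4 : ψ R = -S (R + R * ψ R - ψ R * P (R + R * ψ R)) := by
      have : f (0, 0) = 0 := by simp [f]
      rw [this] at h1
      exact eq_neg_of_add_eq_zero_left h1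
    set X := ψ R with hX
    set D := P (R + R * X) with hD
    have h5 (i j) : X (ev j) i = -(((lam i : ℝ) - lam j)⁻¹ *
        (R (ev j) i + R (X (ev j)) i - X (D (ev j)) i)) := by
      conv_lhs => rw [h4]
      simp [hS]
      ring
    by_cases hij : lam i = lam j
    -- `X` has no diagonal blocks and `D` has only diagonal blocks, so `XD` has no diagonal blocks.
    · have h6 : X (D (ev j)) i = 0 := by
        refine (hasSum_entries X (D (ev j)) i).unique ?_
        convert! hasSum_zero using 2 with k
        by_cases hik : lam i = lam k
        · rw [h5]; simp [hik]
        · rw [hD, hP, if_neg (by rw [← hij]; exact fun h => hik h.symm), mul_zero]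
      have h7 : D (ev j) i = R (ev j) i + R (X (ev j)) i := by simp [hD, hP, hij]
      rw [h6, h7, hij]; ring
    · have h7 : D (ev j) i = 0 := by simp [hD, hP, hij]
      have h8 : ((lam i : ℝ) - lam j) ≠ 0 := by
        rw [sub_ne_zero]; exact_mod_cast hij
      have h9 : ((lam i : ℝ) - lam j) * X (ev j) i =
          -(R (ev j) i + R (X (ev j)) i - X (D (ev j)) i) := by
        rw [h5]; field_simp
      rw [h7]; linarith

end BlockDiagonal
end DarkSoliton

namespace DarkSoliton

/-! ### The unbounded operator `diag(lam) + R` as a relation, and its behaviour under conjugation.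
-/

section Acts

variable {ι : Type*}

/-- `x` is in the domain of the unbounded operator `diag(lam) + R`, with image `z`. -/
def Acts (lam : ι → ℤ) (R : L2 ι →L[ℝ] L2 ι) (x z : L2 ι) : Prop :=
  ∀ i, (lam i : ℝ) * x i + R x i = z i

variable {lam : ι → ℤ} {R X D : L2 ι →L[ℝ] L2 ι}

theorem Acts.add {x z x' z' : L2 ι} (h : Acts lam R x z) (h' : Acts lam R x' z') :
    Acts lam R (x + x') (z + z') := fun i => by
  have h1 := h i
  have h2 := h' i
  simp only [map_add, lp.coeFn_add, Pi.add_apply]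
  linarith

theorem Acts.smul {x z : L2 ι} (c : ℝ) (h : Acts lam R x z) : Acts lam R (c • x) (c • z) :=
  fun i => by
    have h1 := h i
    simp only [map_smul, lp.coeFn_smul, Pi.smul_apply, smul_eq_mul]
    rw [← h1]; ring

theorem Acts.sub {x z x' z' : L2 ι} (h : Acts lam R x z) (h' : Acts lam R x' z') :
    Acts lam R (x - x') (z - z') := by
  have := h.add (h'.smul (-1))
  simpa [sub_eq_add_neg] using this

theorem Acts.unique {x z z' : L2 ι} (h : Acts lam R x z) (h' : Acts lam R x z') : z = z' := by
  ext i
  exact (h i).symm.trans (h' i)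

/-- The energies keep distance `1/2` from a half-integer. -/
theorem half_le_abs_sub_half (k : ℤ) : 1 / 2 ≤ |(k : ℝ) - 1 / 2| := by
  rcases le_or_gt k 0 with hk | hk
  · have : (k : ℝ) ≤ 0 := by exact_mod_cast hk
    rw [abs_of_neg (by linarith)]; linarith
  · have : (1 : ℝ) ≤ k := by exact_mod_cast hk
    rw [abs_of_pos (by linarith)]; linarith

/-- Integers keep distance at least `1/2` from the point `1/2`, and a perturbation of smaller norm
cannot close this gap. -/
theorem Acts.eq_zero_of_half (hR : ‖R‖ < 1 / 2) {x : L2 ι}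
    (h : Acts lam R x ((1 / 2 : ℝ) • x)) : x = 0 := by
  have h1 : ∀ i, ((1 / 2) ^ 2 : ℝ) * x i ^ 2 ≤ (R x i) ^ 2 := fun i => by
    have h2 : R x i = -(((lam i : ℝ) - 1 / 2) * x i) := by
      have := h i
      simp only [lp.coeFn_smul, Pi.smul_apply, smul_eq_mul] at this
      linarith
    rw [h2, neg_sq, mul_pow, ← sq_abs ((lam i : ℝ) - 1 / 2)]
    have := half_le_abs_sub_half (lam i)
    gcongr
  have h2 := hasSum_le h1 ((hasSum_sq x).mul_left _) (hasSum_sq (R x))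
  rw [← mul_pow] at h2
  have h3 := (abs_le_of_sq_le_sq' h2 (norm_nonneg _)).2
  have h4 := R.le_opNorm x
  by_contra hx
  have h5 : 0 < ‖x‖ := norm_pos_iff.2 hx
  nlinarith

/-- Surjectivity at the spectral point `1/2`: with `Q = (Λ - 1/2)⁻¹` of norm at most `2`, the
operator `1 + QD` is inverted by a Neumann series. -/
theorem exists_acts_sub_half (hD : ‖D‖ < 1 / 2) (z : L2 ι) :
    ∃ y, Acts lam D y (z + (1 / 2 : ℝ) • y) := by
  obtain ⟨Q, hQ, hQe⟩ := exists_diag (fun i => ((lam i : ℝ) - 1 / 2)⁻¹) (C := 2) (by norm_num)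
    (fun i => by
      rw [abs_inv]
      exact inv_le_of_inv_le₀ (by norm_num) (by have := half_le_abs_sub_half (lam i); linarith))
  have hn : ‖-(Q * D)‖ < 1 := by
    rw [norm_neg]
    calc _ ≤ ‖Q‖ * ‖D‖ := norm_mul_le _ _
      _ ≤ 2 * ‖D‖ := by gcongr
      _ < 1 := by linarith
  let u := Units.oneSub _ hn
  have hu : (u : L2 ι →L[ℝ] L2 ι) = 1 + Q * D := by simp [u]
  refine ⟨(↑u⁻¹ : L2 ι →L[ℝ] L2 ι) (Q z), fun i => ?_⟩
  set y := (↑u⁻¹ : L2 ι →L[ℝ] L2 ι) (Q z) with hy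
  have h1 : y + Q (D y) = Q z := by
    have : (u : L2 ι →L[ℝ] L2 ι) y = Q z := by
      rw [hy, ← mul_apply_eq_comp, u.mul_inv]; rfl
    rw [hu] at this
    exact this
  have h2 : y i + ((lam i : ℝ) - 1 / 2)⁻¹ * D y i = ((lam i : ℝ) - 1 / 2)⁻¹ * z i := by
    rw [← hQe, ← hQe, ← h1]; rfl
  have h3 : (lam i : ℝ) - 1 / 2 ≠ 0 := by
    intro h
    have := half_le_abs_sub_half (lam i)
    rw [h, abs_zero] at this
    norm_num at this
  have h4 := congrArg (fun t => ((lam i : ℝ) - 1 / 2) * t) h2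
  simp only [mul_add, mul_inv_cancel_left₀ h3] at h4
  simp only [lp.coeFn_add, lp.coeFn_smul, Pi.add_apply, Pi.smul_apply, smul_eq_mul]
  linarith

theorem exists_block_projection (lam : ι → ℤ) (p : ℤ → Prop) [DecidablePred p] :
    ∃ Q : L2 ι →L[ℝ] L2 ι, ∀ x i, Q x i = if p (lam i) then x i else 0 := by
  obtain ⟨Q, -, hQ⟩ := exists_diag (fun i : ι => if p (lam i) then (1 : ℝ) else 0) (C := 1)
    zero_le_one (fun i => by split_ifs <;> simp)
  exact ⟨Q, fun x i => by rw [hQ]; split_ifs <;> simp⟩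

variable [DecidableEq ι]

/-- The intertwining identity is known only on coordinate vectors and is summed against `y`.
Replacing `lam j * y j` by the coordinates of `z - D y`, an element of `l²`, makes every series
converge. -/
theorem Acts.conj
    (hXD : ∀ i j, lam i * X (ev j) i - X (ev j) i * lam j + R (ev j) i + R (X (ev j)) i =
      D (ev j) i + X (D (ev j)) i)
    {y z : L2 ι} (h : Acts lam D y z) : Acts lam R (y + X y) (z + X z) := by
  intro i
  have hz : D y i = z i - lam i * y i := by have := h i; linarith
  have s1 := (hasSum_entries X y i).mul_left (lam i : ℝ)
  have s2 := hasSum_entries R y i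
  have s3 := hasSum_entries (R * X) y i
  have s4 := hasSum_entries D y i
  have s5 := hasSum_entries (X * D) y i
  have s6 := hasSum_entries X (z - D y) i
  have h1 := (((s1.add s2).add s3).sub s4).sub s5
  have h2 : (fun j => (lam i : ℝ) * (X (ev j) i * y j) + R (ev j) i * y j + (R * X) (ev j) i * y j -
      D (ev j) i * y j - (X * D) (ev j) i * y j) = fun j => X (ev j) i * (z - D y : L2 ι) j := by
    funext j
    have h3 := hXD i j
    have h4 : (z - D y : L2 ι) j = lam j * y j := by
      have := h j
      simp only [lp.coeFn_sub, Pi.sub_apply]; linarith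
    rw [h4]
    simp only [mul_apply_eq_comp]
    linear_combination y j * h3
  rw [h2] at h1
  have h3 := h1.unique s6
  simp only [mul_apply_eq_comp, map_sub, lp.coeFn_sub, Pi.sub_apply] at h3
  simp only [map_add, lp.coeFn_add, Pi.add_apply]
  linarith

/-- `Acts.conj` gives one inclusion of domains; this is the converse. Solve the equation of `D` at
the point `1/2` and transport the solution by `T`. It differs from `x` by an eigenvector of
`diag(lam) + R` for `1/2`, hence by zero. -/
theorem Acts.of_conj
    (hXD : ∀ i j, lam i * X (ev j) i - X (ev j) i * lam j + R (ev j) i + R (X (ev j)) i =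
      D (ev j) i + X (D (ev j)) i)
    (hR : ‖R‖ < 1 / 2) (hD : ‖D‖ < 1 / 2) (T : L2 ι ≃L[ℝ] L2 ι)
    (hT : ∀ x, T x = x + X x) {x z : L2 ι} (h : Acts lam R x z) :
    Acts lam D (T.symm x) (T.symm z) := by
  obtain ⟨y, hy⟩ := exists_acts_sub_half (lam := lam) hD (T.symm (z - (1 / 2 : ℝ) • x))
  have h1 := hy.conj hXD
  rw [← hT, ← hT, map_add, T.apply_symm_apply, map_smul] at h1
  have h2 : Acts lam R (T y - x) ((1 / 2 : ℝ) • (T y - x)) := by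
    have := h1.sub h
    convert this using 1
    module
  have h3 : T y = x := sub_eq_zero.1 (h2.eq_zero_of_half hR)
  have h4 : y = T.symm x := by rw [← h3, T.symm_apply_apply]
  rw [← h4]
  convert hy using 1
  rw [map_sub, map_smul, ← h4]
  module

/-- The perturbed operator preserves the spectral blocks. -/
theorem Acts.restrict (hD : ∀ i j, lam i ≠ lam j → D (ev j) i = 0) {Q : L2 ι →L[ℝ] L2 ι}
    {p : ℤ → Prop} [DecidablePred p] (hQ : ∀ x i, Q x i = if p (lam i) then x i else 0)
    {y z : L2 ι} (h : Acts lam D y z) : Acts lam D (Q y) (Q z) := by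
  intro i
  have h1 : D (Q y) i = if p (lam i) then D y i else 0 := by
    refine (hasSum_entries D (Q y) i).unique ?_
    split_ifs with hi
    · convert! hasSum_entries D y i using 2 with j
      rw [hQ]
      by_cases hij : lam i = lam j
      · rw [if_pos (hij ▸ hi)]
      · rw [hD i j hij, zero_mul, zero_mul]
    · convert! hasSum_zero using 2 with j
      rw [hQ]
      by_cases hij : lam i = lam j
      · rw [if_neg (hij ▸ hi), mul_zero]
      · rw [hD i j hij, zero_mul]
  rw [h1, hQ, hQ]
  have := h i
  split_ifs <;> simp [this]

/-- On the block of energy `lam i`, an eigenvector for `ν` is an eigenvector of `D` for `ν - lam i`,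
a number larger than `‖D‖`. -/
theorem Acts.apply_eq_zero (hD : ∀ i j, lam i ≠ lam j → D (ev j) i = 0) (hDn : ‖D‖ < 1 / 2)
    {y : L2 ι} {ν : ℝ} (h : Acts lam D y (ν • y)) {i : ι} (hi : 1 / 2 ≤ |(lam i : ℝ) - ν|) :
    y i = 0 := by
  obtain ⟨Q, hQ⟩ := exists_block_projection lam (fun k => k = lam i)
  have h1 := h.restrict (p := fun k => k = lam i) hD hQ
  have h2 : D (Q y) = (ν - lam i) • Q y := by
    ext j
    have := h1 j
    simp only [map_smul, lp.coeFn_smul, Pi.smul_apply, smul_eq_mul] at this ⊢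
    by_cases hj : lam j = lam i
    · rw [hj] at this; linarith
    · have h3 : Q y j = 0 := by rw [hQ, if_neg hj]
      rw [h3] at this ⊢
      linarith
  have h3 := D.le_opNorm (Q y)
  rw [h2, norm_smul, Real.norm_eq_abs, abs_sub_comm] at h3
  have h4 : Q y = 0 := by
    by_contra hne
    have := norm_pos_iff.2 hne
    nlinarith
  have := hQ y i
  rw [h4, if_pos rfl] at this
  exact this.symm

end Acts
end DarkSoliton

namespace DarkSoliton

/-! ### Riesz bases up to scalar factors. -/

section Riesz

variable {ι E : Type*} [NormedAddCommGroup E] [InnerProductSpace ℝ E]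

/-- `v` consists of nonzero multiples of the image of a Hilbert basis under a bounded invertible
operator. -/
def IsScaledRieszBasis (v : ι → E) : Prop :=
  ∃ (b : HilbertBasis ι ℝ E) (T : E ≃L[ℝ] E) (c : ι → ℝ), (∀ i, c i ≠ 0) ∧ ∀ i, v i = c i • T (b i)

theorem IsScaledRieszBasis.smul {v w : ι → E} (h : IsScaledRieszBasis v) {c : ι → ℝ}
    (hc : ∀ i, c i ≠ 0) (hw : ∀ i, w i = c i • v i) : IsScaledRieszBasis w := by
  obtain ⟨b, T, d, hd, hv⟩ := h
  exact ⟨b, T, fun i => c i * d i, fun i => mul_ne_zero (hc i) (hd i), fun i => by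
    rw [hw, hv, smul_smul]⟩

/-- Reindexing of a Hilbert basis. -/
theorem exists_hilbertBasis_reindex {κ : Type*} [CompleteSpace E] (b : HilbertBasis ι ℝ E)
    (e : κ ≃ ι) : ∃ b' : HilbertBasis κ ℝ E, ∀ k, b' k = b (e k) := by
  have ho : Orthonormal ℝ (fun k => b (e k)) := b.orthonormal.comp e e.injective
  refine ⟨HilbertBasis.mk ho ?_, fun k => by rw [HilbertBasis.coe_mk]⟩
  have : Set.range (fun k => b (e k)) = Set.range b := e.surjective.range_comp b
  rw [this, b.dense_span]

theorem IsScaledRieszBasis.reindex {κ : Type*} [CompleteSpace E] {v : ι → E}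
    (h : IsScaledRieszBasis v) (e : κ ≃ ι) : IsScaledRieszBasis (fun k => v (e k)) := by
  obtain ⟨b, T, d, hd, hv⟩ := h
  obtain ⟨b', hb'⟩ := exists_hilbertBasis_reindex b e
  exact ⟨b', T, fun k => d (e k), fun k => hd _, fun k => by rw [hb']; exact hv _⟩

theorem IsScaledRieszBasis.isUnconditionalBasis {v : ι → E} (h : IsScaledRieszBasis v) :
    IsUnconditionalBasis v := by
  classical
  obtain ⟨b, T, d, hd, hv⟩ := h
  let u := b.toUnconditionalSchauderBasis
  refine ⟨{ basis := v
            coord := fun i => (d i)⁻¹ • (u.coord i).comp (T.symm : E →L[ℝ] E)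
            ortho := fun i j => ?_
            expansion := fun x => ?_ }, fun i => rfl⟩
  · have := u.ortho i j
    simp only [hv, smul_apply, ContinuousLinearMap.comp_apply, map_smul,
      ContinuousLinearEquiv.coe_coe, T.symm_apply_apply]
    have hub : u.basis j = b j := rfl
    rw [← hub, this]
    rcases eq_or_ne i j with rfl | hij
    · simp [hd]
    · simp [hij]
  · have := (T : E →L[ℝ] E).hasSum (u.expansion (T.symm x))
    simp only [map_smul, ContinuousLinearEquiv.coe_coe, T.apply_symm_apply] at this
    convert this using 2 with i
    have hub : u.basis i = b i := rfl
    rw [hv, hub, smul_apply, ContinuousLinearMap.comp_apply, smul_smul, smul_eq_mul,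
      ContinuousLinearEquiv.coe_coe, mul_right_comm, inv_mul_cancel₀ (hd i), one_mul]

theorem exists_diag_equiv (b : HilbertBasis ι ℝ E) (f : ι → ℝ) {m C : ℝ} (hm : 0 < m)
    (hf : ∀ i, m ≤ |f i|) (hC : ∀ i, |f i| ≤ C) :
    ∃ S : E ≃L[ℝ] E, ∀ i, S (b i) = f i • b i := by
  classical
  have hf0 (i : ι) : f i ≠ 0 := fun h => by
    have := hf i; rw [h, abs_zero] at this; linarith
  obtain ⟨S, -, hS⟩ := exists_diag f (C := |C|) (abs_nonneg _) (fun i => (hC i).trans (le_abs_self _))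
  obtain ⟨S', -, hS'⟩ := exists_diag (fun i => (f i)⁻¹) (C := m⁻¹) (by positivity) (fun i => by
    rw [abs_inv]; exact inv_anti₀ hm (hf i))
  have h1 : ∀ x, S' (S x) = x := fun x => by ext i; rw [hS', hS, inv_mul_cancel_left₀ (hf0 i)]
  have h2 : ∀ x, S (S' x) = x := fun x => by ext i; rw [hS, hS', mul_inv_cancel_left₀ (hf0 i)]
  let e := ContinuousLinearEquiv.equivOfInverse S S' h1 h2
  let r := b.repr.toContinuousLinearEquiv
  refine ⟨(r.trans e).trans r.symm, fun i => ?_⟩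
  change b.repr.symm (S (b.repr (b i))) = f i • b i
  rw [b.repr_self, ← b.repr_symm_single, ← map_smul]
  congr 1
  ext j
  rw [hS]
  rcases eq_or_ne j i with rfl | hj
  · simp
  · simp [hj]

/-- After normalisation the scalar at `i` has absolute value `‖T bᵢ‖⁻¹`. These numbers lie between
two positive constants because `T` and `T⁻¹` are bounded, so the diagonal operator they define is
invertible and is absorbed into `T`. -/
theorem IsScaledRieszBasis.isRieszBasis {v : ι → E} (h : IsScaledRieszBasis v) :
    IsRieszBasis (fun i => ‖v i‖⁻¹ • v i) := by
  obtain ⟨b, T, d, hd, hv⟩ := h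
  rcases isEmpty_or_nonempty ι with hι | ⟨⟨i₀⟩⟩
  · exact ⟨b, T, fun i => hι.elim i⟩
  have hb (i : ι) : ‖b i‖ = 1 := b.orthonormal.1 i
  have hlow (i : ι) : 1 ≤ ‖(T.symm : E →L[ℝ] E)‖ * ‖T (b i)‖ := by
    have := (T.symm : E →L[ℝ] E).le_opNorm (T (b i))
    rwa [ContinuousLinearEquiv.coe_coe, T.symm_apply_apply, hb] at this
  have hup (i : ι) : ‖T (b i)‖ ≤ ‖(T : E →L[ℝ] E)‖ := by
    have := (T : E →L[ℝ] E).le_opNorm (b i)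
    rwa [ContinuousLinearEquiv.coe_coe, hb, mul_one] at this
  have hTpos (i : ι) : 0 < ‖T (b i)‖ := by
    by_contra h
    have h1 : ‖T (b i)‖ = 0 := le_antisymm (not_lt.1 h) (norm_nonneg _)
    have := hlow i
    rw [h1] at this; linarith
  have hpos : 0 < ‖(T : E →L[ℝ] E)‖ := (hTpos i₀).trans_le (hup i₀)
  have habs (i : ι) : |‖v i‖⁻¹ * d i| = ‖T (b i)‖⁻¹ := by
    rw [hv, norm_smul, mul_inv, Real.norm_eq_abs, abs_mul, abs_mul, abs_inv, abs_inv, abs_abs,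
      abs_norm, mul_right_comm, inv_mul_cancel₀ (abs_ne_zero.2 (hd i)), one_mul]
  obtain ⟨S, hS⟩ := exists_diag_equiv b (fun i => ‖v i‖⁻¹ * d i) (m := ‖(T : E →L[ℝ] E)‖⁻¹)
    (C := ‖(T.symm : E →L[ℝ] E)‖) (inv_pos.2 hpos)
    (fun i => by rw [habs]; exact inv_anti₀ (hTpos i) (hup i))
    (fun i => by
      rw [habs, inv_eq_one_div, div_le_iff₀ (hTpos i)]; exact hlow i)
  refine ⟨b, S.trans T, fun i => ?_⟩
  rw [ContinuousLinearEquiv.trans_apply, hS, map_smul, mul_smul, ← hv]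

end Riesz

/-! ### Change of basis in finitely many coordinates. -/

section FiniteChange

variable {ι : Type*} [DecidableEq ι]

/-- A change of basis inside the span of finitely many coordinate vectors. -/
theorem exists_finite_change (F : Finset ι) (w : ι → L2 ι)
    (hw : ∀ i ∈ F, ∀ j ∉ F, w i j = 0)
    (hli : ∀ z : ι → ℝ, ∑ i ∈ F, z i • w i = 0 → ∀ i ∈ F, z i = 0) :
    ∃ U : L2 ι ≃L[ℝ] L2 ι, (∀ i ∈ F, U (ev i) = w i) ∧ (∀ i ∉ F, U (ev i) = ev i) ∧
      ∀ x, ∀ i ∉ F, U x i = x i := by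
  let U : L2 ι →L[ℝ] L2 ι := 1 + ∑ i ∈ F, (coordCLM i).smulRight (w i - ev i)
  have hU (x : L2 ι) : U x = x + ∑ i ∈ F, x i • (w i - ev i) := by
    simp [U]
  have hoff (x : L2 ι) (i : ι) (hi : i ∉ F) : U x i = x i := by
    rw [hU, ← coordCLM_apply, map_add, map_sum]
    rw [Finset.sum_eq_zero, add_zero, coordCLM_apply]
    intro j hj
    rw [map_smul, map_sub, coordCLM_apply, coordCLM_apply, hw j hj i hi,
      ev_ne (by rintro rfl; exact hi hj)]
    simp
  have hUF (x : L2 ι) (hx : ∀ i ∉ F, x i = 0) : U x = ∑ i ∈ F, x i • w i := by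
    have h1 : x = ∑ i ∈ F, x i • ev i := by
      ext j
      have := finVec_apply F x j
      rw [finVec] at this
      rw [this]
      split_ifs with h
      · rfl
      · exact hx j h
    have h2 : ∑ i ∈ F, x i • (w i - ev i) = ∑ i ∈ F, x i • w i - x := by
      conv_rhs => rw [h1]
      rw [← Finset.sum_sub_distrib]
      refine Finset.sum_congr rfl fun i hi => ?_
      have h3 : (∑ i ∈ F, x i • ev i : L2 ι) i = x i := by rw [← h1]
      rw [smul_sub, h3]
    rw [hU, h2]; abel
  have hinj : Function.Injective U := by
    rw [injective_iff_map_eq_zero]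
    intro x hx
    have h1 : ∀ i ∉ F, x i = 0 := fun i hi => by rw [← hoff x i hi, hx]; rfl
    have h2 := hli x ((hUF x h1).symm.trans hx)
    ext i
    by_cases hi : i ∈ F
    · exact h2 i hi
    · exact h1 i hi
  -- The action of `U` on the span of `F`, where injectivity yields surjectivity by finite
  -- dimension.
  let N : (F → ℝ) →ₗ[ℝ] (F → ℝ) :=
    { toFun := fun z i => ∑ j : F, z j * w j i
      map_add' := fun a b => by ext i; simp [add_mul, Finset.sum_add_distrib]
      map_smul' := fun c a => by ext i; simp [mul_assoc, Finset.mul_sum] }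
  have hN : Function.Injective N := by
    rw [injective_iff_map_eq_zero]
    intro z hz
    let z' : ι → ℝ := fun i => if h : i ∈ F then z ⟨i, h⟩ else 0
    have hz' (i : F) : z' i = z i := by simp [z']
    have h1 : ∑ i ∈ F, z' i • w i = 0 := by
      ext k
      rw [← coordCLM_apply, map_sum]
      simp only [map_smul, coordCLM_apply, smul_eq_mul]
      by_cases hk : k ∈ F
      · rw [← Finset.sum_coe_sort]
        have := congrFun hz ⟨k, hk⟩
        simp only [hz']
        exact this
      · exact Finset.sum_eq_zero fun i hi => by rw [hw i hi k hk, mul_zero]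
    ext i
    rw [← hz']
    exact hli z' h1 i i.2
  have hNs : Function.Surjective N := LinearMap.injective_iff_surjective.1 hN
  have hsurj : Function.Surjective U := by
    intro y
    -- The coordinates outside `F` are matched by `y - finVec F y` itself, since `U` preserves them;
    -- the remainder `y'` is supported in `F`.
    let y' := y - U (y - finVec F y)
    have hy' : ∀ i ∉ F, y' i = 0 := fun i hi => by
      simp only [y', lp.coeFn_sub, Pi.sub_apply]
      rw [hoff _ i hi]
      simp [finVec_apply, hi]
    obtain ⟨z, hz⟩ := hNs (fun i => y' i)
    let z' : ι → ℝ := fun i => if h : i ∈ F then z ⟨i, h⟩ else 0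
    have hz' (i : F) : z' i = z i := by simp [z']
    refine ⟨finVec F z' + (y - finVec F y), ?_⟩
    have h1 : U (finVec F z') = y' := by
      rw [hUF _ (fun i hi => by simp [finVec_apply, hi])]
      ext k
      rw [← coordCLM_apply, map_sum]
      simp only [map_smul, coordCLM_apply, smul_eq_mul]
      by_cases hk : k ∈ F
      · rw [← Finset.sum_coe_sort]
        have := congrFun hz ⟨k, hk⟩
        simp only [finVec_apply, Finset.coe_mem, if_true, hz']
        exact this
      · rw [hy' k hk]
        exact Finset.sum_eq_zero fun i hi => by rw [hw i hi k hk, mul_zero]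
    rw [map_add, h1]
    simp [y']
  let e := ContinuousLinearEquiv.ofBijective U (LinearMap.ker_eq_bot.2 hinj)
    (LinearMap.range_eq_top.2 hsurj)
  refine ⟨e, fun i hi => ?_, fun i hi => ?_, hoff⟩
  · change U (ev i) = w i
    rw [hU, Finset.sum_eq_single i]
    · simp
    · intro j _ hj; simp [ev_ne hj]
    · exact fun h => (h hi).elim
  · change U (ev i) = ev i
    rw [hU, Finset.sum_eq_zero, add_zero]
    intro j hj
    rw [ev_ne (by rintro rfl; exact hi hj), zero_smul]

end FiniteChange
end DarkSoliton

namespace DarkSoliton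

/-! ### Hermite functions: ladder relations, orthonormality, Sobolev embedding. -/

section Hermite

open MeasureTheory

theorem derivative_hermite_succ (n : ℕ) :
    Polynomial.derivative (Polynomial.hermite (n + 1)) = (n + 1 : ℕ) * Polynomial.hermite n := by
  induction n with
  | zero => simp
  | succ n ih =>
    conv_lhs => rw [Polynomial.hermite_succ (n + 1)]
    rw [Polynomial.derivative_sub, Polynomial.derivative_mul, ih, Polynomial.derivative_mul,
      Polynomial.derivative_X, Polynomial.derivative_natCast, Polynomial.hermite_succ n]
    push_cast
    ring

/-- The matrix elements `√(n/2)` of position and derivative in the Hermite basis. -/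
noncomputable def lad (n : ℕ) : ℝ := √((n : ℝ) / 2)

@[simp] theorem lad_zero : lad 0 = 0 := by simp [lad]

theorem lad_sq (n : ℕ) : lad n ^ 2 = n / 2 := Real.sq_sqrt (by positivity)

theorem lad_succ_pos (n : ℕ) : 0 < lad (n + 1) := Real.sqrt_pos.2 (by positivity)

/-- The normalising constant of the Hermite functions in probabilists' form. -/
noncomputable def hnorm (n : ℕ) : ℝ := (√((n.factorial : ℝ) * √Real.pi))⁻¹

theorem hermiteFun_eq (n : ℕ) (x : ℝ) : hermiteFun n x =
    hnorm n * Polynomial.aeval (√2 * x) (Polynomial.hermite n) * Real.exp (-x ^ 2 / 2) := by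
  have h1 : √(2 ^ n * (n.factorial : ℝ) * √Real.pi) = √2 ^ n * √((n.factorial : ℝ) * √Real.pi) := by
    have h0 : (2 : ℝ) ^ n = (√2 ^ n) ^ 2 := by
      rw [← pow_mul, mul_comm, pow_mul, Real.sq_sqrt (by norm_num)]
    rw [mul_assoc, Real.sqrt_mul (by positivity), h0, Real.sqrt_sq (by positivity)]
  have h2 : √2 ^ n ≠ 0 := by positivity
  have h3 : √((n.factorial : ℝ) * √Real.pi) ≠ 0 := by
    have := Real.pi_pos
    positivity
  rw [hermiteFun, physHermite, h1, hnorm]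
  field_simp

theorem hnorm_succ (n : ℕ) : √((n : ℝ) + 1) * hnorm (n + 1) = hnorm n := by
  have h : ((n + 1).factorial : ℝ) * √Real.pi = ((n : ℝ) + 1) * ((n.factorial : ℝ) * √Real.pi) := by
    rw [Nat.factorial_succ]; push_cast; ring
  have h2 : √((n : ℝ) + 1) ≠ 0 := by positivity
  rw [hnorm, hnorm, h, Real.sqrt_mul (by positivity), mul_inv, mul_inv_cancel_left₀ h2]

theorem sqrt_eq_lad (n : ℕ) : √((n : ℝ) + 1) = √2 * lad (n + 1) := by
  rw [lad, ← Real.sqrt_mul (by norm_num)]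
  congr 1; push_cast; ring

/-- The position operator in the Hermite basis. -/
theorem mul_hermiteFun (n : ℕ) (x : ℝ) :
    x * hermiteFun n x = lad n * hermiteFun (n - 1) x + lad (n + 1) * hermiteFun (n + 1) x := by
  have h2 : √2 * √2 = 2 := Real.mul_self_sqrt (by norm_num)
  cases n with
  -- Here `n - 1` is the truncated `0`; this is harmless since `lad 0 = 0`.
  | zero =>
    have h := hnorm_succ 0
    rw [sqrt_eq_lad] at h
    simp only [lad_zero, zero_mul, zero_add, hermiteFun_eq]
    simp only [Polynomial.hermite_zero, Polynomial.hermite_one, Polynomial.aeval_X, zero_add,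
      map_one] at h ⊢
    linear_combination (x * Real.exp (-x ^ 2 / 2)) * (-h) 
  | succ n =>
    have h := hnorm_succ n
    have h' := hnorm_succ (n + 1)
    have hr : Polynomial.aeval (√2 * x) (Polynomial.hermite (n + 2)) =
        √2 * x * Polynomial.aeval (√2 * x) (Polynomial.hermite (n + 1)) -
        (n + 1) * Polynomial.aeval (√2 * x) (Polynomial.hermite n) := by
      rw [Polynomial.hermite_succ (n + 1), derivative_hermite_succ]
      simp
    rw [sqrt_eq_lad] at h h'
    have hl := lad_sq (n + 1)
    push_cast at hl
    simp only [hermiteFun_eq, hr, Nat.add_sub_cancel]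
    rw [← h, ← h'] 
    set E := Real.exp (-x ^ 2 / 2)
    set a := Polynomial.aeval (√2 * x) (Polynomial.hermite (n + 1))
    set b := Polynomial.aeval (√2 * x) (Polynomial.hermite n)
    have hl2 : (n : ℝ) + 1 = 2 * lad (n + 1) ^ 2 := by linarith
    rw [hl2]
    linear_combination -(lad (n + 1 + 1) * hnorm (n + 1 + 1) * E * lad (n + 1) ^ 2 * b) * h2

theorem hasDerivAt_hermiteFun (n : ℕ) (x : ℝ) : HasDerivAt (hermiteFun n)
    (lad n * hermiteFun (n - 1) x - lad (n + 1) * hermiteFun (n + 1) x) x := by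
  have h2 : √2 * √2 = 2 := Real.mul_self_sqrt (by norm_num)
  have hp : HasDerivAt (fun y : ℝ => Polynomial.aeval (√2 * y) (Polynomial.hermite n))
      (Polynomial.aeval (√2 * x) (Polynomial.derivative (Polynomial.hermite n)) * √2) x := by
    have h := (Polynomial.hermite n).hasDerivAt_aeval (√2 * x)
    have h' : HasDerivAt (fun y : ℝ => √2 * y) √2 x := by
      simpa using (hasDerivAt_id x).const_mul √2
    exact h.comp x h'
  have he : HasDerivAt (fun y : ℝ => Real.exp (-y ^ 2 / 2)) (Real.exp (-x ^ 2 / 2) * (-x)) x := by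
    have h : HasDerivAt (fun y : ℝ => -y ^ 2 / 2) (-x) x := by
      have := ((hasDerivAt_pow 2 x).neg).div_const 2
      refine this.congr_deriv ?_
      simp; ring
    exact h.exp
  have h := (hp.const_mul (hnorm n)).mul he
  have hfun : hermiteFun n = fun y => hnorm n * Polynomial.aeval (√2 * y) (Polynomial.hermite n) *
      Real.exp (-y ^ 2 / 2) := funext fun y => hermiteFun_eq n y
  rw [hfun]
  refine h.congr_deriv ?_
  have hx := mul_hermiteFun n x
  rw [hermiteFun_eq n] at hx
  have key : hnorm n * (Polynomial.aeval (√2 * x) (Polynomial.derivative (Polynomial.hermite n)) * √2)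
      * Real.exp (-x ^ 2 / 2) = 2 * lad n * hermiteFun (n - 1) x := by
    cases n with
    | zero => simp
    | succ n =>
      have h := hnorm_succ n
      rw [sqrt_eq_lad] at h
      have hl := lad_sq (n + 1)
      push_cast at hl
      rw [derivative_hermite_succ, Nat.add_sub_cancel, hermiteFun_eq, ← h]
      simp only [map_mul, map_natCast]
      push_cast
      have hl2 : (n : ℝ) + 1 = 2 * lad (n + 1) ^ 2 := by linarith
      rw [hl2]; ring
  linear_combination key - hx

theorem continuous_hermiteFun (n : ℕ) : Continuous (hermiteFun n) :=
  continuous_iff_continuousAt.2 fun x => (hasDerivAt_hermiteFun n x).continuousAt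

theorem integrable_eval_mul_exp (P : Polynomial ℝ) {b : ℝ} (hb : 0 < b) :
    Integrable fun x : ℝ => P.eval x * Real.exp (-b * x ^ 2) := by
  simp_rw [Polynomial.eval_eq_sum_range, Finset.sum_mul]
  refine integrable_finsetSum _ fun k _ => ?_
  have h := (integrable_rpow_mul_exp_neg_mul_sq hb (s := k)
    (lt_of_lt_of_le (by norm_num) (Nat.cast_nonneg k))).const_mul (P.coeff k)
  simpa [Real.rpow_natCast, mul_assoc] using h

theorem hermiteFun_eq_eval (n : ℕ) : ∃ P : Polynomial ℝ, ∀ x,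
    hermiteFun n x = P.eval x * Real.exp (-x ^ 2 / 2) := by
  refine ⟨Polynomial.C (hnorm n) *
    ((Polynomial.hermite n).map (Int.castRingHom ℝ)).comp (Polynomial.C √2 * Polynomial.X),
    fun x => ?_⟩
  rw [hermiteFun_eq]
  simp [Polynomial.aeval_def, Polynomial.eval_map]

theorem integrable_hermiteFun_mul (n m : ℕ) :
    Integrable fun x => hermiteFun n x * hermiteFun m x := by
  obtain ⟨P, hP⟩ := hermiteFun_eq_eval n
  obtain ⟨Q, hQ⟩ := hermiteFun_eq_eval m
  convert! integrable_eval_mul_exp (P * Q) one_pos using 2 with x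
  rw [hP, hQ, Polynomial.eval_mul]
  have : Real.exp (-1 * x ^ 2) = Real.exp (-x ^ 2 / 2) * Real.exp (-x ^ 2 / 2) := by
    rw [← Real.exp_add]; ring_nf
  rw [this]; ring

/-- Integration by parts for the Hermite functions. -/
theorem integral_deriv_mul_hermiteFun (m n : ℕ) :
    lad m * (∫ x, hermiteFun (m - 1) x * hermiteFun n x) -
      lad (m + 1) * (∫ x, hermiteFun (m + 1) x * hermiteFun n x) +
      (lad n * (∫ x, hermiteFun m x * hermiteFun (n - 1) x) -
      lad (n + 1) * (∫ x, hermiteFun m x * hermiteFun (n + 1) x)) = 0 := by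
  have i1 := (integrable_hermiteFun_mul (m - 1) n).const_mul (lad m)
  have i2 := (integrable_hermiteFun_mul (m + 1) n).const_mul (lad (m + 1))
  have i3 := (integrable_hermiteFun_mul m (n - 1)).const_mul (lad n)
  have i4 := (integrable_hermiteFun_mul m (n + 1)).const_mul (lad (n + 1))
  have h := integral_eq_zero_of_hasDerivAt_of_integrable
    (fun x => (hasDerivAt_hermiteFun m x).mul (hasDerivAt_hermiteFun n x))
    (by
      convert! ((i1.sub i2).add (i3.sub i4)) using 2 with x
      simp only [Pi.add_apply, Pi.sub_apply]
      ring)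
    (integrable_hermiteFun_mul m n)
  rw [← h, ← integral_const_mul, ← integral_const_mul, ← integral_const_mul, ← integral_const_mul,
    ← integral_sub i1 i2, ← integral_sub i3 i4]
  refine (integral_add (i1.sub i2) (i3.sub i4)).symm.trans ?_
  exact integral_congr_ae (Filter.Eventually.of_forall fun x => by simp only [Pi.sub_apply]; ring)

theorem integral_mul_hermiteFun_comm (m n : ℕ) :
    lad m * (∫ x, hermiteFun (m - 1) x * hermiteFun n x) +
      lad (m + 1) * (∫ x, hermiteFun (m + 1) x * hermiteFun n x) =
      lad n * (∫ x, hermiteFun m x * hermiteFun (n - 1) x) +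
      lad (n + 1) * (∫ x, hermiteFun m x * hermiteFun (n + 1) x) := by
  have i1 := (integrable_hermiteFun_mul (m - 1) n).const_mul (lad m)
  have i2 := (integrable_hermiteFun_mul (m + 1) n).const_mul (lad (m + 1))
  have i3 := (integrable_hermiteFun_mul m (n - 1)).const_mul (lad n)
  have i4 := (integrable_hermiteFun_mul m (n + 1)).const_mul (lad (n + 1))
  rw [← integral_const_mul, ← integral_const_mul, ← integral_const_mul, ← integral_const_mul,
    ← integral_add i1 i2, ← integral_add i3 i4]
  refine integral_congr_ae (Filter.Eventually.of_forall fun x => ?_)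
  simp only []
  linear_combination hermiteFun m x * mul_hermiteFun n x - hermiteFun n x * mul_hermiteFun m x

theorem hermiteFun_zero (x : ℝ) : hermiteFun 0 x = (√√Real.pi)⁻¹ * Real.exp (-x ^ 2 / 2) := by
  simp [hermiteFun_eq, hnorm]

/-- Integration by parts and the symmetry of the position operator combine to the adjointness of
lowering and raising. This moves both indices down together until one of them is `0`, where `lad 0 =
0` gives orthogonality and a Gaussian integral gives the norm. -/
theorem integral_hermiteFun_mul (m n : ℕ) :
    ∫ x, hermiteFun m x * hermiteFun n x = if m = n then 1 else 0 := by
  have hlad (m n : ℕ) : lad m * (∫ x, hermiteFun (m - 1) x * hermiteFun n x) =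
      lad (n + 1) * (∫ x, hermiteFun m x * hermiteFun (n + 1) x) := by
    linarith [integral_deriv_mul_hermiteFun m n, integral_mul_hermiteFun_comm m n]
  have h0 (n : ℕ) : ∫ x, hermiteFun 0 x * hermiteFun (n + 1) x = 0 := by
    have h := hlad 0 n
    rw [lad_zero, zero_mul] at h
    exact (mul_eq_zero.1 h.symm).resolve_left (lad_succ_pos n).ne'
  induction m generalizing n with
  | zero =>
    cases n with
    | zero =>
      have hpi := Real.pi_pos
      have h1 : ∀ x, hermiteFun 0 x * hermiteFun 0 x = (√Real.pi)⁻¹ * Real.exp (-1 * x ^ 2) := by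
        intro x
        have h2 : Real.exp (-1 * x ^ 2) = Real.exp (-x ^ 2 / 2) * Real.exp (-x ^ 2 / 2) := by
          rw [← Real.exp_add]; ring_nf
        have h3 : (√√Real.pi)⁻¹ * (√√Real.pi)⁻¹ = (√Real.pi)⁻¹ := by
          rw [← mul_inv, Real.mul_self_sqrt (Real.sqrt_nonneg _)]
        rw [hermiteFun_zero, h2, ← h3]; ring
      simp_rw [h1]
      rw [integral_const_mul, integral_gaussian, div_one, if_pos trivial,
        inv_mul_cancel₀ (by positivity)]
    | succ n => simp [h0]
  | succ m ih =>
    cases n with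
    | zero =>
      simp_rw [mul_comm (hermiteFun (m + 1) _)]
      simp [h0]
    | succ n =>
      have h := hlad (m + 1) n
      rw [Nat.add_sub_cancel, ih n] at h
      have hn := (lad_succ_pos n).ne'
      by_cases hmn : m = n
      · subst hmn
        simp only [if_true, mul_one] at h ⊢
        exact mul_left_cancel₀ hn (by rw [mul_one]; exact h.symm)
      · rw [if_neg hmn, mul_zero] at h
        rw [if_neg (by omega)]
        exact (mul_eq_zero.1 h.symm).resolve_left hn

theorem integral_sum_mul_sum {s t : Finset ℕ} (a b : ℕ → ℝ) (f g : ℕ → ℕ) :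
    Integrable (fun x => (∑ n ∈ s, a n * hermiteFun (f n) x) * ∑ m ∈ t, b m * hermiteFun (g m) x) ∧
    ∫ x, (∑ n ∈ s, a n * hermiteFun (f n) x) * ∑ m ∈ t, b m * hermiteFun (g m) x =
      ∑ n ∈ s, ∑ m ∈ t, a n * b m * if f n = g m then 1 else 0 := by
  have h (x : ℝ) : (∑ n ∈ s, a n * hermiteFun (f n) x) * ∑ m ∈ t, b m * hermiteFun (g m) x =
      ∑ n ∈ s, ∑ m ∈ t, a n * b m * (hermiteFun (f n) x * hermiteFun (g m) x) := by
    rw [Finset.sum_mul_sum]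
    exact Finset.sum_congr rfl fun n _ => Finset.sum_congr rfl fun m _ => by ring
  simp_rw [h]
  have hi (n m : ℕ) : Integrable fun x => a n * b m * (hermiteFun (f n) x * hermiteFun (g m) x) :=
    (integrable_hermiteFun_mul _ _).const_mul _
  refine ⟨integrable_finsetSum _ fun n _ => integrable_finsetSum _ fun m _ => hi n m, ?_⟩
  rw [integral_finsetSum _ fun n _ => integrable_finsetSum _ fun m _ => hi n m]
  refine Finset.sum_congr rfl fun n _ => ?_
  rw [integral_finsetSum _ fun m _ => hi n m]
  refine Finset.sum_congr rfl fun m _ => ?_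
  rw [integral_const_mul, integral_hermiteFun_mul]

theorem integral_sum_sq {s : Finset ℕ} (a : ℕ → ℝ) (f : ℕ → ℕ)
    (hf : ∀ n m, a n ≠ 0 → a m ≠ 0 → f n = f m → n = m) :
    Integrable (fun x => (∑ n ∈ s, a n * hermiteFun (f n) x) ^ 2) ∧
    ∫ x, (∑ n ∈ s, a n * hermiteFun (f n) x) ^ 2 = ∑ n ∈ s, a n ^ 2 := by
  obtain ⟨h1, h2⟩ := integral_sum_mul_sum (s := s) (t := s) a a f f
  simp_rw [sq]
  refine ⟨h1, h2.trans (Finset.sum_congr rfl fun n hn => ?_)⟩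
  rw [Finset.sum_eq_single n]
  · simp
  · intro m _ hmn
    by_cases han : a n = 0
    · simp [han]
    by_cases ham : a m = 0
    · simp [ham]
    rw [if_neg fun h => hmn (hf n m han ham h).symm, mul_zero]
  · exact fun h => (h hn).elim

/-- `u(x)² = ∫_{-∞}^x 2uu'`, and `2uu' ≤ u² + u'²`. -/
theorem sq_le_integral {u u' : ℝ → ℝ} (hu : ∀ x, HasDerivAt u (u' x) x)
    (h2 : Integrable fun x => u x ^ 2) (h2' : Integrable fun x => u' x ^ 2)
    (huu' : Integrable fun x => u x * u' x) (x : ℝ) :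
    u x ^ 2 ≤ (∫ x, u x ^ 2) + ∫ x, u' x ^ 2 := by
  have hd : ∀ y, HasDerivAt (fun y => u y ^ 2) (2 * (u y * u' y)) y := fun y => by
    refine ((hu y).pow 2).congr_deriv ?_
    simp; ring
  have ht := tendsto_zero_of_hasDerivAt_of_integrableOn_Iic (a := x) (fun y _ => hd y)
    (huu'.const_mul 2).integrableOn h2.integrableOn
  have h := integral_Iic_of_hasDerivAt_of_tendsto' (a := x) (fun y _ => hd y)
    (huu'.const_mul 2).integrableOn ht
  rw [sub_zero] at h
  rw [← h, ← integral_add h2 h2']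
  calc ∫ y in Set.Iic x, 2 * (u y * u' y)
      ≤ ∫ y in Set.Iic x, (u y ^ 2 + u' y ^ 2) :=
        setIntegral_mono (huu'.const_mul 2).integrableOn (h2.add h2').integrableOn
          fun y => by simp only []; nlinarith [sq_nonneg (u y - u' y)]
    _ ≤ _ := setIntegral_le_integral (h2.add h2') (Filter.Eventually.of_forall fun y => by
        simp only [Pi.zero_apply]; positivity)

/-- The embedding of the energy space into the bounded functions. -/
theorem sum_hermiteFun_sq_le (s : Finset ℕ) (a : ℕ → ℝ) (x : ℝ) :
    (∑ n ∈ s, a n * hermiteFun n x) ^ 2 ≤ 2 * ∑ n ∈ s, (1 + (n : ℝ)) * a n ^ 2 := by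
  have hu : ∀ x, HasDerivAt (fun x => ∑ n ∈ s, a n * hermiteFun n x)
      ((∑ n ∈ s, (a n * lad n) * hermiteFun (n - 1) x) -
        ∑ n ∈ s, (a n * lad (n + 1)) * hermiteFun (n + 1) x) x := fun x => by
    refine (HasDerivAt.fun_sum fun n _ => (hasDerivAt_hermiteFun n x).const_mul (a n)).congr_deriv ?_
    rw [← Finset.sum_sub_distrib]
    exact Finset.sum_congr rfl fun n _ => by ring
  obtain ⟨i1, e1⟩ := integral_sum_sq (s := s) a id (fun n m _ _ h => h)
  obtain ⟨i2, e2⟩ := integral_sum_sq (s := s) (fun n => a n * lad n) (fun n => n - 1)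
    (fun n m hn hm h => by
      have hn' : n ≠ 0 := by rintro rfl; simp at hn
      have hm' : m ≠ 0 := by rintro rfl; simp at hm
      omega)
  obtain ⟨i3, e3⟩ := integral_sum_sq (s := s) (fun n => a n * lad (n + 1)) (fun n => n + 1)
    (fun n m _ _ h => by omega)
  have i12 := (integral_sum_mul_sum (s := s) (t := s) a (fun n => a n * lad n) id (fun n => n - 1)).1
  have i13 := (integral_sum_mul_sum (s := s) (t := s) a (fun n => a n * lad (n + 1)) id
    (fun n => n + 1)).1
  have i23 := (integral_sum_mul_sum (s := s) (t := s) (fun n => a n * lad n)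
    (fun n => a n * lad (n + 1)) (fun n => n - 1) (fun n => n + 1)).1
  have h := sq_le_integral hu i1 (by
    convert! (i2.add i3).sub (i23.const_mul 2) using 2 with y
    simp only [Pi.add_apply, Pi.sub_apply]; ring) (by
    convert! i12.sub i13 using 2 with y
    simp only [Pi.sub_apply, id]; ring) x
  refine h.trans ?_
  -- `(p - q)² ≤ 2p² + 2q²` avoids the cross terms of the lowering and raising parts. The
  -- coefficient of `aₙ²` becomes `1 + n + (n + 1) = 2(1 + n)`.
  have h4 : ∫ y, ((∑ n ∈ s, (a n * lad n) * hermiteFun (n - 1) y) -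
        ∑ n ∈ s, (a n * lad (n + 1)) * hermiteFun (n + 1) y) ^ 2 ≤
      2 * (∑ n ∈ s, (a n * lad n) ^ 2) + 2 * ∑ n ∈ s, (a n * lad (n + 1)) ^ 2 := by
    rw [← e2, ← e3, ← integral_const_mul, ← integral_const_mul,
      ← integral_add (i2.const_mul 2) (i3.const_mul 2)]
    refine integral_mono_of_nonneg (Filter.Eventually.of_forall fun y => sq_nonneg _)
      ((i2.const_mul 2).add (i3.const_mul 2)) (Filter.Eventually.of_forall fun y => ?_)
    simp only []
    nlinarith [sq_nonneg ((∑ n ∈ s, (a n * lad n) * hermiteFun (n - 1) y) +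
        ∑ n ∈ s, (a n * lad (n + 1)) * hermiteFun (n + 1) y)]
  have e1' : ∫ y, (∑ n ∈ s, a n * hermiteFun n y) ^ 2 = ∑ n ∈ s, a n ^ 2 := e1
  rw [e1']
  calc _ ≤ _ := add_le_add_right h4 _
    _ = _ := by
      simp only [Finset.mul_sum]
      rw [← Finset.sum_add_distrib, ← Finset.sum_add_distrib]
      refine Finset.sum_congr rfl fun n _ => ?_
      rw [mul_pow, mul_pow, lad_sq, lad_sq]
      push_cast; ring

/-- For the coefficients `φₙ(x)/(1 + n)` both the value at `x` and the energy equal the kernel `k`,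
so the embedding reads `k² ≤ 2k`. -/
theorem sum_kernel_le (s : Finset ℕ) (x : ℝ) :
    ∑ n ∈ s, ((√(1 + (n : ℝ)))⁻¹ * hermiteFun n x) ^ 2 ≤ 2 := by
  set k := ∑ n ∈ s, ((√(1 + (n : ℝ)))⁻¹ * hermiteFun n x) ^ 2 with hk
  have hn (n : ℕ) : (√(1 + (n : ℝ)))⁻¹ ^ 2 = (1 + (n : ℝ))⁻¹ := by
    rw [inv_pow, Real.sq_sqrt (by positivity)]
  have h := sum_hermiteFun_sq_le s (fun n => (1 + (n : ℝ))⁻¹ * hermiteFun n x) x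
  have h1 : ∑ n ∈ s, (1 + (n : ℝ))⁻¹ * hermiteFun n x * hermiteFun n x = k :=
    Finset.sum_congr rfl fun n _ => by rw [mul_pow, hn]; ring
  have h2 : ∑ n ∈ s, (1 + (n : ℝ)) * ((1 + (n : ℝ))⁻¹ * hermiteFun n x) ^ 2 = k :=
    Finset.sum_congr rfl fun n _ => by
      have : (1 + (n : ℝ)) ≠ 0 := by positivity
      rw [mul_pow, mul_pow, hn]; field_simp
  rw [h1, h2] at h
  by_contra! h3
  nlinarith

end Hermite
end DarkSoliton

namespace DarkSoliton

/-! ### Multiplication by products of energy-space functions, in the weighted coordinates `A n = wt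
n * a n`. -/

section Potential

open MeasureTheory

/-- The weights `(1 + n)^{-1/2}`. -/
noncomputable def wt (n : ℕ) : ℝ := (√(1 + (n : ℝ)))⁻¹

theorem wt_pos (n : ℕ) : 0 < wt n := inv_pos.2 (Real.sqrt_pos.2 (by positivity))

theorem wt_sq (n : ℕ) : wt n ^ 2 = (1 + (n : ℝ))⁻¹ := by
  rw [wt, inv_pow, Real.sq_sqrt (by positivity)]

/-- The evaluation functional at `x`, in weighted coordinates. -/
noncomputable def kvec (x : ℝ) : Ell2 :=
  ⟨fun n => wt n * hermiteFun n x, (memℓp_iff fun n => wt n * hermiteFun n x).2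
    (summable_of_sum_le (fun _ => sq_nonneg _) fun s => sum_kernel_le s x)⟩

theorem kvec_apply (x : ℝ) (n : ℕ) : kvec x n = wt n * hermiteFun n x := rfl

theorem norm_kvec_sq_le (x : ℝ) : ‖kvec x‖ ^ 2 ≤ 2 :=
  hasSum_le_of_sum_le (hasSum_sq (kvec x)) fun s => sum_kernel_le s x

theorem abs_inner_kvec_le (x : ℝ) (a : Ell2) : |inner ℝ (kvec x) a| ≤ √2 * ‖a‖ := by
  refine (abs_real_inner_le_norm _ _).trans ?_
  gcongr
  exact Real.le_sqrt_of_sq_le (norm_kvec_sq_le x)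

theorem measurable_inner_kvec (a : Ell2) : Measurable fun x => inner ℝ (kvec x) a := by
  have h (x : ℝ) : Filter.Tendsto (fun N => ∑ n ∈ Finset.range N, a n * (wt n * hermiteFun n x))
      Filter.atTop (nhds (inner ℝ (kvec x) a)) := by
    have := (lp.hasSum_inner (𝕜 := ℝ) (kvec x) a).tendsto_sum_nat
    simpa [kvec_apply] using this
  refine measurable_of_tendsto_metrizable (f := fun N x =>
    ∑ n ∈ Finset.range N, a n * (wt n * hermiteFun n x)) (fun N => ?_) (tendsto_pi_nhds.2 h)
  exact Finset.measurable_fun_sum _ fun n _ =>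
    ((continuous_hermiteFun n).measurable.const_mul _).const_mul _

/-- The matrix elements of multiplication by the product of two functions of the energy space. -/
noncomputable def potEntry (a b : Ell2) (n m : ℕ) : ℝ :=
  ∫ x, hermiteFun n x * hermiteFun m x * (inner ℝ (kvec x) a * inner ℝ (kvec x) b)

theorem abs_mul_inner_kvec_le (a b : Ell2) (x : ℝ) :
    ‖inner ℝ (kvec x) a * inner ℝ (kvec x) b‖ ≤ 2 * ‖a‖ * ‖b‖ := by
  rw [Real.norm_eq_abs, abs_mul]
  calc _ ≤ (√2 * ‖a‖) * (√2 * ‖b‖) := by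
        gcongr <;> exact abs_inner_kvec_le _ _
    _ = (√2 * √2) * ‖a‖ * ‖b‖ := by ring
    _ = _ := by rw [Real.mul_self_sqrt (by norm_num)]

theorem integrable_mul_kvec {f : ℝ → ℝ} (hf : Integrable f) (a b : Ell2) :
    Integrable fun x => f x * (inner ℝ (kvec x) a * inner ℝ (kvec x) b) :=
  hf.mul_bdd (c := 2 * ‖a‖ * ‖b‖) ((measurable_inner_kvec a).mul
    (measurable_inner_kvec b)).aestronglyMeasurable
    (Filter.Eventually.of_forall fun x => abs_mul_inner_kvec_le a b x)

theorem integrable_potEntry (a b : Ell2) (n m : ℕ) : Integrable fun x =>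
    hermiteFun n x * hermiteFun m x * (inner ℝ (kvec x) a * inner ℝ (kvec x) b) :=
  integrable_mul_kvec (integrable_hermiteFun_mul n m) a b

theorem integral_abs_mul_le {f g : ℝ → ℝ} (hf : Continuous f) (hg : Continuous g)
    (hf2 : Integrable fun x => f x ^ 2) (hg2 : Integrable fun x => g x ^ 2) :
    ∫ x, |f x * g x| ≤ √(∫ x, f x ^ 2) * √(∫ x, g x ^ 2) := by
  have h := integral_mul_norm_le_Lp_mul_Lq (μ := volume) (f := f) (g := g) (p := 2) (q := 2)
    (by rw [Real.holderConjugate_iff]; norm_num)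
    (by simpa using (memLp_two_iff_integrable_sq hf.aestronglyMeasurable).2 hf2)
    (by simpa using (memLp_two_iff_integrable_sq hg.aestronglyMeasurable).2 hg2)
  simpa [Real.sqrt_eq_rpow, abs_mul] using h

/-- The form is the integral of two finite Hermite sums against a function bounded by `2‖a‖‖b‖`.
Cauchy–Schwarz and orthonormality finish; completeness of the Hermite functions plays no role. -/
theorem sum_potEntry_le (a b : Ell2) (s t : Finset ℕ) (x y : ℕ → ℝ) :
    |∑ i ∈ s, ∑ j ∈ t, x i * potEntry a b i j * y j| ≤
      2 * ‖a‖ * ‖b‖ * √(∑ i ∈ s, x i ^ 2) * √(∑ j ∈ t, y j ^ 2) := by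
  obtain ⟨ix, ex⟩ := integral_sum_sq (s := s) x id (fun n m _ _ h => h)
  obtain ⟨iy, ey⟩ := integral_sum_sq (s := t) y id (fun n m _ _ h => h)
  have ixy := (integral_sum_mul_sum (s := s) (t := t) x y id id).1
  simp only [id] at ix ex iy ey ixy
  have h1 : ∑ i ∈ s, ∑ j ∈ t, x i * potEntry a b i j * y j =
      ∫ z, ((∑ n ∈ s, x n * hermiteFun n z) * ∑ m ∈ t, y m * hermiteFun m z) *
        (inner ℝ (kvec z) a * inner ℝ (kvec z) b) := by
    have h2 (z : ℝ) : ((∑ n ∈ s, x n * hermiteFun n z) * ∑ m ∈ t, y m * hermiteFun m z) *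
        (inner ℝ (kvec z) a * inner ℝ (kvec z) b) = ∑ i ∈ s, ∑ j ∈ t, x i * y j *
          (hermiteFun i z * hermiteFun j z * (inner ℝ (kvec z) a * inner ℝ (kvec z) b)) := by
      rw [Finset.sum_mul_sum, Finset.sum_mul]
      refine Finset.sum_congr rfl fun n _ => ?_
      rw [Finset.sum_mul]
      exact Finset.sum_congr rfl fun m _ => by ring
    simp_rw [h2]
    have hi (n m : ℕ) := (integrable_potEntry a b n m).const_mul (x n * y m)
    rw [integral_finsetSum _ fun n _ => integrable_finsetSum _ fun m _ => hi n m]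
    refine Finset.sum_congr rfl fun n _ => ?_
    rw [integral_finsetSum _ fun m _ => hi n m]
    refine Finset.sum_congr rfl fun m _ => ?_
    rw [integral_const_mul, potEntry]; ring
  rw [h1, ← Real.norm_eq_abs]
  calc _ ≤ ∫ z, 2 * ‖a‖ * ‖b‖ * |(∑ n ∈ s, x n * hermiteFun n z) * ∑ m ∈ t, y m * hermiteFun m z| := by
        refine norm_integral_le_of_norm_le (ixy.abs.const_mul _)
          (Filter.Eventually.of_forall fun z => ?_)
        rw [norm_mul, mul_comm, Real.norm_eq_abs (_ * _)]
        have := abs_mul_inner_kvec_le a b z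
        rw [Real.norm_eq_abs (_ * Finset.sum _ _)]
        gcongr
        simpa using this
    _ = 2 * ‖a‖ * ‖b‖ * ∫ z, |(∑ n ∈ s, x n * hermiteFun n z) * ∑ m ∈ t, y m * hermiteFun m z| :=
        integral_const_mul _ _
    _ ≤ 2 * ‖a‖ * ‖b‖ * (√(∑ i ∈ s, x i ^ 2) * √(∑ j ∈ t, y j ^ 2)) := by
        gcongr
        rw [← ex, ← ey]
        have hc (s : Finset ℕ) (x : ℕ → ℝ) : Continuous fun z => ∑ n ∈ s, x n * hermiteFun n z :=
          continuous_finsetSum _ fun n _ => continuous_const.mul (continuous_hermiteFun n)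
        exact integral_abs_mul_le (hc _ _) (hc _ _) ix iy
    _ = _ := by ring

theorem potEntry_add_left (a a' b : Ell2) (n m : ℕ) :
    potEntry (a + a') b n m = potEntry a b n m + potEntry a' b n m := by
  rw [potEntry, potEntry, potEntry, ← integral_add (integrable_potEntry _ _ _ _)
    (integrable_potEntry _ _ _ _)]
  simp_rw [inner_add_right]
  exact integral_congr_ae (Filter.Eventually.of_forall fun x => by ring)

theorem potEntry_smul_left (c : ℝ) (a b : Ell2) (n m : ℕ) :
    potEntry (c • a) b n m = c * potEntry a b n m := by
  rw [potEntry, potEntry, ← integral_const_mul]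
  simp_rw [inner_smul_right]
  exact integral_congr_ae (Filter.Eventually.of_forall fun x => by ring)

theorem potEntry_comm (a b : Ell2) (n m : ℕ) : potEntry a b n m = potEntry b a n m := by
  simp_rw [potEntry, mul_comm (inner ℝ (kvec _) a)]

theorem potEntry_symm (a b : Ell2) (n m : ℕ) : potEntry a b n m = potEntry a b m n := by
  simp_rw [potEntry, mul_comm (hermiteFun n _)]

theorem potEntry_ev (j k n m : ℕ) : potEntry (ev j) (ev k) n m = wt j * wt k * K n m j k := by
  rw [potEntry, K, ← integral_const_mul]
  simp_rw [inner_ev_right, kvec_apply]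
  exact integral_congr_ae (Filter.Eventually.of_forall fun x => by ring)

/-- The potential operator, as a bounded bilinear map of the weighted coordinates. -/
theorem exists_potential : ∃ P : Ell2 →L[ℝ] Ell2 →L[ℝ] (Ell2 →L[ℝ] Ell2),
    ∀ a b n m, P a b (ev m) n = potEntry a b n m := by
  have h (a b : Ell2) := exists_clm_of_matrix (by positivity) (sum_potEntry_le a b)
  choose P hPn hP using h
  have hcomm (a b : Ell2) : P a b = P b a := clm_ext_entries fun i k => by
    rw [hP, hP, potEntry_comm]
  have hadd (a a' b : Ell2) : P (a + a') b = P a b + P a' b := clm_ext_entries fun i k => by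
    simp [hP, potEntry_add_left]
  have hsmul (c : ℝ) (a b : Ell2) : P (c • a) b = c • P a b := clm_ext_entries fun i k => by
    simp [hP, potEntry_smul_left]
  let P0 : Ell2 →ₗ[ℝ] Ell2 →ₗ[ℝ] (Ell2 →L[ℝ] Ell2) := LinearMap.mk₂ ℝ P hadd hsmul
    (fun a b b' => by rw [hcomm, hadd, hcomm b, hcomm b'])
    (fun c a b => by rw [hcomm, hsmul, hcomm b])
  exact ⟨P0.mkContinuous₂ 2 hPn, fun a b n m => hP a b n m⟩

/-- The operator of multiplication by the product of two functions of the energy space, given by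
their weighted coordinates. -/
noncomputable def pot : Ell2 →L[ℝ] Ell2 →L[ℝ] (Ell2 →L[ℝ] Ell2) := exists_potential.choose

theorem pot_entry (a b : Ell2) (n m : ℕ) : pot a b (ev m) n = potEntry a b n m :=
  exists_potential.choose_spec a b n m

theorem pot_comm (a b : Ell2) : pot a b = pot b a :=
  clm_ext_entries fun i k => by rw [pot_entry, pot_entry, potEntry_comm]

theorem pot_ev (j k m n : ℕ) : pot (ev j) (ev k) (ev m) n = wt j * wt k * K n m j k := by
  rw [pot_entry, potEntry_ev]

theorem clm_ext_ev {ι F : Type*} [DecidableEq ι] [NormedAddCommGroup F] [NormedSpace ℝ F]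
    {f g : L2 ι →L[ℝ] F} (h : ∀ i, f (ev i) = g (ev i)) : f = g := by
  ext x
  have h1 := f.hasSum (hasSum_ev x)
  have h2 := g.hasSum (hasSum_ev x)
  simp only [map_smul, h] at h1 h2
  exact h1.unique h2

/-- Symmetry of the matrix entries, extended to `l²` by continuity in one argument at a time. -/
theorem inner_pot_symm (a b c d : Ell2) : inner ℝ (pot a b c) d = inner ℝ c (pot a b d) := by
  have h1 : (innerSL ℝ).flip d ∘L pot a b = (innerSL ℝ).flip (pot a b d) := by
    refine clm_ext_ev fun i => ?_
    simp only [ContinuousLinearMap.comp_apply, ContinuousLinearMap.flip_apply, innerSL_apply_apply]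
    rw [inner_ev_left, real_inner_comm]
    have h2 : innerSL ℝ (pot a b (ev i)) = coordCLM i ∘L pot a b := by
      refine clm_ext_ev fun j => ?_
      simp only [ContinuousLinearMap.comp_apply, innerSL_apply_apply, coordCLM_apply]
      rw [inner_ev_right, pot_entry, pot_entry, potEntry_symm]
    have h3 := congrArg (fun f => f d) h2
    simp only [ContinuousLinearMap.comp_apply, innerSL_apply_apply, coordCLM_apply] at h3
    rw [real_inner_comm]
    exact h3
  exact congrArg (fun f => f c) h1

end Potential
end DarkSoliton

namespace DarkSoliton

/-! ### Position and derivative operators, and their relations with the potential. -/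

section Ladder

open MeasureTheory

/-- A common source of the ladder operators and of the weight: where `g` does not vanish, `f` uses
each coordinate at most once, so the operator is a contraction. -/
theorem exists_weighted_shift (f : ℕ → ℕ) (g : ℕ → ℝ) (hg : ∀ n, |g n| ≤ 1)
    (hf : ∀ n m, g n ≠ 0 → g m ≠ 0 → f n = f m → n = m) :
    ∃ T : Ell2 →L[ℝ] Ell2, ∀ x n, T x n = g n * x (f n) := by
  have hbd (x : Ell2) (s : Finset ℕ) : ∑ n ∈ s, (g n * x (f n)) ^ 2 ≤ ‖x‖ ^ 2 := by
    calc _ = ∑ n ∈ s with g n ≠ 0, (g n * x (f n)) ^ 2 := by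
          rw [Finset.sum_filter]
          refine Finset.sum_congr rfl fun n _ => ?_
          split_ifs with h
          · rfl
          · rw [not_not.1 h]; ring
      _ ≤ ∑ n ∈ s with g n ≠ 0, x (f n) ^ 2 := by
          refine Finset.sum_le_sum fun n _ => ?_
          rw [mul_pow]
          exact mul_le_of_le_one_left (sq_nonneg _) (by rw [sq_le_one_iff_abs_le_one]; exact hg n)
      _ = ∑ k ∈ ({n ∈ s | g n ≠ 0}).image f, x k ^ 2 := by
          rw [Finset.sum_image]
          intro n hn m hm h
          exact hf n m (by simpa using (Finset.mem_filter.1 hn).2)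
            (by simpa using (Finset.mem_filter.1 hm).2) h
      _ ≤ _ := sum_sq_le x _
  have hmem (x : Ell2) : Memℓp (fun n => g n * x (f n)) 2 := by
    rw [memℓp_iff]
    exact summable_of_sum_le (fun _ => sq_nonneg _) (hbd x)
  let T0 : Ell2 →ₗ[ℝ] Ell2 :=
    { toFun := fun y => ⟨fun i => g i * y (f i), hmem y⟩
      map_add' := fun x y => by ext i; exact mul_add _ _ _
      map_smul' := fun c x => by ext i; simp; ring }
  have hT (y : Ell2) : ‖T0 y‖ ≤ 1 * ‖y‖ := by
    rw [one_mul]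
    exact le_of_sq_le_sq (hasSum_le_of_sum_le (hasSum_sq (T0 y)) (hbd y)) (norm_nonneg _)
  exact ⟨T0.mkContinuous 1 hT, fun x i => rfl⟩

theorem wt_le_one (n : ℕ) : wt n ≤ 1 := by
  rw [wt]
  exact inv_le_one_of_one_le₀ (Real.one_le_sqrt.2 (by simp))

theorem exists_wtOp : ∃ T : Ell2 →L[ℝ] Ell2, ∀ x n, T x n = wt n * x n :=
  exists_weighted_shift id wt (fun n => by rw [abs_of_pos (wt_pos n)]; exact wt_le_one n)
    (fun _ _ _ _ h => h)

/-- The inclusion of the energy space, in weighted coordinates. -/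
noncomputable def wtOp : Ell2 →L[ℝ] Ell2 := exists_wtOp.choose

theorem wtOp_apply (x : Ell2) (n : ℕ) : wtOp x n = wt n * x n := exists_wtOp.choose_spec x n

theorem wtOp_ev (n : ℕ) : wtOp (ev n) = wt n • ev n := by
  ext k
  rw [wtOp_apply]
  rcases eq_or_ne k n with rfl | h
  · simp
  · simp [ev_ne h]

theorem exists_lowOp : ∃ T : Ell2 →L[ℝ] Ell2, ∀ x n,
    T x n = lad (n + 1) * wt (n + 1) * x (n + 1) := by
  refine exists_weighted_shift (· + 1) (fun n => lad (n + 1) * wt (n + 1)) (fun n => ?_)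
    (fun n m _ _ h => by simpa using h)
  rw [← sq_le_one_iff_abs_le_one, mul_pow, lad_sq, wt_sq, ← div_eq_mul_inv, div_le_one (by positivity)]
  push_cast
  linarith [(Nat.cast_nonneg n : (0 : ℝ) ≤ n)]

theorem exists_raiseOp : ∃ T : Ell2 →L[ℝ] Ell2, ∀ x n,
    T x n = lad n * wt (n - 1) * x (n - 1) := by
  refine exists_weighted_shift (fun n => n - 1) (fun n => lad n * wt (n - 1)) (fun n => ?_)
    (fun n m hn hm h => ?_)
  · rw [← sq_le_one_iff_abs_le_one, mul_pow, lad_sq, wt_sq, ← div_eq_mul_inv,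
      div_le_one (by positivity)]
    cases n with
    | zero => simp
    | succ n =>
      simp only [Nat.add_sub_cancel]
      push_cast
      linarith [(Nat.cast_nonneg n : (0 : ℝ) ≤ n)]
  · have hn' : n ≠ 0 := by rintro rfl; simp at hn
    have hm' : m ≠ 0 := by rintro rfl; simp at hm
    omega

noncomputable def lowOp : Ell2 →L[ℝ] Ell2 := exists_lowOp.choose

noncomputable def raiseOp : Ell2 →L[ℝ] Ell2 := exists_raiseOp.choose

/-- Multiplication by the position variable on the energy space. -/
noncomputable def posOp : Ell2 →L[ℝ] Ell2 := lowOp + raiseOp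

/-- Differentiation on the energy space. -/
noncomputable def derOp : Ell2 →L[ℝ] Ell2 := lowOp - raiseOp

theorem lowOp_apply (x : Ell2) (n : ℕ) : lowOp x n = lad (n + 1) * wt (n + 1) * x (n + 1) :=
  exists_lowOp.choose_spec x n

theorem raiseOp_apply (x : Ell2) (n : ℕ) : raiseOp x n = lad n * wt (n - 1) * x (n - 1) :=
  exists_raiseOp.choose_spec x n

theorem lowOp_ev (j : ℕ) : lowOp (ev j) = (wt j * lad j) • ev (j - 1) := by
  ext n
  rw [lowOp_apply]
  simp only [lp.coeFn_smul, Pi.smul_apply, smul_eq_mul, ev_apply]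
  rcases j with _ | j
  · simp
  · rcases eq_or_ne n j with rfl | h
    · simp; ring
    · simp [h]

theorem raiseOp_ev (j : ℕ) : raiseOp (ev j) = (wt j * lad (j + 1)) • ev (j + 1) := by
  ext n
  rw [raiseOp_apply]
  simp only [lp.coeFn_smul, Pi.smul_apply, smul_eq_mul, ev_apply]
  rcases n with _ | n
  · simp
  · rcases eq_or_ne n j with rfl | h
    · simp; ring
    · simp [h]

theorem abs_hermiteFun_mul_le (m : ℕ) : ∃ C, ∀ x, ‖hermiteFun m x‖ ≤ C := by
  refine ⟨(wt m)⁻¹ * √2, fun x => ?_⟩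
  have h := abs_apply_le (kvec x) m
  rw [kvec_apply, abs_mul, abs_of_pos (wt_pos m)] at h
  have h2 : ‖kvec x‖ ≤ √2 := Real.le_sqrt_of_sq_le (norm_kvec_sq_le x)
  rw [Real.norm_eq_abs, inv_mul_eq_div, le_div_iff₀ (wt_pos m)]
  linarith

theorem integrable_K (n j k m : ℕ) : Integrable fun x =>
    hermiteFun n x * (hermiteFun j x * hermiteFun k x * hermiteFun m x) := by
  obtain ⟨C, hC⟩ := abs_hermiteFun_mul_le k
  obtain ⟨C', hC'⟩ := abs_hermiteFun_mul_le m
  have h := ((integrable_hermiteFun_mul n j).mul_bdd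
    (continuous_hermiteFun k).aestronglyMeasurable (Filter.Eventually.of_forall hC)).mul_bdd
    (continuous_hermiteFun m).aestronglyMeasurable (Filter.Eventually.of_forall hC')
  exact h.congr (Filter.Eventually.of_forall fun x => by simp only []; ring)

theorem K_swap_left (n j k m : ℕ) : K n j k m = K n k j m := by
  simp only [K]; congr 1; ext x; ring

theorem K_swap_right (n j k m : ℕ) : K n j k m = K n j m k := by
  simp only [K]; congr 1; ext x; ring

/-- The factor `x` in the integral may be attached to `φₙ` or to `φⱼ`. -/
theorem K_position (n j k m : ℕ) :
    lad n * K (n - 1) j k m + lad (n + 1) * K (n + 1) j k m =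
      lad j * K n (j - 1) k m + lad (j + 1) * K n (j + 1) k m := by
  simp only [K]
  rw [← integral_const_mul, ← integral_const_mul, ← integral_const_mul, ← integral_const_mul,
    ← integral_add ((integrable_K _ _ _ _).const_mul _) ((integrable_K _ _ _ _).const_mul _),
    ← integral_add ((integrable_K _ _ _ _).const_mul _) ((integrable_K _ _ _ _).const_mul _)]
  refine integral_congr_ae (Filter.Eventually.of_forall fun x => ?_)
  simp only []
  linear_combination hermiteFun k x * hermiteFun m x *
    (hermiteFun n x * mul_hermiteFun j x - hermiteFun j x * mul_hermiteFun n x)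

/-- The derivative of a product of four Hermite functions has integral zero. -/
theorem K_derivative (n j k m : ℕ) :
    (lad n * K (n - 1) j k m - lad (n + 1) * K (n + 1) j k m) +
      (lad j * K n (j - 1) k m - lad (j + 1) * K n (j + 1) k m) +
      (lad k * K n j (k - 1) m - lad (k + 1) * K n j (k + 1) m) +
      (lad m * K n j k (m - 1) - lad (m + 1) * K n j k (m + 1)) = 0 := by
  have i (c : ℝ) (n j k m : ℕ) := (integrable_K n j k m).const_mul c
  have hi := ((((i (lad n) (n - 1) j k m).sub (i (lad (n + 1)) (n + 1) j k m)).add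
    ((i (lad j) n (j - 1) k m).sub (i (lad (j + 1)) n (j + 1) k m))).add
    ((i (lad k) n j (k - 1) m).sub (i (lad (k + 1)) n j (k + 1) m))).add
    ((i (lad m) n j k (m - 1)).sub (i (lad (m + 1)) n j k (m + 1)))
  have hd (x : ℝ) := (hasDerivAt_hermiteFun n x).mul (((hasDerivAt_hermiteFun j x).mul
    (hasDerivAt_hermiteFun k x)).mul (hasDerivAt_hermiteFun m x))
  have h := integral_eq_zero_of_hasDerivAt_of_integrable hd
    (hi.congr (Filter.Eventually.of_forall fun x => by
      simp only [Pi.add_apply, Pi.sub_apply, Pi.mul_apply]; ring)) (integrable_K n j k m)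
  rw [← h]
  simp only [K]
  simp only [← integral_const_mul]
  rw [← integral_sub (i _ _ _ _ _) (i _ _ _ _ _), ← integral_sub (i _ _ _ _ _) (i _ _ _ _ _),
    ← integral_sub (i _ _ _ _ _) (i _ _ _ _ _), ← integral_sub (i _ _ _ _ _) (i _ _ _ _ _)]
  have h1 := (i (lad n) (n - 1) j k m).sub (i (lad (n + 1)) (n + 1) j k m)
  have h2 := (i (lad j) n (j - 1) k m).sub (i (lad (j + 1)) n (j + 1) k m)
  have h3 := (i (lad k) n j (k - 1) m).sub (i (lad (k + 1)) n j (k + 1) m)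
  have h4 := (i (lad m) n j k (m - 1)).sub (i (lad (m + 1)) n j k (m + 1))
  have e1 := integral_add h1 h2
  have e2 := integral_add (h1.add h2) h3
  have e3 := integral_add ((h1.add h2).add h3) h4
  simp only [Pi.add_apply, Pi.sub_apply] at e1 e2 e3
  rw [← e1, ← e2, ← e3]
  refine integral_congr_ae (Filter.Eventually.of_forall fun x => ?_)
  simp only [Pi.mul_apply]; ring

/-- Reduces identities between potential operators to identities between the integrals `K`. -/
theorem trilinear_eq_zero {F : Ell2 → Ell2 → Ell2 → ℝ}
    (h₁ : ∀ b c, ∃ L : Ell2 →L[ℝ] ℝ, ∀ a, F a b c = L a)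
    (h₂ : ∀ a c, ∃ L : Ell2 →L[ℝ] ℝ, ∀ b, F a b c = L b)
    (h₃ : ∀ a b, ∃ L : Ell2 →L[ℝ] ℝ, ∀ c, F a b c = L c)
    (h : ∀ i j k, F (ev i) (ev j) (ev k) = 0) (a b c : Ell2) : F a b c = 0 := by
  have key {f : Ell2 → ℝ} (hf : ∃ L : Ell2 →L[ℝ] ℝ, ∀ a, f a = L a) (h0 : ∀ i, f (ev i) = 0)
      (a : Ell2) : f a = 0 := by
    obtain ⟨L, hL⟩ := hf
    have : L = 0 := clm_ext_ev fun i => by rw [← hL, h0]; rfl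
    rw [hL, this]; rfl
  exact key (h₁ b c) (fun i => key (h₂ _ c) (fun j => key (h₃ _ _) (fun k => h i j k) c) b) a

/-- `wtOp` passes from weighted coordinates to plain coefficients, so both sides are the expansion
of the product of the same three functions. -/
theorem pot_wtOp_comm (a b c : Ell2) : pot a b (wtOp c) = pot a c (wtOp b) := by
  ext n
  rw [← sub_eq_zero]
  refine trilinear_eq_zero (F := fun a b c => pot a b (wtOp c) n - pot a c (wtOp b) n)
    (fun b c => ⟨coordCLM n ∘L (pot.flip b).flip (wtOp c) - coordCLM n ∘L (pot.flip c).flip (wtOp b),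
      fun a => by simp⟩)
    (fun a c => ⟨coordCLM n ∘L (pot a).flip (wtOp c) - coordCLM n ∘L pot a c ∘L wtOp,
      fun b => by simp⟩)
    (fun a b => ⟨coordCLM n ∘L pot a b ∘L wtOp - coordCLM n ∘L (pot a).flip (wtOp b),
      fun c => by simp⟩) (fun i j k => ?_) a b c
  simp only [wtOp_ev, map_smul, lp.coeFn_smul, Pi.smul_apply, smul_eq_mul, pot_ev]
  rw [K_swap_left n k, K_swap_right n i, K_swap_left n i]; ring

/-- Multiplication operators commute with the position operator. -/
theorem pot_posOp (a b c : Ell2) (n : ℕ) : pot a b (posOp c) n =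
    lad n * pot a b (wtOp c) (n - 1) + lad (n + 1) * pot a b (wtOp c) (n + 1) := by
  rw [← sub_eq_zero]
  refine trilinear_eq_zero (F := fun a b c => pot a b (posOp c) n -
      (lad n * pot a b (wtOp c) (n - 1) + lad (n + 1) * pot a b (wtOp c) (n + 1)))
    (fun b c => ⟨coordCLM n ∘L (pot.flip b).flip (posOp c) -
      (lad n • coordCLM (n - 1) ∘L (pot.flip b).flip (wtOp c) +
        lad (n + 1) • coordCLM (n + 1) ∘L (pot.flip b).flip (wtOp c)), fun a => by simp⟩)
    (fun a c => ⟨coordCLM n ∘L (pot a).flip (posOp c) -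
      (lad n • coordCLM (n - 1) ∘L (pot a).flip (wtOp c) +
        lad (n + 1) • coordCLM (n + 1) ∘L (pot a).flip (wtOp c)), fun b => by simp⟩)
    (fun a b => ⟨coordCLM n ∘L pot a b ∘L posOp -
      (lad n • coordCLM (n - 1) ∘L pot a b ∘L wtOp +
        lad (n + 1) • coordCLM (n + 1) ∘L pot a b ∘L wtOp), fun c => by simp⟩)
    (fun i j k => ?_) a b c
  have hK := K_position n k i j
  simp only [posOp, add_apply, lowOp_ev, raiseOp_ev, wtOp_ev, map_add, map_smul, lp.coeFn_smul,
    lp.coeFn_add, Pi.add_apply, Pi.smul_apply, smul_eq_mul, pot_ev]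
  linear_combination -(wt i * wt j * wt k) * hK

/-- The Leibniz rule. -/
theorem pot_derOp (a b c : Ell2) (n : ℕ) :
    pot b c (derOp a) n + pot a c (derOp b) n + pot a b (derOp c) n =
    lad (n + 1) * pot a b (wtOp c) (n + 1) - lad n * pot a b (wtOp c) (n - 1) := by
  rw [← sub_eq_zero]
  refine trilinear_eq_zero (F := fun a b c =>
      pot b c (derOp a) n + pot a c (derOp b) n + pot a b (derOp c) n -
      (lad (n + 1) * pot a b (wtOp c) (n + 1) - lad n * pot a b (wtOp c) (n - 1)))
    (fun b c => ⟨coordCLM n ∘L pot b c ∘L derOp + coordCLM n ∘L (pot.flip c).flip (derOp b) +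
      coordCLM n ∘L (pot.flip b).flip (derOp c) -
      (lad (n + 1) • coordCLM (n + 1) ∘L (pot.flip b).flip (wtOp c) -
        lad n • coordCLM (n - 1) ∘L (pot.flip b).flip (wtOp c)), fun a => by simp⟩)
    (fun a c => ⟨coordCLM n ∘L (pot.flip c).flip (derOp a) + coordCLM n ∘L pot a c ∘L derOp +
      coordCLM n ∘L (pot a).flip (derOp c) -
      (lad (n + 1) • coordCLM (n + 1) ∘L (pot a).flip (wtOp c) -
        lad n • coordCLM (n - 1) ∘L (pot a).flip (wtOp c)), fun b => by simp⟩)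
    (fun a b => ⟨coordCLM n ∘L (pot b).flip (derOp a) + coordCLM n ∘L (pot a).flip (derOp b) +
      coordCLM n ∘L pot a b ∘L derOp -
      (lad (n + 1) • coordCLM (n + 1) ∘L pot a b ∘L wtOp -
        lad n • coordCLM (n - 1) ∘L pot a b ∘L wtOp), fun c => by simp⟩)
    (fun i j k => ?_) a b c
  have hK := K_derivative n k i j
  have e1 (i' : ℕ) : K n i' j k = K n k i' j := by rw [K_swap_right, K_swap_left, K_swap_right, K_swap_left]
  have e2 (j' : ℕ) : K n j' i k = K n k i j' := by rw [K_swap_left, K_swap_right n i, K_swap_left]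
  simp only [derOp, sub_apply, lowOp_ev, raiseOp_ev, wtOp_ev, map_sub, map_smul, lp.coeFn_smul,
    lp.coeFn_sub, Pi.sub_apply, Pi.smul_apply, smul_eq_mul, pot_ev, e1, e2]
  linear_combination (wt i * wt j * wt k) * hK

end Ladder
end DarkSoliton

namespace DarkSoliton

/-! ### The iterated sums of the statement in terms of `pot`. -/

section Sums

theorem hasSum_pot_left (a b c : Ell2) (n : ℕ) :
    HasSum (fun j => a j * pot (ev j) b c n) (pot a b c n) := by
  have := (coordCLM n ∘L (pot.flip b).flip c).hasSum (hasSum_ev a)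
  simpa using this

/-- The iterated sum defining the potential matrix. -/
theorem V_eq_pot {A : ℕ → ℝ} {a : Ell2} (hA : ∀ n, A n = wt n * a n) (n m : ℕ) :
    V A n m = pot a a (ev m) n := by
  have h1 (j : ℕ) : ∑' k, K n m j k * A j * A k = a j * pot (ev j) a (ev m) n := by
    have h := (hasSum_pot_left a (ev j) (ev m) n).mul_left (a j)
    rw [pot_comm a] at h
    rw [← h.tsum_eq]
    refine tsum_congr fun k => ?_
    rw [pot_comm, pot_ev, hA, hA]; ring
  rw [V]
  simp_rw [h1]
  exact (hasSum_pot_left a a (ev m) n).tsum_eq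

theorem Lplus_eq_pot {A : ℕ → ℝ} {a : Ell2} (hA : ∀ n, A n = wt n * a n) (σ μ : ℝ) (B : Ell2)
    (n : ℕ) : Lplus σ A μ B n = (n - μ) * B n + 3 * σ * pot a a B n := by
  rw [Lplus, ← (hasSum_entries (pot a a) B n).tsum_eq]
  simp_rw [V_eq_pot hA]

theorem Lminus_eq_pot {A : ℕ → ℝ} {a : Ell2} (hA : ∀ n, A n = wt n * a n) (σ μ : ℝ) (B : Ell2)
    (n : ℕ) : Lminus σ A μ B n = (n - μ) * B n + σ * pot a a B n := by
  rw [Lminus, ← (hasSum_entries (pot a a) B n).tsum_eq]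
  simp_rw [V_eq_pot hA]

theorem stationaryField_eq_pot {A : ℕ → ℝ} {a : Ell2} (hA : ∀ n, A n = wt n * a n) (σ μ : ℝ)
    (n : ℕ) : stationaryField σ A μ n = (μ - n) * A n - σ * pot a a (wtOp a) n := by
  have h1 (m : ℕ) : ∑' j, ∑' k, K n m j k * A m * A j * A k = pot a a (ev m) n * wtOp a m := by
    rw [← V_eq_pot hA, wtOp_apply, ← hA, V, ← tsum_mul_right]
    refine tsum_congr fun j => ?_
    rw [← tsum_mul_right]
    exact tsum_congr fun k => by ring
  rw [stationaryField]
  simp_rw [h1]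
  rw [(hasSum_entries (pot a a) (wtOp a) n).tsum_eq]

theorem sqrt_mul_wt (n : ℕ) : √(1 + (n : ℝ)) * wt n = 1 :=
  mul_inv_cancel₀ (Real.sqrt_pos.2 (by positivity)).ne'

theorem rpow_half_mul_wt (n : ℕ) : (1 + (n : ℝ)) ^ (1 / 2 : ℝ) * wt n = 1 := by
  rw [← Real.sqrt_eq_rpow, sqrt_mul_wt]

theorem weightedNorm_half {A : ℕ → ℝ} {a : Ell2} (hA : ∀ n, A n = wt n * a n) :
    weightedNorm (1 / 2) A = ‖a‖ := by
  have h (n : ℕ) : (1 + (n : ℝ)) ^ (2 * (1 / 2) : ℝ) * |A n| ^ 2 = a n ^ 2 := by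
    have h0 : (1 + (n : ℝ)) ≠ 0 := by positivity
    rw [sq_abs, hA, mul_pow, wt_sq, mul_one_div_cancel two_ne_zero, Real.rpow_one,
      mul_inv_cancel_left₀ h0]
  rw [weightedNorm]
  simp_rw [h]
  rw [(hasSum_sq a).tsum_eq, Real.sqrt_sq (norm_nonneg _)]

end Sums

/-! ### Explicit values of the integrals `K`. -/

section Moments

open MeasureTheory

theorem integrable_pow_mul_exp (k : ℕ) : Integrable fun x : ℝ => x ^ k * Real.exp (-2 * x ^ 2) := by
  simpa using integrable_eval_mul_exp (Polynomial.X ^ k) (b := 2) two_pos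

/-- The derivative of `x^{k+1} exp(-2x²)` integrates to zero. -/
theorem integral_pow_mul_exp_succ (k : ℕ) : ∫ x : ℝ, x ^ (k + 2) * Real.exp (-2 * x ^ 2) =
    (k + 1) / 4 * ∫ x : ℝ, x ^ k * Real.exp (-2 * x ^ 2) := by
  have hd (x : ℝ) : HasDerivAt (fun x : ℝ => x ^ (k + 1) * Real.exp (-2 * x ^ 2))
      ((k + 1) * (x ^ k * Real.exp (-2 * x ^ 2)) - 4 * (x ^ (k + 2) * Real.exp (-2 * x ^ 2))) x := by
    have h1 : HasDerivAt (fun x : ℝ => -2 * x ^ 2) (-2 * (2 * x)) x := by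
      simpa using (hasDerivAt_pow 2 x).const_mul (-2)
    refine ((hasDerivAt_pow (k + 1) x).mul h1.exp).congr_deriv ?_
    simp only [Nat.add_sub_cancel]
    push_cast; ring
  have h := integral_eq_zero_of_hasDerivAt_of_integrable hd
    (((integrable_pow_mul_exp k).const_mul _).sub ((integrable_pow_mul_exp (k + 2)).const_mul _))
    (integrable_pow_mul_exp (k + 1))
  rw [integral_sub ((integrable_pow_mul_exp k).const_mul _)
    ((integrable_pow_mul_exp (k + 2)).const_mul _), integral_const_mul, integral_const_mul] at h
  linarith

theorem hermiteFun_zero_pow (x : ℝ) :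
    hermiteFun 0 x ^ 4 = Real.pi⁻¹ * Real.exp (-2 * x ^ 2) := by
  have hpi := Real.pi_pos
  have h : (√√Real.pi)⁻¹ ^ 4 = Real.pi⁻¹ := by
    rw [inv_pow]
    congr 1
    calc √√Real.pi ^ 4 = (√√Real.pi ^ 2) ^ 2 := by ring
      _ = _ := by rw [Real.sq_sqrt (Real.sqrt_nonneg _), Real.sq_sqrt hpi.le]
  rw [hermiteFun_zero, mul_pow, h, ← Real.exp_nat_mul]
  congr 2
  push_cast; ring

theorem hermiteFun_one_sq (x : ℝ) : hermiteFun 1 x ^ 2 = 2 * x ^ 2 * hermiteFun 0 x ^ 2 := by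
  have h := mul_hermiteFun 0 x
  have hl := lad_sq 1
  simp only [lad_zero, zero_mul, zero_add, Nat.cast_one] at h hl
  have h2 : (x * hermiteFun 0 x) ^ 2 = (lad 1 * hermiteFun 1 x) ^ 2 := by rw [h]
  rw [mul_pow, mul_pow, hl] at h2
  linarith

theorem hermiteFun_two_sq (x : ℝ) :
    hermiteFun 2 x ^ 2 = (2 * x ^ 4 - 2 * x ^ 2 + 1 / 2) * hermiteFun 0 x ^ 2 := by
  have h := mul_hermiteFun 1 x
  have h0 := mul_hermiteFun 0 x
  have hl := lad_sq 1
  have hl2 : lad 2 = 1 := by simp [lad]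
  simp only [lad_zero, zero_mul, zero_add, Nat.cast_one, Nat.sub_self, Nat.reduceAdd, hl2, one_mul]
    at h h0 hl
  have h1 := hermiteFun_one_sq x
  have h2 : hermiteFun 2 x = x * hermiteFun 1 x - lad 1 * hermiteFun 0 x := by linarith
  rw [h2]
  linear_combination x ^ 2 * h1 + hermiteFun 0 x ^ 2 * hl + 2 * x * hermiteFun 0 x * h0

theorem integral_poly_mul_exp (a b c : ℝ) :
    ∫ x, (a * x ^ 2 + b * x ^ 4 + c * x ^ 6) * hermiteFun 0 x ^ 4 =
      (a / 4 + 3 * b / 16 + 15 * c / 64) * (√(2 * Real.pi))⁻¹ := by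
  have hpi := Real.pi_pos
  have h0 : ∫ x : ℝ, Real.exp (-(2 * x ^ 2)) = √(Real.pi / 2) := by
    rw [← integral_gaussian 2]
    simp only [neg_mul]
  have h2 := integral_pow_mul_exp_succ 0
  have h4 := integral_pow_mul_exp_succ 2
  have h6 := integral_pow_mul_exp_succ 4
  norm_num at h2 h4 h6
  have i2 := (integrable_pow_mul_exp 2).const_mul (Real.pi⁻¹ * a)
  have i4 := (integrable_pow_mul_exp 4).const_mul (Real.pi⁻¹ * b)
  have i6 := (integrable_pow_mul_exp 6).const_mul (Real.pi⁻¹ * c)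
  have e : ∫ x, (a * x ^ 2 + b * x ^ 4 + c * x ^ 6) * hermiteFun 0 x ^ 4 =
      Real.pi⁻¹ * a * (∫ x : ℝ, x ^ 2 * Real.exp (-2 * x ^ 2)) +
      Real.pi⁻¹ * b * (∫ x : ℝ, x ^ 4 * Real.exp (-2 * x ^ 2)) +
      Real.pi⁻¹ * c * (∫ x : ℝ, x ^ 6 * Real.exp (-2 * x ^ 2)) := by
    rw [← integral_const_mul, ← integral_const_mul, ← integral_const_mul, ← integral_add i2 i4]
    refine Eq.trans ?_ (integral_add (i2.add i4) i6)
    refine integral_congr_ae (Filter.Eventually.of_forall fun x => ?_)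
    simp only [hermiteFun_zero_pow]; ring
  have hs : √(Real.pi / 2) = Real.pi * (√(2 * Real.pi))⁻¹ := by
    rw [← div_eq_mul_inv, eq_div_iff (by positivity), ← Real.sqrt_mul (by positivity)]
    rw [show Real.pi / 2 * (2 * Real.pi) = Real.pi ^ 2 by ring, Real.sqrt_sq hpi.le]
  norm_num at e
  rw [e, h6, h4, h2, h0, hs]
  field_simp; ring

theorem K_1111 : K 1 1 1 1 = 3 / √(32 * Real.pi) := by
  have h := integral_poly_mul_exp 0 4 0
  have hs : √(32 * Real.pi) = 4 * √(2 * Real.pi) := by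
    rw [show (32 : ℝ) * Real.pi = 4 ^ 2 * (2 * Real.pi) by ring, Real.sqrt_mul (by positivity),
      Real.sqrt_sq (by norm_num)]
  have e : K 1 1 1 1 = ∫ x, (0 * x ^ 2 + 4 * x ^ 4 + 0 * x ^ 6) * hermiteFun 0 x ^ 4 := by
    rw [K]
    refine integral_congr_ae (Filter.Eventually.of_forall fun x => ?_)
    simp only []
    linear_combination (hermiteFun 1 x ^ 2 + 2 * x ^ 2 * hermiteFun 0 x ^ 2) * hermiteFun_one_sq x
  rw [e, h, hs]
  field_simp; ring

/-- This difference is the leading coefficient, up to `2σ`, of the trace on the block of frequency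
one; its being nonzero splits the double eigenvalue. Both products are even polynomials of degree at
most `6` times `φ₀⁴`. -/
theorem K_2211_sub_K_0011 : K 2 2 1 1 - K 0 0 1 1 = -(1 / 16) * (√(2 * Real.pi))⁻¹ := by
  have h := integral_poly_mul_exp 1 (-4) 4
  have h' := integral_poly_mul_exp 2 0 0
  have e : K 2 2 1 1 = ∫ x, (1 * x ^ 2 + (-4) * x ^ 4 + 4 * x ^ 6) * hermiteFun 0 x ^ 4 := by
    rw [K]
    refine integral_congr_ae (Filter.Eventually.of_forall fun x => ?_)
    simp only []
    linear_combination hermiteFun 2 x ^ 2 * hermiteFun_one_sq x +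
      2 * x ^ 2 * hermiteFun 0 x ^ 2 * hermiteFun_two_sq x
  have e' : K 0 0 1 1 = ∫ x, (2 * x ^ 2 + 0 * x ^ 4 + 0 * x ^ 6) * hermiteFun 0 x ^ 4 := by
    rw [K]
    refine integral_congr_ae (Filter.Eventually.of_forall fun x => ?_)
    simp only []
    linear_combination hermiteFun 0 x ^ 2 * hermiteFun_one_sq x
  rw [e, e', h, h']; ring

end Moments

/-! ### Existence of dark soliton families by Lyapunov–Schmidt reduction. -/

section Existence

/-- The cubic nonlinearity of the stationary equation, in weighted coordinates. -/
noncomputable def cubic (a : Ell2) : Ell2 := pot a a (wtOp a)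

theorem contDiff_cubic {n : WithTop ℕ∞} : ContDiff ℝ n cubic :=
  ((pot.contDiff.clm_apply contDiff_id).clm_apply wtOp.contDiff)

theorem cubic_smul (c : ℝ) (a : Ell2) : cubic (c • a) = c ^ 3 • cubic a := by
  simp only [cubic, map_smul, smul_apply, smul_smul]
  congr 1; ring

/-- The first excited state in weighted coordinates. -/
noncomputable def wev : Ell2 := (wt 1)⁻¹ • ev 1

theorem wtOp_wev : wtOp wev = ev 1 := by
  rw [wev, map_smul, wtOp_ev, smul_smul, inv_mul_cancel₀ (wt_pos 1).ne', one_smul]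

theorem pot_wev (n m : ℕ) : pot wev wev (ev m) n = K n m 1 1 := by
  have h := (wt_pos 1).ne'
  simp only [wev, map_smul, smul_apply, lp.coeFn_smul, Pi.smul_apply, smul_eq_mul, pot_ev]
  field_simp

theorem cubic_wev : cubic wev 1 = 3 / √(32 * Real.pi) := by
  rw [cubic, wtOp_wev, pot_wev, K_1111]

/-- The bound is `√(1 + n) ≤ 2|n - 1|` for `n ≠ 1`. At the resonant index `n = 1` the convention
`0⁻¹ = 0` makes `Q` annihilate the kernel direction. -/
theorem exists_reduced_resolvent : ∃ Q : Ell2 →L[ℝ] Ell2, ∀ x n,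
    Q x n = (((n : ℝ) - 1) * wt n)⁻¹ * x n := by
  obtain ⟨Q, -, hQ⟩ := exists_diag (fun n : ℕ => (((n : ℝ) - 1) * wt n)⁻¹) (C := 2) (by norm_num)
    (fun n => by
      have hw : (wt n)⁻¹ = √(1 + (n : ℝ)) := by rw [wt, inv_inv]
      rw [mul_inv, hw, abs_mul, abs_inv, abs_of_nonneg (Real.sqrt_nonneg _)]
      rcases n with _ | _ | n
      · simp
      · simp
      · push_cast
        have h1 : (0 : ℝ) < (n : ℝ) + 1 + 1 - 1 := by
          linarith [(Nat.cast_nonneg n : (0 : ℝ) ≤ n)]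
        rw [abs_of_pos h1, inv_mul_le_iff₀ h1, Real.sqrt_le_left (by nlinarith)]
        nlinarith [(Nat.cast_nonneg n : (0 : ℝ) ≤ n)])
  exact ⟨Q, hQ⟩

/-- Lyapunov–Schmidt reduction: the rescaled branch of solutions. -/
theorem exists_rescaled_branch (σ : ℝ) : ∃ ψ : ℝ → Ell2, ψ 0 = 0 ∧ ContDiffAt ℝ ω ψ 0 ∧
    ∀ᶠ s in nhds 0, ψ s 1 = 0 ∧ ∀ n : ℕ, n ≠ 1 → ((n : ℝ) - 1) * (wt n * ψ s n) =
      s * (σ * cubic (wev + ψ s) 1 * (wt n * ψ s n) - σ * cubic (wev + ψ s) n) := by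
  obtain ⟨Q, hQ⟩ := exists_reduced_resolvent
  -- Insert `W = ε(wev + v)` and `μ = 1 + sν` with `s = ε²`. The component `n = 1` fixes `ν = σ ·
  -- cubic(wev + v)₁`; the others, divided by `ε`, become `v = s G(v)`, solvable near `s = 0`.
  let G : Ell2 → Ell2 := fun v =>
    Q ((σ * coordCLM 1 (cubic (wev + v))) • wtOp v - σ • cubic (wev + v))
  have hG : ContDiff ℝ ω G := by
    have h : ContDiff ℝ ω fun v : Ell2 => cubic (wev + v) :=
      contDiff_cubic.comp (contDiff_const.add contDiff_id)
    exact Q.contDiff.comp (((contDiff_const.mul ((coordCLM 1).contDiff.comp h)).smul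
      wtOp.contDiff).sub (h.const_smul σ))
  let f : ℝ × Ell2 → Ell2 := fun u => u.2 - u.1 • G u.2
  have hf : ContDiff ℝ ω f := contDiff_snd.sub (contDiff_fst.smul (hG.comp contDiff_snd))
  have hω : (ω : WithTop ℕ∞) ≠ 0 := by simp
  have hd : fderiv ℝ f (0, 0) ∘L .inr ℝ _ _ = .id ℝ Ell2 := by
    have h1 : HasFDerivAt (fun v : Ell2 => f (0, v)) (fderiv ℝ f (0, 0) ∘L .inr ℝ _ _) 0 :=
      HasFDerivAt.comp (g := f) (f := fun v : Ell2 => ((0 : ℝ), v)) 0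
        (hf.differentiable hω (0, 0)).hasFDerivAt (hasFDerivAt_prodMk_right _ _)
    have h2 : (fun v : Ell2 => f (0, v)) = id := by
      funext v; simp [f]
    rw [h2] at h1
    exact h1.unique (hasFDerivAt_id _)
  have hinv : (fderiv ℝ f (0, 0) ∘L .inr ℝ _ _).IsInvertible := by
    rw [hd]; exact ⟨.refl ℝ _, rfl⟩
  have hfa : ContDiffAt ℝ ω f (0, 0) := hf.contDiffAt
  refine ⟨hfa.implicitFunction hω hinv, hfa.implicitFunction_apply_self hω hinv,
    hfa.contDiffAt_implicitFunction hω hinv, ?_⟩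
  filter_upwards [hfa.eventually_apply_implicitFunction hω hinv] with s hs
  set v := hfa.implicitFunction hω hinv s
  have h0 : f (0, 0) = 0 := by simp [f]
  rw [h0] at hs
  have hv (n : ℕ) : v n = s * ((((n : ℝ) - 1) * wt n)⁻¹ *
      (σ * cubic (wev + v) 1 * (wt n * v n) - σ * cubic (wev + v) n)) := by
    have h1 : v = s • G v := sub_eq_zero.1 hs
    conv_lhs => rw [h1]
    simp only [G, lp.coeFn_smul, Pi.smul_apply, smul_eq_mul, hQ, lp.coeFn_sub, Pi.sub_apply,
      wtOp_apply, coordCLM_apply]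
  refine ⟨by rw [hv]; simp, fun n hn => ?_⟩
  have h1 : ((n : ℝ) - 1) ≠ 0 := sub_ne_zero.2 (by exact_mod_cast hn)
  have h2 := (wt_pos n).ne'
  conv_lhs => rw [hv]
  field_simp

/-- The cubic term is homogeneous of degree three, so the rescaled problem depends on `ε²` only.
Differentiability of the branch and of `ν` at `s = 0` gives errors `O(ε²)`, which the prefactors `ε`
and `ε²` turn into `O(ε³)` and `O(ε⁴)`. -/
theorem exists_darkSolitonFamily (σ : ℝ) : ∃ (A : ℝ → Ell2) (μ : ℝ → ℝ),
    IsDarkSolitonFamily σ A μ := by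
  obtain ⟨ψ, hψ0, hψ, hev⟩ := exists_rescaled_branch σ
  have hω : (ω : WithTop ℕ∞) ≠ 0 := by simp
  let ν : ℝ → ℝ := fun s => σ * coordCLM 1 (cubic (wev + ψ s))
  have hνψ {s : ℝ} (h : ContDiffAt ℝ ω ψ s) : ContDiffAt ℝ ω ν s :=
    contDiffAt_const.mul ((coordCLM 1).contDiff.contDiffAt.comp s
      (contDiff_cubic.contDiffAt.comp s (contDiffAt_const.add h)))
  have hν0 : ν 0 = σ * (3 / √(32 * Real.pi)) := by
    simp only [ν, hψ0, add_zero, coordCLM_apply, cubic_wev]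
  obtain ⟨C₁, hC₁⟩ := (hψ.differentiableAt hω).isBigO_sub.bound
  obtain ⟨C₂, hC₂⟩ := ((hνψ hψ).differentiableAt hω).isBigO_sub.bound
  -- Analyticity is used because, unlike `C^∞` regularity at a point, it passes to a whole
  -- neighbourhood of the point.
  obtain ⟨δ, hδ, H⟩ := Metric.eventually_nhds_iff.1
    (hev.and ((hψ.eventually (by simp)).and (hC₁.and hC₂)))
  have hr (ε : ℝ) (hε : ε ∈ Set.Ioo (-√δ) √δ) : dist (ε ^ 2) 0 < δ := by
    rw [dist_zero_right, Real.norm_eq_abs, abs_of_nonneg (sq_nonneg _)]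
    have h := (Real.lt_sqrt (abs_nonneg ε)).1 (abs_lt.2 hε)
    rwa [sq_abs] at h
  let W : ℝ → Ell2 := fun ε => ε • (wev + ψ (ε ^ 2))
  refine ⟨fun ε => wtOp (W ε), fun ε => 1 + ε ^ 2 * ν (ε ^ 2), √δ, Real.sqrt_pos.2 hδ, C₁, C₂,
    ⟨W, ?_, ?_⟩, ?_, ?_⟩
  · intro ε _ n
    rw [wtOp_apply, ← mul_assoc, rpow_half_mul_wt, one_mul]
  · intro ε hε
    have h1 := (H (hr ε hε)).2.1.comp (f := fun ε : ℝ => ε ^ 2) ε (contDiff_id.pow 2).contDiffAt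
    exact ((contDiffAt_id.smul (contDiffAt_const.add h1)).of_le le_top).contDiffWithinAt
  · intro ε hε
    have h1 := (hνψ (H (hr ε hε)).2.1).comp (f := fun ε : ℝ => ε ^ 2) ε
      (contDiff_id.pow 2).contDiffAt
    exact ((contDiffAt_const.add ((contDiff_id.pow 2).contDiffAt.mul h1)).of_le
      le_top).contDiffWithinAt
  · intro ε hε
    obtain ⟨⟨h1, h2⟩, -, h3, h4⟩ := H (hr ε hε)
    have hW : W ε - ε • wev = ε • ψ (ε ^ 2) := by simp only [W]; module
    refine ⟨fun n => ?_, ?_, ?_⟩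
    · rw [stationaryField_eq_pot (a := W ε) (fun n => wtOp_apply _ _)]
      have h5 : pot (W ε) (W ε) (wtOp (W ε)) n = ε ^ 3 * cubic (wev + ψ (ε ^ 2)) n := by
        change cubic (W ε) n = _
        simp only [W]
        rw [cubic_smul]; rfl
      rw [h5, wtOp_apply]
      simp only [W, ν, lp.coeFn_smul, lp.coeFn_add, Pi.smul_apply, Pi.add_apply, smul_eq_mul,
        coordCLM_apply]
      rcases eq_or_ne n 1 with rfl | hn
      · have h6 : wt 1 * wev 1 = 1 := by rw [← wtOp_apply, wtOp_wev, ev_self]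
        rw [h1]
        push_cast
        linear_combination ε ^ 3 * σ * cubic (wev + ψ (ε ^ 2)) 1 * h6
      · have h6 : (wev : Ell2) n = 0 := by simp [wev, ev_ne hn]
        rw [h6]
        linear_combination -ε * h2 n hn
    · rw [weightedNorm_half (a := W ε - ε • wev), hW, norm_smul, Real.norm_eq_abs]
      · simp only [hψ0, sub_zero, Real.norm_eq_abs] at h3
        calc |ε| * ‖ψ (ε ^ 2)‖ ≤ |ε| * (C₁ * |ε ^ 2|) := by gcongr
          _ = C₁ * |ε| ^ 3 := by rw [abs_pow]; ring
      · intro n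
        have h6 : wtOp (ε • wev) = lp.single 2 1 ε := by
          rw [map_smul, wtOp_wev, ev, ← lp.single_smul]; simp
        rw [← wtOp_apply, map_sub, h6]
    · rw [hν0] at h4
      simp only [Real.norm_eq_abs, sub_zero] at h4
      have h5 : 1 + ε ^ 2 * ν (ε ^ 2) - 1 - 3 * σ * ε ^ 2 / √(32 * Real.pi) =
          ε ^ 2 * (ν (ε ^ 2) - σ * (3 / √(32 * Real.pi))) := by ring
      simp only []
      rw [h5, abs_mul]
      calc |ε ^ 2| * |ν (ε ^ 2) - σ * (3 / √(32 * Real.pi))| ≤ |ε ^ 2| * (C₂ * |ε ^ 2|) := by gcongr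
        _ = C₂ * ε ^ 4 := by rw [abs_of_nonneg (sq_nonneg ε)]; ring

end Existence
end DarkSoliton

namespace DarkSoliton

/-! ### Asymptotics along an arbitrary family, and the dipole mode. -/

section Family

open Filter Topology

/-- The three terms of the product rule coincide by `pot_comm` and `pot_wtOp_comm`. -/
theorem hasDerivAt_cubic {W : ℝ → Ell2} {w : Ell2} {t : ℝ} (h : HasDerivAt W w t) :
    HasDerivAt (fun t => cubic (W t)) ((3 : ℝ) • pot (W t) (W t) (wtOp w)) t := by
  have h1 : HasDerivAt (fun t => pot (W t)) (pot w) t :=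
    HasFDerivAt.comp_hasDerivAt (l := pot) t pot.hasFDerivAt h
  have h2 : HasDerivAt (fun t => wtOp (W t)) (wtOp w) t := wtOp.hasFDerivAt.comp_hasDerivAt t h
  refine ((h1.clm_apply h).clm_apply h2).congr_deriv ?_
  rw [add_apply, pot_comm w, pot_wtOp_comm (W t) w]
  module

/-- The data of a dark soliton family in weighted coordinates. -/
theorem IsDarkSolitonFamily.exists_weighted {σ : ℝ} {A : ℝ → Ell2} {μ : ℝ → ℝ}
    (h : IsDarkSolitonFamily σ A μ) : ∃ W : ℝ → Ell2,
      (∀ᶠ ε in 𝓝 0, A ε = wtOp (W ε) ∧ DifferentiableAt ℝ W ε ∧ DifferentiableAt ℝ μ ε ∧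
        ∀ n : ℕ, (μ ε - n) * (wt n * W ε n) - σ * cubic (W ε) n = 0) ∧
      Tendsto (fun ε => ε⁻¹ • W ε) (𝓝[≠] 0) (𝓝 wev) ∧ Tendsto (deriv W) (𝓝[≠] 0) (𝓝 wev) ∧
      Tendsto (fun ε => (ε ^ 2)⁻¹ * (μ ε - 1)) (𝓝[≠] 0) (𝓝 (σ * (3 / √(32 * Real.pi)))) := by
  obtain ⟨r, hr, C₁, C₂, ⟨W, hW, hWs⟩, hμs, H⟩ := h
  have hnhds : Set.Ioo (-r) r ∈ 𝓝 (0 : ℝ) := Ioo_mem_nhds (by linarith) hr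
  have hAW : ∀ ε ∈ Set.Ioo (-r) r, ∀ n, A ε n = wt n * W ε n := fun ε hε n => by
    rw [hW ε hε, ← mul_assoc, mul_comm (wt n), rpow_half_mul_wt, one_mul]
  have hdist : ∀ ε ∈ Set.Ioo (-r) r, ‖W ε - ε • wev‖ ≤ C₁ * |ε| ^ 3 := fun ε hε => by
    have h1 := (H ε hε).2.1
    rwa [weightedNorm_half (a := W ε - ε • wev)] at h1
    intro n
    have h6 : wtOp (ε • wev) = lp.single 2 1 ε := by
      rw [map_smul, wtOp_wev, ev, ← lp.single_smul]; simp
    have h7 : A ε = wtOp (W ε) := by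
      ext n; rw [hAW ε hε, wtOp_apply]
    rw [← wtOp_apply, map_sub, h6, h7]
  have hW1 : ∀ ε ∈ Set.Ioo (-r) r, ContDiffAt ℝ ∞ W ε := fun ε hε =>
    hWs.contDiffAt (Ioo_mem_nhds hε.1 hε.2)
  have h0mem : (0 : ℝ) ∈ Set.Ioo (-r) r := ⟨by linarith, hr⟩
  have hW0 : W 0 = 0 := by
    have := hdist 0 h0mem
    simpa using this
  -- The bound `‖W - ε wev‖ ≤ C₁|ε|³` determines the derivative at `0`; smoothness of `W` then gives
  -- the limit of `deriv W`.
  have hder0 : HasDerivAt W wev 0 := by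
    rw [hasDerivAt_iff_isLittleO_nhds_zero]
    have h1 : (fun ε => W (0 + ε) - W 0 - ε • wev) =O[𝓝 0] fun ε : ℝ => ε ^ 3 := by
      refine Asymptotics.IsBigO.of_bound C₁ ?_
      filter_upwards [hnhds] with ε hε
      simpa [hW0] using hdist ε hε
    exact h1.trans_isLittleO (by simpa using Asymptotics.isLittleO_pow_pow (𝕜 := ℝ) (m := 1) (n := 3) (by norm_num))
  refine ⟨W, ?_, ?_, ?_, ?_⟩
  · filter_upwards [hnhds] with ε hε
    refine ⟨?_, (hW1 ε hε).differentiableAt (by simp),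
      (hμs.contDiffAt (Ioo_mem_nhds hε.1 hε.2)).differentiableAt (by simp), fun n => ?_⟩
    · ext n; rw [hAW ε hε, wtOp_apply]
    · have h1 := (H ε hε).1 n
      rw [stationaryField_eq_pot (hAW ε hε), hAW ε hε] at h1
      exact h1
  · have h1 := hder0.tendsto_slope_zero
    simpa [hW0] using h1
  · have h1 : ContinuousAt (deriv W) 0 := by
      have h2 : ContDiffOn ℝ ∞ (deriv W) (Set.Ioo (-r) r) :=
        ((contDiffOn_infty_iff_deriv_of_isOpen isOpen_Ioo).1 hWs).2
      exact h2.continuousOn.continuousAt hnhds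
    have h2 := h1.tendsto
    rw [hder0.deriv] at h2
    exact h2.mono_left nhdsWithin_le_nhds
  · have h1 : ∀ᶠ ε in 𝓝[≠] (0 : ℝ), ‖(ε ^ 2)⁻¹ * (μ ε - 1) - σ * (3 / √(32 * Real.pi))‖ ≤
        C₂ * ε ^ 2 := by
      filter_upwards [nhdsWithin_le_nhds hnhds, self_mem_nhdsWithin] with ε hε hne
      have hne' : ε ≠ 0 := hne
      have h2 := (H ε hε).2.2
      have h3 : (ε ^ 2)⁻¹ * (μ ε - 1) - σ * (3 / √(32 * Real.pi)) =
          (ε ^ 2)⁻¹ * (μ ε - 1 - 3 * σ * ε ^ 2 / √(32 * Real.pi)) := by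
        field_simp
      rw [h3, norm_mul, norm_inv, Real.norm_eq_abs, Real.norm_eq_abs, abs_of_nonneg (sq_nonneg ε),
        inv_mul_le_iff₀ (by positivity)]
      calc _ ≤ C₂ * ε ^ 4 := h2
        _ = _ := by ring
    have h2 : Tendsto (fun ε : ℝ => C₂ * ε ^ 2) (𝓝[≠] 0) (𝓝 0) := by
      have h3 : Continuous fun ε : ℝ => C₂ * ε ^ 2 := by fun_prop
      have h4 := h3.tendsto 0
      simp only [ne_eq, OfNat.ofNat_ne_zero, not_false_eq_true, zero_pow, mul_zero] at h4
      exact h4.mono_left nhdsWithin_le_nhds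
    exact tendsto_sub_nhds_zero_iff.1 (squeeze_zero_norm' h1 h2)

/-- The linearised stationary equation along the family. -/
theorem linearised_equation {σ : ℝ} {W : ℝ → Ell2} {μ : ℝ → ℝ} {ε : ℝ}
    (h : ∀ᶠ t in 𝓝 ε, ∀ n : ℕ, (μ t - n) * (wt n * W t n) - σ * cubic (W t) n = 0)
    (hW : DifferentiableAt ℝ W ε) (hμ : DifferentiableAt ℝ μ ε) (n : ℕ) :
    (n - μ ε) * (wt n * deriv W ε n) + 3 * σ * pot (W ε) (W ε) (wtOp (deriv W ε)) n =
      deriv μ ε * (wt n * W ε n) := by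
  have h1 := (coordCLM n).hasFDerivAt.comp_hasDerivAt ε hW.hasDerivAt
  have h2 := (coordCLM n).hasFDerivAt.comp_hasDerivAt ε (hasDerivAt_cubic hW.hasDerivAt)
  have h3 := ((hμ.hasDerivAt.sub_const (n : ℝ)).mul (h1.const_mul (wt n))).sub (h2.const_mul σ)
  have h4 : HasDerivAt (fun _ : ℝ => (0 : ℝ)) _ ε := h3.congr_of_eventuallyEq (by
    filter_upwards [h] with t ht
    simpa using (ht n).symm)
  have h5 := h4.unique (hasDerivAt_const ε (0 : ℝ))
  simp only [coordCLM_apply, map_smul, smul_eq_mul, Function.comp_apply] at h5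
  linarith

theorem tendsto_pot_scaled {W : ℝ → Ell2}
    (hW : Tendsto (fun ε => ε⁻¹ • W ε) (𝓝[≠] 0) (𝓝 wev)) :
    Tendsto (fun ε => (ε ^ 2)⁻¹ • pot (W ε) (W ε)) (𝓝[≠] 0) (𝓝 (pot wev wev)) := by
  have h1 : Continuous fun a : Ell2 => pot a a := pot.continuous.clm_apply continuous_id
  have h2 := (h1.tendsto wev).comp hW
  refine h2.congr fun ε => ?_
  simp only [Function.comp_apply, map_smul, smul_apply, smul_smul]
  congr 1
  rw [sq, mul_inv]

/-- Divide component `1` of the linearised equation by `ε²`. The left side tends to `(-1 + 3)σ K₁₁₁₁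
≠ 0`, while the right side is a multiple of `deriv μ ε`. For the inner product, divide by `ε`; the
limit is `⟨e₁, e₁⟩ = 1`. -/
theorem IsDarkSolitonFamily.nondegenerate {σ : ℝ} (hσ : σ ≠ 0) {W : ℝ → Ell2} {μ : ℝ → ℝ}
    (h : ∀ᶠ t in 𝓝 0, DifferentiableAt ℝ W t ∧ DifferentiableAt ℝ μ t ∧
      ∀ n : ℕ, (μ t - n) * (wt n * W t n) - σ * cubic (W t) n = 0)
    (hW : Tendsto (fun ε => ε⁻¹ • W ε) (𝓝[≠] 0) (𝓝 wev))
    (hW' : Tendsto (deriv W) (𝓝[≠] 0) (𝓝 wev))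
    (hμ : Tendsto (fun ε => (ε ^ 2)⁻¹ * (μ ε - 1)) (𝓝[≠] 0) (𝓝 (σ * (3 / √(32 * Real.pi))))) :
    ∀ᶠ ε in 𝓝[≠] 0, deriv μ ε ≠ 0 ∧ inner ℝ (wtOp (W ε)) (wtOp (deriv W ε)) ≠ (0 : ℝ) := by
  have hpi := Real.pi_pos
  have e1 : ∀ᶠ ε in 𝓝[≠] (0 : ℝ), (ε ^ 2)⁻¹ * (deriv μ ε * (wt 1 * W ε 1)) ≠ 0 := by
    have t1 := (hμ.const_sub 0).mul
      (((coordCLM 1).continuous.tendsto _).comp ((wtOp.continuous.tendsto _).comp hW'))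
    have t0 := ((isBoundedBilinearMap_apply (𝕜 := ℝ) (E := Ell2) (F := Ell2)).continuous.tendsto
      (pot wev wev, wtOp wev)).comp
      ((tendsto_pot_scaled hW).prodMk_nhds ((wtOp.continuous.tendsto _).comp hW'))
    have t2 := (((coordCLM 1).continuous.tendsto _).comp t0).const_mul (3 * σ)
    have t3 := t1.add t2
    have t4 : (0 - σ * (3 / √(32 * Real.pi))) * coordCLM 1 (wtOp wev) +
        3 * σ * coordCLM 1 (pot wev wev (wtOp wev)) = 2 * σ * (3 / √(32 * Real.pi)) := by
      have h1 : coordCLM 1 (pot wev wev (wtOp wev)) = 3 / √(32 * Real.pi) := by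
        rw [coordCLM_apply]; exact cubic_wev
      rw [h1, wtOp_wev, coordCLM_apply, ev_self]; ring
    rw [t4] at t3
    have hne : 2 * σ * (3 / √(32 * Real.pi)) ≠ 0 := by positivity
    filter_upwards [t3.eventually_ne hne, nhdsWithin_le_nhds h.eventually_nhds] with ε h1 h2
    have h3 := linearised_equation (h2.mono fun t ht => ht.2.2) h2.self_of_nhds.1
      h2.self_of_nhds.2.1 1
    rw [← h3]
    refine ne_of_eq_of_ne ?_ h1
    simp only [Function.comp_apply, coordCLM_apply, wtOp_apply, smul_apply, lp.coeFn_smul,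
      Pi.smul_apply, smul_eq_mul]
    push_cast; ring
  have e2 : ∀ᶠ ε in 𝓝[≠] (0 : ℝ),
      inner ℝ (ε⁻¹ • wtOp (W ε)) (wtOp (deriv W ε)) ≠ (0 : ℝ) := by
    have t1 := ((wtOp.continuous.tendsto _).comp hW).inner (𝕜 := ℝ)
      ((wtOp.continuous.tendsto _).comp hW')
    have h1 : inner ℝ (wtOp wev) (wtOp wev) ≠ (0 : ℝ) := by
      rw [wtOp_wev, inner_ev_left, ev_self]; exact one_ne_zero
    filter_upwards [t1.eventually_ne h1] with ε h2
    simpa using h2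
  filter_upwards [e1, e2] with ε h1 h2
  refine ⟨fun h0 => h1 (by rw [h0]; ring), fun h0 => h2 ?_⟩
  rw [inner_smul_left, h0, mul_zero]

/-- The exact dipole mode of the harmonic trap. -/
theorem dipole_mode {σ μ : ℝ} {a : Ell2}
    (h : ∀ n : ℕ, (μ - n) * (wt n * a n) - σ * cubic a n = 0) (n : ℕ) :
    (n - μ) * derOp a n + 3 * σ * pot a a (derOp a) n = -posOp a n ∧
    (n - μ) * posOp a n + σ * pot a a (posOp a) n = -derOp a n := by
  have hder : 3 * pot a a (derOp a) n = lad (n + 1) * cubic a (n + 1) - lad n * cubic a (n - 1) := by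
    rw [cubic, ← pot_derOp]; ring
  have hpos : pot a a (posOp a) n = lad n * cubic a (n - 1) + lad (n + 1) * cubic a (n + 1) := by
    rw [cubic, ← pot_posOp]
  -- The stationary equations at levels `n ± 1` are combined with ladder coefficients. The unit
  -- shift of the level is the pair of commutators `[H, ∂] = -x`, `[H, x] = -∂` of the oscillator,
  -- and produces the right-hand sides.
  have h1 := h (n + 1)
  have h2 := h (n - 1)
  have h3 : lad n * ((n - 1 : ℕ) : ℝ) = lad n * (n - 1) := by
    cases n with
    | zero => simp
    | succ n => simp
  have e1 : derOp a n = lad (n + 1) * wt (n + 1) * a (n + 1) - lad n * wt (n - 1) * a (n - 1) := by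
    rw [← lowOp_apply, ← raiseOp_apply]; rfl
  have e2 : posOp a n = lad (n + 1) * wt (n + 1) * a (n + 1) + lad n * wt (n - 1) * a (n - 1) := by
    rw [← lowOp_apply, ← raiseOp_apply]; rfl
  push_cast at h1
  constructor
  · rw [e1, e2]
    linear_combination σ * hder - lad (n + 1) * h1 + lad n * h2 + wt (n - 1) * a (n - 1) * h3
  · rw [e1, e2, hpos]
    linear_combination -lad (n + 1) * h1 - lad n * h2 - wt (n - 1) * a (n - 1) * h3

end Family
end DarkSoliton

namespace DarkSoliton

/-! ### Linear algebra on one- and two-dimensional blocks. -/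

section Blocks

theorem Acts.independent {κ : Type*} {lam : κ → ℤ} {R : L2 κ →L[ℝ] L2 κ} {x y : L2 κ} {a b : ℝ} (hx : Acts lam R x (a • x))
    (hy : Acts lam R y (b • y)) (hab : a ≠ b) (hx0 : x ≠ 0) (hy0 : y ≠ 0) {s t : ℝ}
    (h : s • x + t • y = 0) : s = 0 ∧ t = 0 := by
  have h1 := (hx.smul s).add (hy.smul t)
  have h0 : Acts lam R 0 0 := fun i => by simp
  rw [h] at h1
  have h2 := h1.unique h0
  have h3 : (s * (a - b)) • x = 0 := by
    have : (s * (a - b)) • x = (s • a • x + t • b • y) - b • (s • x + t • y) := by module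
    rw [this, h, h2]; simp
  have h4 : (t * (b - a)) • y = 0 := by
    have : (t * (b - a)) • y = (s • a • x + t • b • y) - a • (s • x + t • y) := by module
    rw [this, h, h2]; simp
  have h5 := sub_ne_zero.2 hab
  have h6 := sub_ne_zero.2 hab.symm
  exact ⟨by simpa [hx0, h5] using h3, by simpa [hy0, h6] using h4⟩

theorem Acts.independent_of_kernel {κ : Type*} {lam : κ → ℤ} {R : L2 κ →L[ℝ] L2 κ} {x y : L2 κ} (hx : Acts lam R x 0) (hy : Acts lam R y x)
    (hx0 : x ≠ 0) {s t : ℝ} (h : s • x + t • y = 0) : s = 0 ∧ t = 0 := by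
  have h1 := (hx.smul s).add (hy.smul t)
  have h0 : Acts lam R 0 0 := fun i => by simp
  rw [h] at h1
  have h2 := h1.unique h0
  have h3 : t = 0 := by simpa [hx0] using h2
  rw [h3] at h
  exact ⟨by simpa [hx0] using h, h3⟩

theorem exists_equiv_one_add {κ : Type*} {X : L2 κ →L[ℝ] L2 κ} (hX : ‖X‖ ≤ 1 / 2) : ∃ T : L2 κ ≃L[ℝ] L2 κ, ∀ x, T x = x + X x := by
  have hn : ‖-X‖ < 1 := by rw [norm_neg]; linarith
  refine ⟨ContinuousLinearEquiv.unitsEquiv ℝ (L2 κ) (Units.oneSub (-X) hn), fun x => ?_⟩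
  change (((Units.oneSub (-X) hn : (L2 κ →L[ℝ] L2 κ)ˣ) : L2 κ →L[ℝ] L2 κ)) x = x + X x
  simp

variable {ι : Type*} [DecidableEq ι] {lam : ι → ℤ} {R X D : L2 ι →L[ℝ] L2 ι}

theorem eq_smul_ev {y : L2 ι} {i : ι} (h : ∀ j, j ≠ i → y j = 0) : y = y i • ev i := by
  ext j
  simp only [lp.coeFn_smul, Pi.smul_apply, smul_eq_mul]
  rcases eq_or_ne j i with rfl | hj
  · rw [ev_self, mul_one]
  · rw [h j hj, ev_ne hj, mul_zero]

theorem eq_smul_ev_add {y : L2 ι} {i k : ι} (hik : i ≠ k) (h : ∀ j, j ≠ i → j ≠ k → y j = 0) :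
    y = y i • ev i + y k • ev k := by
  ext j
  simp only [lp.coeFn_add, Pi.add_apply, lp.coeFn_smul, Pi.smul_apply, smul_eq_mul]
  rcases eq_or_ne j i with rfl | hj
  · rw [ev_self, ev_ne hik]; ring
  · rcases eq_or_ne j k with rfl | hk
    · rw [ev_self, ev_ne hj]; ring
    · rw [h j hj hk, ev_ne hj, ev_ne hk]; ring

/-- A two-dimensional block is spanned by any two independent vectors. -/
theorem exists_eq_smul_add_smul {x y w : L2 ι} {i k : ι} (hik : i ≠ k)
    (hx : ∀ j, j ≠ i → j ≠ k → x j = 0) (hy : ∀ j, j ≠ i → j ≠ k → y j = 0)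
    (hw : ∀ j, j ≠ i → j ≠ k → w j = 0) (hli : ∀ s t : ℝ, s • x + t • y = 0 → s = 0 ∧ t = 0) :
    ∃ s t : ℝ, w = s • x + t • y := by
  have ex := eq_smul_ev_add hik hx
  have ey := eq_smul_ev_add hik hy
  have ew := eq_smul_ev_add hik hw
  have hdet : x i * y k - x k * y i ≠ 0 := by
    intro h0
    have h1 := hli (y k) (-x k) (by
      rw [ex, ey]
      simp only [lp.coeFn_add, Pi.add_apply, lp.coeFn_smul, Pi.smul_apply, smul_eq_mul, ev_self,
        ev_ne hik.symm, mul_one, mul_zero, zero_add]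
      match_scalars <;> linarith)
    have h2 := hli (y i) (-x i) (by
      rw [ex, ey]
      simp only [lp.coeFn_add, Pi.add_apply, lp.coeFn_smul, Pi.smul_apply, smul_eq_mul, ev_self,
        ev_ne hik, mul_one, mul_zero, add_zero]
      match_scalars <;> linarith)
    have h3 := hli 1 0 (by
      rw [ex, neg_eq_zero.1 h1.2, neg_eq_zero.1 h2.2]; simp)
    exact one_ne_zero h3.1
  refine ⟨(w i * y k - w k * y i) / (x i * y k - x k * y i),
    (x i * w k - x k * w i) / (x i * y k - x k * y i), ?_⟩
  rw [ex, ey, ew]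
  simp only [lp.coeFn_add, Pi.add_apply, lp.coeFn_smul, Pi.smul_apply, smul_eq_mul, ev_self,
    ev_ne hik, ev_ne hik.symm, mul_one, mul_zero, add_zero, zero_add]
  generalize hd : x i * y k - x k * y i = d at hdet
  match_scalars <;> (field_simp; rw [← hd]; ring)

/-- A singular operator with nonzero trace on a two-dimensional block has its trace as an
eigenvalue. -/
theorem exists_trace_eigenvector {i k : ι} (hik : i ≠ k)
    (hi : ∀ j, j ≠ i → j ≠ k → D (ev i) j = 0) (hk : ∀ j, j ≠ i → j ≠ k → D (ev k) j = 0)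
    {y : L2 ι} (hy : ∀ j, j ≠ i → j ≠ k → y j = 0) (hy0 : y ≠ 0) (hDy : D y = 0)
    (ht : D (ev i) i + D (ev k) k ≠ 0) :
    ∃ x : L2 ι, x ≠ 0 ∧ (∀ j, j ≠ i → j ≠ k → x j = 0) ∧
      D x = (D (ev i) i + D (ev k) k) • x := by
  have ei := eq_smul_ev_add hik hi
  have ek := eq_smul_ev_add hik hk
  have ey := eq_smul_ev_add hik hy
  have hdet : D (ev i) i * D (ev k) k = D (ev k) i * D (ev i) k := by
    have h1 : y i • D (ev i) + y k • D (ev k) = 0 := by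
      rw [← map_smul, ← map_smul, ← map_add, ← ey, hDy]
    have h2 : y i * D (ev i) i + y k * D (ev k) i = 0 := congrArg (fun z : L2 ι => z i) h1
    have h3 : y i * D (ev i) k + y k * D (ev k) k = 0 := congrArg (fun z : L2 ι => z k) h1
    by_contra hne
    have hne' : D (ev i) i * D (ev k) k - D (ev k) i * D (ev i) k ≠ 0 := sub_ne_zero.2 hne
    have h4 : y i = 0 := (mul_eq_zero.1 (by linear_combination D (ev k) k * h2 - D (ev k) i * h3 :
      y i * (D (ev i) i * D (ev k) k - D (ev k) i * D (ev i) k) = 0)).resolve_right hne'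
    have h5 : y k = 0 := (mul_eq_zero.1 (by linear_combination D (ev i) i * h3 - D (ev i) k * h2 :
      y k * (D (ev i) i * D (ev k) k - D (ev k) i * D (ev i) k) = 0)).resolve_right hne'
    exact hy0 (by rw [ey, h4, h5]; simp)
  -- The block has determinant zero, so Cayley–Hamilton reads `D² = (tr D) D`: every nonzero column
  -- of `D` is an eigenvector for the trace.
  by_cases h0 : D (ev i) = 0
  · refine ⟨D (ev k), fun h => ht (by rw [h0, h]; simp), hk, ?_⟩
    conv_lhs => rw [ek]
    rw [map_add, map_smul, map_smul, h0]
    simp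
  · refine ⟨D (ev i), h0, hi, ?_⟩
    conv_lhs => rw [ei]
    rw [map_add, map_smul, map_smul]
    ext j
    simp only [lp.coeFn_add, Pi.add_apply, lp.coeFn_smul, Pi.smul_apply, smul_eq_mul]
    by_cases h1 : j = i
    · rw [h1]; linarith
    by_cases h2 : j = k
    · rw [h2]; linear_combination
    rw [hi j h1 h2, hk j h1 h2]; ring

/-- `D` is a block diagonalisation of the perturbation `R` of `diag(lam)`, under the
conjugation by `1 + X`. -/
structure BlockDiag (lam : ι → ℤ) (R X D : L2 ι →L[ℝ] L2 ι) : Prop where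
  off : ∀ i j, lam i ≠ lam j → D (ev j) i = 0
  conj : ∀ i j, lam i * X (ev j) i - X (ev j) i * lam j + R (ev j) i + R (X (ev j)) i =
      D (ev j) i + X (D (ev j)) i
  norm_R : ‖R‖ < 1 / 2
  norm_D : ‖D‖ < 1 / 2
  norm_X : ‖X‖ ≤ 1 / 2

/-- The spectral block of an eigenvector. -/
theorem BlockDiag.symm_apply_eq_zero (h : BlockDiag lam R X D) {T : L2 ι ≃L[ℝ] L2 ι}
    (hT : ∀ x, T x = x + X x) {x : L2 ι} {ν : ℝ} (hx : Acts lam R x (ν • x)) {k : ℤ}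
    (hk : |(k : ℝ) - ν| < 1 / 2) {j : ι} (hj : lam j ≠ k) : T.symm x j = 0 := by
  have h1 := hx.of_conj h.conj h.norm_R h.norm_D T hT
  rw [map_smul] at h1
  refine h1.apply_eq_zero h.off h.norm_D ?_
  have h2 : (1 : ℝ) ≤ |(lam j : ℝ) - k| := by
    exact_mod_cast Int.one_le_abs (sub_ne_zero.2 hj)
  have h3 := abs_sub_abs_le_abs_sub ((lam j : ℝ) - k) (ν - k)
  rw [abs_sub_comm ν, sub_sub_sub_cancel_right] at h3
  linarith

/-- The spectral block of a generalised kernel vector. -/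
theorem BlockDiag.symm_apply_eq_zero_of_kernel (h : BlockDiag lam R X D) {T : L2 ι ≃L[ℝ] L2 ι}
    (hT : ∀ x, T x = x + X x) {x z : L2 ι} (hx : Acts lam R x z) (hz : Acts lam R z 0) {j : ι}
    (hj : lam j ≠ 0) : T.symm x j = 0 := by
  obtain ⟨Q, hQ⟩ := exists_block_projection lam (fun k => k ≠ 0)
  have h1 := hx.of_conj h.conj h.norm_R h.norm_D T hT
  have h2 : Q (T.symm z) = 0 := by
    ext i
    rw [hQ]
    split_ifs with hi
    · exact h.symm_apply_eq_zero hT (ν := 0) (k := 0) (by simpa using hz) (by simp) hi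
    · rfl
  have h3 := h1.restrict (p := fun k => k ≠ 0) h.off hQ
  rw [h2] at h3
  have h4 : Q (T.symm x) j = 0 := by
    refine Acts.apply_eq_zero (ν := 0) h.off h.norm_D (by simpa using h3) ?_
    have h5 : (1 : ℝ) ≤ |(lam j : ℝ)| := by exact_mod_cast Int.one_le_abs hj
    rw [sub_zero]; linarith
  rw [hQ, if_pos hj] at h4
  exact h4

end Blocks

/-! ### Labels, levels and unperturbed frequencies of the modes. -/

section Modes

/-- Labels of the modes: positive frequencies, negative frequencies, and the zero modes. -/
abbrev Mode := ℕ ⊕ ℕ ⊕ Fin 2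

/-- The oscillator level of a mode. -/
def site : Mode → ℕ
  | .inl 0 => 0
  | .inl (m + 1) => m + 2
  | .inr (.inl 0) => 0
  | .inr (.inl (m + 1)) => m + 2
  | .inr (.inr _) => 1

/-- The sign relating the two components of a mode. -/
def sgn : Mode → ℤ
  | .inl 0 => -1
  | .inl (_ + 1) => 1
  | .inr (.inl 0) => 1
  | .inr (.inl (_ + 1)) => -1
  | .inr (.inr 0) => 1
  | .inr (.inr 1) => -1

/-- The unperturbed frequency of a mode. -/
def freq (i : Mode) : ℤ := sgn i * (site i - 1)

theorem sgn_sq (i : Mode) : sgn i * sgn i = 1 := by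
  rcases i with (_ | m) | (_ | m) | i
  all_goals try rfl
  fin_cases i <;> rfl

theorem freq_inl_zero : freq (.inl 0) = 1 := rfl
theorem freq_inl_succ (m : ℕ) : freq (.inl (m + 1)) = m + 1 := by
  simp [freq, sgn, site]; ring
theorem freq_inr_inl (m : ℕ) : freq (.inr (.inl m)) = -freq (.inl m) := by
  cases m <;> simp [freq, sgn, site]
theorem freq_inr_inr (i : Fin 2) : freq (.inr (.inr i)) = 0 := by
  simp [freq, site]

theorem freq_eq_zero {i : Mode} (h : freq i = 0) :
    i = .inr (.inr 0) ∨ i = .inr (.inr 1) := by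
  rcases i with (_ | m) | (_ | m) | i
  · simp [freq_inl_zero] at h
  · rw [freq_inl_succ] at h; omega
  · simp [freq_inr_inl, freq_inl_zero] at h
  · rw [freq_inr_inl, freq_inl_succ] at h; omega
  · fin_cases i <;> simp

theorem freq_eq_one {i : Mode} (h : freq i = 1) : i = .inl 0 ∨ i = .inl 1 := by
  rcases i with (_ | m) | (_ | m) | i
  · simp
  · rw [freq_inl_succ] at h
    have : m = 0 := by omega
    simp [this]
  · simp [freq_inr_inl, freq_inl_zero] at h
  · rw [freq_inr_inl, freq_inl_succ] at h; omega
  · rw [freq_inr_inr] at h; omega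

theorem freq_eq_neg_one {i : Mode} (h : freq i = -1) : i = .inr (.inl 0) ∨ i = .inr (.inl 1) := by
  rcases i with (_ | m) | (_ | m) | i
  · simp [freq_inl_zero] at h
  · rw [freq_inl_succ] at h; omega
  · simp
  · rw [freq_inr_inl, freq_inl_succ] at h
    have : m = 0 := by omega
    simp [this]
  · rw [freq_inr_inr] at h; omega

theorem freq_eq_inl {i : Mode} {m : ℕ} (h : freq i = freq (.inl (m + 2))) : i = .inl (m + 2) := by
  rw [freq_inl_succ] at h
  rcases i with (_ | k) | (_ | k) | i
  · rw [freq_inl_zero] at h; omega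
  · rw [freq_inl_succ] at h
    have : k = m + 1 := by omega
    rw [this]
  · rw [freq_inr_inl, freq_inl_zero] at h; omega
  · rw [freq_inr_inl, freq_inl_succ] at h; omega
  · rw [freq_inr_inr] at h; omega

theorem freq_eq_inr {i : Mode} {m : ℕ} (h : freq i = freq (.inr (.inl (m + 2)))) :
    i = .inr (.inl (m + 2)) := by
  rw [freq_inr_inl, freq_inl_succ] at h
  rcases i with (_ | k) | (_ | k) | i
  · rw [freq_inl_zero] at h; omega
  · rw [freq_inl_succ] at h; omega
  · rw [freq_inr_inl, freq_inl_zero] at h; omega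
  · rw [freq_inr_inl, freq_inl_succ] at h
    have : k = m + 1 := by omega
    rw [this]
  · rw [freq_inr_inr] at h; omega

theorem one_le_freq_inl (m : ℕ) : 1 ≤ freq (.inl m) := by
  cases m with
  | zero => rw [freq_inl_zero]
  | succ m => rw [freq_inl_succ]; omega

end Modes
end DarkSoliton

namespace DarkSoliton

/-! ### Perturbed eigenvectors: existence, exhaustion, basis property. -/

section ModeSystem

variable {R X D : L2 Mode →L[ℝ] L2 Mode}

/-- A system of eigenvectors and generalised kernel vectors of `diag(freq) + R`, labelled by the
modes. -/
structure IsModeSystem (R : L2 Mode →L[ℝ] L2 Mode) (Ω : ℕ → ℝ) (v : Mode → L2 Mode) : Prop where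
  ne_zero : ∀ i, v i ≠ 0
  close : ∀ m, |(freq (.inl m) : ℝ) - Ω m| < 1 / 2
  distinct : Ω 0 ≠ Ω 1
  pos : ∀ m, Acts freq R (v (.inl m)) (Ω m • v (.inl m))
  neg : ∀ m, Acts freq R (v (.inr (.inl m))) ((-Ω m) • v (.inr (.inl m)))
  ker : Acts freq R (v (.inr (.inr 0))) 0
  gen_ker : Acts freq R (v (.inr (.inr 1))) (v (.inr (.inr 0)))

variable {Ω : ℕ → ℝ} {v : Mode → L2 Mode}

theorem IsModeSystem.pos_of_close (hv : IsModeSystem R Ω v) (m : ℕ) : 0 < Ω m := by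
  have h1 := (abs_lt.1 (hv.close m)).2
  have h2 : (1 : ℝ) ≤ freq (.inl m) := by exact_mod_cast one_le_freq_inl m
  linarith

/-- Closeness recovers the unperturbed frequency from `Ω m`, and only the labels `0` and `1` share
one; these are separated by `distinct`. -/
theorem IsModeSystem.injective (hv : IsModeSystem R Ω v) : Function.Injective Ω := by
  intro m k h
  have h1 := abs_lt.1 (hv.close m)
  have h2 := abs_lt.1 (hv.close k)
  rw [h] at h1
  have h3 : freq (.inl m) = freq (.inl k) := by
    have a1 : freq (.inl m) < freq (.inl k) + 1 := by
      exact_mod_cast (by linarith : (freq (.inl m) : ℝ) < freq (.inl k) + 1)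
    have a2 : freq (.inl k) < freq (.inl m) + 1 := by
      exact_mod_cast (by linarith : (freq (.inl k) : ℝ) < freq (.inl m) + 1)
    omega
  match m, k with
  | 0, 0 => rfl
  | 0, 1 => exact (hv.distinct h).elim
  | 1, 0 => exact (hv.distinct h.symm).elim
  | 0, k + 2 => rw [freq_inl_zero, freq_inl_succ] at h3; omega
  | m + 2, 0 => rw [freq_inl_zero, freq_inl_succ] at h3; omega
  | m + 1, k + 1 => rw [freq_inl_succ, freq_inl_succ] at h3; omega

variable {T : L2 Mode ≃L[ℝ] L2 Mode}

theorem IsModeSystem.symm_apply_eq_zero (hv : IsModeSystem R Ω v) (h : BlockDiag freq R X D)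
    (hT : ∀ x, T x = x + X x) {i j : Mode} (hij : freq j ≠ freq i) : T.symm (v i) j = 0 := by
  match i with
  | .inl m => exact h.symm_apply_eq_zero hT (hv.pos m) (hv.close m) hij
  | .inr (.inl m) =>
    refine h.symm_apply_eq_zero hT (hv.neg m) ?_ hij
    rw [freq_inr_inl, Int.cast_neg, ← neg_sub', abs_neg]
    exact hv.close m
  | .inr (.inr 0) =>
    exact h.symm_apply_eq_zero_of_kernel hT hv.ker (z := 0) (fun i => by simp) (by
      rwa [freq_inr_inr] at hij)
  | .inr (.inr 1) =>
    exact h.symm_apply_eq_zero_of_kernel hT hv.gen_ker hv.ker (by rwa [freq_inr_inr] at hij)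

theorem IsModeSystem.independent_pos (hv : IsModeSystem R Ω v) {s t : ℝ}
    (h : s • v (.inl 0) + t • v (.inl 1) = 0) : s = 0 ∧ t = 0 :=
  (hv.pos 0).independent (hv.pos 1) hv.distinct (hv.ne_zero _) (hv.ne_zero _) h

theorem IsModeSystem.independent_neg (hv : IsModeSystem R Ω v) {s t : ℝ}
    (h : s • v (.inr (.inl 0)) + t • v (.inr (.inl 1)) = 0) : s = 0 ∧ t = 0 :=
  (hv.neg 0).independent (hv.neg 1) (fun h => hv.distinct (neg_injective h)) (hv.ne_zero _)
    (hv.ne_zero _) h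

theorem IsModeSystem.independent_ker (hv : IsModeSystem R Ω v) {s t : ℝ}
    (h : s • v (.inr (.inr 0)) + t • v (.inr (.inr 1)) = 0) : s = 0 ∧ t = 0 :=
  hv.ker.independent_of_kernel hv.gen_ker (hv.ne_zero _) h

/-- Eigenvectors with positive eigenvalue belong to the system. -/
theorem IsModeSystem.exhaust (hv : IsModeSystem R Ω v) (h : BlockDiag freq R X D)
    {x : L2 Mode} {ν : ℝ} (hν : 0 < ν) (hx0 : x ≠ 0) (hx : Acts freq R x (ν • x)) :
    ∃ m, ν = Ω m ∧ ∃ c : ℝ, x = c • v (.inl m) := by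
  obtain ⟨T, hT⟩ := exists_equiv_one_add h.norm_X
  have hy0 : T.symm x ≠ 0 := by simpa using hx0
  obtain ⟨i, hi⟩ : ∃ i, T.symm x i ≠ 0 := by
    by_contra! hall
    exact hy0 (by ext i; exact hall i)
  have hyD := hx.of_conj h.conj h.norm_R h.norm_D T hT
  rw [map_smul] at hyD
  have hclose : |(freq i : ℝ) - ν| < 1 / 2 := by
    by_contra hcon
    exact hi (hyD.apply_eq_zero h.off h.norm_D (not_lt.1 hcon))
  have hsupp : ∀ j, freq j ≠ freq i → T.symm x j = 0 := fun j hj =>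
    h.symm_apply_eq_zero hT hx hclose hj
  have hnonneg : 0 ≤ freq i := by
    have h1 := (abs_lt.1 hclose).1
    have h2 : (-1 : ℝ) < freq i := by linarith
    have h3 : -1 < freq i := by exact_mod_cast h2
    omega
  have hprop : ∀ m, (∃ c : ℝ, x = c • v (.inl m)) → ∃ m, ν = Ω m ∧ ∃ c : ℝ, x = c • v (.inl m) := by
    rintro m ⟨c, hc⟩
    refine ⟨m, ?_, c, hc⟩
    have h1 := (hv.pos m).smul c
    rw [smul_comm, ← hc] at h1
    have h2 : (ν - Ω m) • x = 0 := by rw [sub_smul, hx.unique h1, sub_self]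
    exact sub_eq_zero.1 ((smul_eq_zero.1 h2).resolve_right hx0)
  -- In the block of frequency `0` the operator is nilpotent on the span of the two kernel modes, so
  -- it has no eigenvalue `ν > 0`.
  rcases hnonneg.eq_or_lt with h0 | h0
  · have hnot {j : Mode} (h1 : j ≠ .inr (.inr 0)) (h2 : j ≠ .inr (.inr 1)) : freq j ≠ 0 :=
      fun hj => (freq_eq_zero hj).elim h1 h2
    obtain ⟨s, t, hst⟩ := exists_eq_smul_add_smul (x := T.symm (v (.inr (.inr 0))))
      (y := T.symm (v (.inr (.inr 1)))) (w := T.symm x) (i := .inr (.inr 0)) (k := .inr (.inr 1))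
      (by simp)
      (fun j h1 h2 => hv.symm_apply_eq_zero h hT (by rw [freq_inr_inr]; exact hnot h1 h2))
      (fun j h1 h2 => hv.symm_apply_eq_zero h hT (by rw [freq_inr_inr]; exact hnot h1 h2))
      (fun j h1 h2 => hsupp j (by rw [← h0]; exact hnot h1 h2))
      (fun s t hst => hv.independent_ker (T.symm.injective (by simpa using hst)))
    rw [← map_smul, ← map_smul, ← map_add] at hst
    have hst' := T.symm.injective hst
    have h1 := (hv.ker.smul s).add (hv.gen_ker.smul t)
    rw [← hst'] at h1
    have h2 := hx.unique h1
    have h3 : (ν * s - t) • v (.inr (.inr 0)) + (ν * t) • v (.inr (.inr 1)) = 0 := by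
      have : (ν * s - t) • v (.inr (.inr 0)) + (ν * t) • v (.inr (.inr 1)) =
        ν • (s • v (.inr (.inr 0)) + t • v (.inr (.inr 1))) -
          (s • (0 : L2 Mode) + t • v (.inr (.inr 0))) := by module
      rw [this, ← hst', h2, sub_self]
    obtain ⟨h4, h5⟩ := hv.independent_ker h3
    have ht : t = 0 := by simpa [hν.ne'] using h5
    have hs : s = 0 := by simpa [hν.ne', ht] using h4
    rw [hs, ht] at hst'
    exact (hx0 (by simpa using hst')).elim
  · have hcase : freq i = 1 ∨ ∃ m, i = .inl (m + 2) := by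
      rcases i with (_ | _ | m) | m | i
      · exact .inl rfl
      · exact .inl rfl
      · exact .inr ⟨m, rfl⟩
      · rw [freq_inr_inl] at h0
        have := one_le_freq_inl m
        omega
      · rw [freq_inr_inr] at h0
        exact (lt_irrefl _ h0).elim
    -- In the double block, comparing coefficients in the two independent modes leaves only one of
    -- them, since `Ω 0 ≠ Ω 1`. The remaining positive blocks are one-dimensional.
    rcases hcase with h1 | ⟨m, rfl⟩
    · have hnot {j : Mode} (h1 : j ≠ .inl 0) (h2 : j ≠ .inl 1) : freq j ≠ 1 :=
        fun hj => (freq_eq_one hj).elim h1 h2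
      obtain ⟨s, t, hst⟩ := exists_eq_smul_add_smul (x := T.symm (v (.inl 0)))
        (y := T.symm (v (.inl 1))) (w := T.symm x) (i := .inl 0) (k := .inl 1) (by simp)
        (fun j h1 h2 => hv.symm_apply_eq_zero h hT (hnot h1 h2))
        (fun j h1 h2 => hv.symm_apply_eq_zero h hT (hnot h1 h2))
        (fun j h2 h3 => hsupp j (by rw [h1]; exact hnot h2 h3))
        (fun s t hst => hv.independent_pos (T.symm.injective (by simpa using hst)))
      rw [← map_smul, ← map_smul, ← map_add] at hst
      have hst' := T.symm.injective hst
      have h2 := ((hv.pos 0).smul s).add ((hv.pos 1).smul t)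
      rw [← hst'] at h2
      have h3 : (s * (ν - Ω 0)) • v (.inl 0) + (t * (ν - Ω 1)) • v (.inl 1) = 0 := by
        have : (s * (ν - Ω 0)) • v (.inl 0) + (t * (ν - Ω 1)) • v (.inl 1) =
          ν • (s • v (.inl 0) + t • v (.inl 1)) -
            (s • Ω 0 • v (.inl 0) + t • Ω 1 • v (.inl 1)) := by module
        rw [this, ← hst', hx.unique h2, sub_self]
      obtain ⟨h4, h5⟩ := hv.independent_pos h3
      by_cases hs : s = 0
      · exact hprop 1 ⟨t, by rw [hst', hs]; simp⟩
      · by_cases ht : t = 0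
        · exact hprop 0 ⟨s, by rw [hst', ht]; simp⟩
        · have e0 := (mul_eq_zero.1 h4).resolve_left hs
          have e1 := (mul_eq_zero.1 h5).resolve_left ht
          exact (hv.distinct (by linarith)).elim
    · have e1 := eq_smul_ev (y := T.symm x) (i := .inl (m + 2)) (fun j hj =>
        hsupp j (fun h => hj (freq_eq_inl h)))
      have e2 := eq_smul_ev (y := T.symm (v (.inl (m + 2)))) (i := .inl (m + 2)) (fun j hj =>
        hv.symm_apply_eq_zero h hT (fun h => hj (freq_eq_inl h)))
      have hne : T.symm (v (.inl (m + 2))) (.inl (m + 2)) ≠ 0 := fun h0 => by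
        rw [h0, zero_smul] at e2
        exact hv.ne_zero _ (by simpa using e2)
      refine hprop (m + 2) ⟨T.symm x (.inl (m + 2)) / T.symm (v (.inl (m + 2))) (.inl (m + 2)),
        T.symm.injective ?_⟩
      rw [map_smul, e2, e1, smul_smul]
      congr 1
      simp [hne]

/-- The standard Hilbert basis of `L2 ι`. -/
theorem exists_hilbertBasis_ev {ι : Type*} [DecidableEq ι] :
    ∃ b : HilbertBasis ι ℝ (L2 ι), ∀ i, b i = ev i := by
  refine ⟨HilbertBasis.ofRepr (LinearIsometryEquiv.refl ℝ _), fun i => ?_⟩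
  rw [← HilbertBasis.repr_symm_single]
  rfl

/-- `T⁻¹ vᵢ` lies in the block of mode `i`. Outside the six modes in `F`, which fill the blocks of
frequency `0` and `±1`, it is a multiple of the coordinate vector; inside, independence in each pair
allows an invertible change `U`. Hence `vᵢ` is a scalar times `T U eᵢ`. -/
theorem IsModeSystem.isScaledRieszBasis (hv : IsModeSystem R Ω v) (h : BlockDiag freq R X D) :
    IsScaledRieszBasis v := by
  obtain ⟨T, hT⟩ := exists_equiv_one_add h.norm_X
  have hsupp {i j : Mode} (hij : freq j ≠ freq i) := hv.symm_apply_eq_zero h hT hij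
  let F : Finset Mode := {.inl 0, .inl 1, .inr (.inl 0), .inr (.inl 1), .inr (.inr 0), .inr (.inr 1)}
  have hF (i : Mode) : i ∈ F ↔ freq i = 1 ∨ freq i = -1 ∨ freq i = 0 := by
    simp only [F, Finset.mem_insert, Finset.mem_singleton]
    constructor
    · rintro (rfl | rfl | rfl | rfl | rfl | rfl) <;> decide
    · rintro (h | h | h)
      · rcases freq_eq_one h with h | h <;> simp [h]
      · rcases freq_eq_neg_one h with h | h <;> simp [h]
      · rcases freq_eq_zero h with h | h <;> simp [h]
  have hoff {i : Mode} (hi : i ∉ F) {j : Mode} (hj : freq j = freq i) : j = i := by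
    rcases i with (_ | _ | m) | (_ | _ | m) | i
    · simp [F] at hi
    · simp [F] at hi
    · exact freq_eq_inl hj
    · simp [F] at hi
    · simp [F] at hi
    · exact freq_eq_inr hj
    · exact (hi ((hF _).2 (.inr (.inr (freq_inr_inr i))))).elim
  obtain ⟨U, hU1, hU2, -⟩ := exists_finite_change F (fun i => T.symm (v i))
    (fun i hi j hj => hsupp fun hij => hj ((hF j).2 (hij ▸ (hF i).1 hi)))
    (fun z hz => by
      have hsum : ∀ w : Mode → L2 Mode, ∑ i ∈ F, w i = (w (.inl 0) + w (.inl 1)) +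
          (w (.inr (.inl 0)) + w (.inr (.inl 1))) +
          (w (.inr (.inr 0)) + w (.inr (.inr 1))) := fun w => by
        simp only [F]
        repeat rw [Finset.sum_insert (by simp)]
        rw [Finset.sum_singleton]
        abel
      rw [hsum] at hz
      have hz' (j : Mode) := congrArg (fun y : L2 Mode => y j) hz
      simp only [lp.coeFn_add, Pi.add_apply, lp.coeFn_smul, Pi.smul_apply, smul_eq_mul,
        lp.coeFn_zero, Pi.zero_apply] at hz'
      have i1 := hv.independent_pos (s := z (.inl 0)) (t := z (.inl 1)) (T.symm.injective (by
        ext j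
        have := hz' j
        simp only [map_add, map_smul, map_zero, lp.coeFn_add, Pi.add_apply, lp.coeFn_smul,
          Pi.smul_apply, smul_eq_mul, lp.coeFn_zero, Pi.zero_apply]
        by_cases hj : freq j = 1
        · rw [hsupp (i := .inr (.inl 0)) (by rw [hj]; decide),
            hsupp (i := .inr (.inl 1)) (by rw [hj]; decide),
            hsupp (i := .inr (.inr 0)) (by rw [hj]; decide),
            hsupp (i := .inr (.inr 1)) (by rw [hj]; decide)] at this
          linarith
        · rw [hsupp (i := .inl 0) hj, hsupp (i := .inl 1) hj]; ring))
      have i2 := hv.independent_neg (s := z (.inr (.inl 0))) (t := z (.inr (.inl 1)))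
        (T.symm.injective (by
        ext j
        have := hz' j
        simp only [map_add, map_smul, map_zero, lp.coeFn_add, Pi.add_apply, lp.coeFn_smul,
          Pi.smul_apply, smul_eq_mul, lp.coeFn_zero, Pi.zero_apply]
        by_cases hj : freq j = -1
        · rw [hsupp (i := .inl 0) (by rw [hj]; decide),
            hsupp (i := .inl 1) (by rw [hj]; decide),
            hsupp (i := .inr (.inr 0)) (by rw [hj]; decide),
            hsupp (i := .inr (.inr 1)) (by rw [hj]; decide)] at this
          linarith
        · rw [hsupp (i := .inr (.inl 0)) hj, hsupp (i := .inr (.inl 1)) hj]; ring))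
      have i3 := hv.independent_ker (s := z (.inr (.inr 0))) (t := z (.inr (.inr 1)))
        (T.symm.injective (by
        have := hz
        rw [i1.1, i1.2, i2.1, i2.2] at this
        simpa using this))
      intro i hi
      simp only [F, Finset.mem_insert, Finset.mem_singleton] at hi
      rcases hi with rfl | rfl | rfl | rfl | rfl | rfl
      exacts [i1.1, i1.2, i2.1, i2.2, i3.1, i3.2])
  obtain ⟨b, hb⟩ := exists_hilbertBasis_ev (ι := Mode)
  refine ⟨b, U.trans T, fun i => if i ∈ F then 1 else T.symm (v i) i, fun i => ?_, fun i => ?_⟩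
  · dsimp only
    split_ifs with hi
    · exact one_ne_zero
    · intro h0
      have e := eq_smul_ev (y := T.symm (v i)) (i := i) fun j hj => hsupp fun h => hj (hoff hi h)
      rw [h0, zero_smul] at e
      exact hv.ne_zero i (by simpa using e)
  · rw [ContinuousLinearEquiv.trans_apply, hb]
    dsimp only
    split_ifs with hi
    · rw [hU1 i hi, one_smul, T.apply_symm_apply]
    · have e := eq_smul_ev (y := T.symm (v i)) (i := i) fun j hj => hsupp fun h => hj (hoff hi h)
      rw [hU2 i hi, ← map_smul, ← e, T.apply_symm_apply]

/-- Existence of the eigenvectors of positive frequency, given the eigenvalue `1` and a nonzero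
trace on the block of frequency one. -/
theorem exists_positive_modes (h : BlockDiag freq R X D) {x₀ : L2 Mode} (hx₀ : x₀ ≠ 0)
    (hx₀' : Acts freq R x₀ ((1 : ℝ) • x₀))
    (ht : D (ev (.inl 0)) (.inl 0) + D (ev (.inl 1)) (.inl 1) ≠ 0) :
    ∃ (Ω : ℕ → ℝ) (u : ℕ → L2 Mode), Ω 0 ≠ Ω 1 ∧ ∀ m, u m ≠ 0 ∧
      Acts freq R (u m) (Ω m • u m) ∧ |(freq (.inl m) : ℝ) - Ω m| < 1 / 2 := by
  obtain ⟨T, hT⟩ := exists_equiv_one_add h.norm_X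
  have hnot {j : Mode} (h1 : j ≠ .inl 0) (h2 : j ≠ .inl 1) : freq j ≠ 1 :=
    fun hj => (freq_eq_one hj).elim h1 h2
  have hy0 : ∀ j, freq j ≠ 1 → T.symm x₀ j = 0 := fun j hj =>
    h.symm_apply_eq_zero hT hx₀' (by norm_num) hj
  -- The eigenvalue equals the unperturbed frequency of the block, so nothing is left for `D`.
  have hDy : D (T.symm x₀) = 0 := by
    have h1 := hx₀'.of_conj h.conj h.norm_R h.norm_D T hT
    rw [one_smul] at h1
    ext j
    have h2 := h1 j
    by_cases hj : freq j = 1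
    · rw [hj] at h2
      push_cast at h2
      rw [lp.coeFn_zero, Pi.zero_apply]; linarith
    · rw [hy0 j hj] at h2
      rw [lp.coeFn_zero, Pi.zero_apply]; linarith
  obtain ⟨y₁, hy₁, hs, hDy₁⟩ := exists_trace_eigenvector (D := D) (i := Sum.inl 0)
    (k := Sum.inl 1) (y := T.symm x₀) (by simp) (fun j h1 h2 => h.off _ _ (hnot h1 h2))
    (fun j h1 h2 => h.off _ _ (hnot h1 h2)) (fun j h1 h2 => hy0 j (hnot h1 h2))
    (by simpa using hx₀) hDy ht
  set t := D (ev (.inl 0)) (.inl 0) + D (ev (.inl 1)) (.inl 1) with htdef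
  have ht' : |t| < 1 / 2 := by
    have h1 := D.le_opNorm y₁
    rw [hDy₁, norm_smul, Real.norm_eq_abs] at h1
    exact (le_of_mul_le_mul_right h1 (norm_pos_iff.2 hy₁)).trans_lt h.norm_D
  -- The given eigenvalue `1`, its partner shifted by the trace `t` of the singular block, and the
  -- diagonal entries on the simple blocks.
  let Ω : ℕ → ℝ
    | 0 => 1
    | 1 => 1 + t
    | m + 2 => freq (.inl (m + 2)) + D (ev (.inl (m + 2))) (.inl (m + 2))
  let u : ℕ → L2 Mode
    | 0 => x₀
    | 1 => T y₁
    | m + 2 => T (ev (.inl (m + 2)))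
  refine ⟨Ω, u, fun h0 => ht ?_, fun m => ?_⟩
  · have h1 : (1 : ℝ) = 1 + t := h0
    linarith
  match m with
  | 0 => exact ⟨hx₀, hx₀', by simp [Ω, freq_inl_zero]⟩
  | 1 =>
    refine ⟨by simpa [u] using hy₁, ?_, ?_⟩
    · have h1 : Acts freq D y₁ ((1 + t) • y₁) := fun j => by
        rw [hDy₁]
        simp only [lp.coeFn_smul, Pi.smul_apply, smul_eq_mul]
        by_cases hj : freq j = 1
        · rw [hj]; push_cast; ring
        · rw [hs j (by rintro rfl; exact hj rfl) (by rintro rfl; exact hj rfl)]; ring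
      have h2 := h1.conj h.conj
      rw [← hT, ← hT, map_smul] at h2
      exact h2
    · have : freq (.inl 1) = 1 := rfl
      simpa [Ω, this] using ht'
  | m + 2 =>
    refine ⟨?_, ?_, ?_⟩
    · have : ev (Sum.inl (m + 2) : Mode) ≠ 0 := fun h0 => by
        have h1 := norm_ev (Sum.inl (m + 2) : Mode)
        rw [h0, norm_zero] at h1
        exact zero_ne_one h1
      simpa [u] using this
    · have e := eq_smul_ev (y := D (ev (.inl (m + 2)))) (i := .inl (m + 2))
        fun j hj => h.off _ _ fun h => hj (freq_eq_inl h)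
      have h1 : Acts freq D (ev (.inl (m + 2))) (Ω (m + 2) • ev (.inl (m + 2))) := fun j => by
        rw [e]
        simp only [lp.coeFn_smul, Pi.smul_apply, smul_eq_mul, Ω]
        by_cases hj : j = .inl (m + 2)
        · rw [hj]; ring
        · rw [ev_ne hj]; ring
      have h2 := h1.conj h.conj
      rw [← hT, ← hT, map_smul] at h2
      exact h2
    · have h1 := abs_apply_le (D (ev (.inl (m + 2)))) (.inl (m + 2))
      have h2 := D.le_opNorm (ev (.inl (m + 2)))
      rw [norm_ev, mul_one] at h2
      simp only [Ω, sub_add_cancel_left, abs_neg]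
      exact (h1.trans h2).trans_lt h.norm_D

end ModeSystem
end DarkSoliton

namespace DarkSoliton

/-! ### The linear problem in mode coordinates, and the spectral theorem for small potentials. -/

section Hamiltonian

theorem IsScaledRieszBasis.of_isometry {ι E E' : Type*} [NormedAddCommGroup E]
    [InnerProductSpace ℝ E] [NormedAddCommGroup E'] [InnerProductSpace ℝ E'] (e : E ≃ₗᵢ[ℝ] E')
    {v : ι → E} (h : IsScaledRieszBasis fun i => e (v i)) : IsScaledRieszBasis v := by
  obtain ⟨b, T, c, hc, hv⟩ := h
  refine ⟨HilbertBasis.ofRepr (e.trans b.repr),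
    (e.toContinuousLinearEquiv.trans T).trans e.symm.toContinuousLinearEquiv, c, hc, fun i => ?_⟩
  classical
  have h1 : HilbertBasis.ofRepr (e.trans b.repr) i = e.symm (b i) := by
    rw [← HilbertBasis.repr_symm_single, ← HilbertBasis.repr_symm_single]; rfl
  rw [h1]
  change v i = c i • e.symm (T (e (e.symm (b i))))
  rw [e.apply_symm_apply, ← map_smul, ← hv, e.symm_apply_apply]

theorem inner_pair (B C B' C' : Ell2) :
    inner ℝ (pair B C) (pair B' C') = inner ℝ B B' + inner ℝ C C' := rfl

theorem pair_fst_snd (x : Ell2Pair) : pair x.fst x.snd = x := rfl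

theorem pair_fst (B C : Ell2) : (pair B C).fst = B := rfl

theorem pair_snd (B C : Ell2) : (pair B C).snd = C := rfl

theorem smul_pair (c : ℝ) (B C : Ell2) : c • pair B C = pair (c • B) (c • C) := rfl

theorem pair_eq_zero {B C : Ell2} : pair B C = 0 ↔ B = 0 ∧ C = 0 := by
  constructor
  · intro h
    exact ⟨congrArg (fun x : Ell2Pair => x.fst) h, congrArg (fun x : Ell2Pair => x.snd) h⟩
  · rintro ⟨rfl, rfl⟩
    rfl

/-- The unit vector of a mode. -/
noncomputable def modeVec (i : Mode) : Ell2Pair :=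
  pair ((√2)⁻¹ • ev (site i)) (((√2)⁻¹ * sgn i) • ev (site i))

theorem inner_modeVec (i : Mode) (B C : Ell2) :
    inner ℝ (modeVec i) (pair B C) = (√2)⁻¹ * (B (site i) + sgn i * C (site i)) := by
  rw [modeVec, inner_pair, inner_smul_left, inner_smul_left, inner_ev_left, inner_ev_left]
  simp only [conj_trivial]
  ring

theorem mode_ext {i j : Mode} (h : site i = site j) (h' : sgn i = sgn j) : i = j := by
  rcases i with (_ | m) | (_ | m) | i <;> rcases j with (_ | k) | (_ | k) | j <;>
    try fin_cases i
  all_goals try fin_cases j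
  all_goals simp_all [site, sgn]

/-- The labels exhaust all pairs of a level and a sign; this is what makes the mode vectors
complete. -/
theorem exists_mode (n : ℕ) (s : Bool) : ∃ i, site i = n ∧ sgn i = if s then 1 else -1 := by
  match n, s with
  | 0, true => exact ⟨.inr (.inl 0), rfl, rfl⟩
  | 0, false => exact ⟨.inl 0, rfl, rfl⟩
  | 1, true => exact ⟨.inr (.inr 0), rfl, rfl⟩
  | 1, false => exact ⟨.inr (.inr 1), rfl, rfl⟩
  | n + 2, true => exact ⟨.inl (n + 1), rfl, rfl⟩
  | n + 2, false => exact ⟨.inr (.inl (n + 1)), rfl, rfl⟩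

theorem sgn_eq (i : Mode) : sgn i = 1 ∨ sgn i = -1 := by
  have := Int.isUnit_iff.1 (IsUnit.of_mul_eq_one _ (sgn_sq i))
  exact this

theorem exists_modeBasis : ∃ b : HilbertBasis Mode ℝ Ell2Pair, ∀ i, b i = modeVec i := by
  have h2 : (√2)⁻¹ * (√2)⁻¹ = (1 / 2 : ℝ) := by
    rw [← mul_inv, Real.mul_self_sqrt zero_le_two, one_div]
  have ho : Orthonormal ℝ modeVec := by
    rw [orthonormal_iff_ite]
    intro i j
    nth_rewrite 2 [modeVec]
    rw [inner_modeVec]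
    simp only [lp.coeFn_smul, Pi.smul_apply, smul_eq_mul]
    split_ifs with hij
    · subst hij
      rw [ev_self]
      have : (sgn i : ℝ) * sgn i = 1 := by exact_mod_cast sgn_sq i
      linear_combination 2 * h2 + (√2)⁻¹ * (√2)⁻¹ * this
    · by_cases hs : site i = site j
      · have h3 : (sgn i : ℝ) * sgn j = -1 := by
          rcases sgn_eq i with h | h <;> rcases sgn_eq j with h' | h' <;>
            first | exact (hij (mode_ext hs (h.trans h'.symm))).elim | simp [h, h']
        rw [hs, ev_self]
        linear_combination (√2)⁻¹ * (√2)⁻¹ * h3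
      · rw [ev_ne hs]; ring
  refine ⟨HilbertBasis.mkOfOrthogonalEqBot ho ?_, fun i => by
    rw [HilbertBasis.coe_mkOfOrthogonalEqBot]⟩
  rw [Submodule.eq_bot_iff]
  intro x hx
  have hx' (i : Mode) : x.fst (site i) + sgn i * x.snd (site i) = 0 := by
    have h1 := (Submodule.mem_orthogonal _ _).1 hx _ (Submodule.subset_span ⟨i, rfl⟩)
    rw [← pair_fst_snd x, inner_modeVec] at h1
    have h3 : (√2)⁻¹ ≠ (0 : ℝ) := by positivity
    exact (mul_eq_zero.1 h1).resolve_left h3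
  rw [← pair_fst_snd x, pair_eq_zero]
  have hx2 (n : ℕ) : x.fst n = 0 ∧ x.snd n = 0 := by
    obtain ⟨i, hi, hi'⟩ := exists_mode n true
    obtain ⟨j, hj, hj'⟩ := exists_mode n false
    have h1 := hx' i
    have h2 := hx' j
    rw [hi, hi'] at h1
    rw [hj, hj'] at h2
    simp at h1 h2
    constructor <;> linarith
  exact ⟨by ext n; exact (hx2 n).1, by ext n; exact (hx2 n).2⟩

/-- The pair `x` is in the domain of `[B, C] ↦ [L₋ C, L₊ B]`, with image `z`, where `V` is the
potential. -/
def HamActs (σ μ : ℝ) (V : Ell2 →L[ℝ] Ell2) (x z : Ell2Pair) : Prop :=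
  ∀ n : ℕ, (n - μ) * x.snd n + σ * V x.snd n = z.fst n ∧
    (n - μ) * x.fst n + 3 * σ * V x.fst n = z.snd n

variable {σ μ : ℝ} {V : Ell2 →L[ℝ] Ell2}

theorem HamActs.reflect {B C : Ell2} {ν : ℝ} (h : HamActs σ μ V (pair B C) (ν • pair B C)) :
    HamActs σ μ V (pair B (-C)) ((-ν) • pair B (-C)) := fun n => by
  have h1 := (h n).1
  have h2 := (h n).2
  simp only [smul_pair, pair_fst, pair_snd, map_neg, lp.coeFn_neg, lp.coeFn_smul, Pi.neg_apply, Pi.smul_apply,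
    smul_eq_mul] at h1 h2 ⊢
  constructor <;> linarith

/-- The bounded perturbation of the harmonic oscillator. -/
theorem exists_perturbation (σ μ : ℝ) (V : Ell2 →L[ℝ] Ell2) :
    ∃ P : Ell2Pair →L[ℝ] Ell2Pair, ‖P‖ ≤ 3 * |σ| * ‖V‖ + |μ - 1| ∧ ∀ B C,
      P (pair B C) = pair (σ • V C - (μ - 1) • C) ((3 * σ) • V B - (μ - 1) • B) := by
  let P₀ : Ell2Pair →ₗ[ℝ] Ell2Pair :=
    { toFun := fun x => pair (σ • V x.snd - (μ - 1) • x.snd) ((3 * σ) • V x.fst - (μ - 1) • x.fst)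
      map_add' := fun x y => by
        have h1 : (x + y).fst = x.fst + y.fst := rfl
        have h2 : (x + y).snd = x.snd + y.snd := rfl
        have h3 (B C B' C' : Ell2) : pair B C + pair B' C' = pair (B + B') (C + C') := rfl
        rw [h1, h2, h3, map_add, map_add]
        congr 1 <;> module
      map_smul' := fun c x => by
        have h1 : (c • x).fst = c • x.fst := rfl
        have h2 : (c • x).snd = c • x.snd := rfl
        rw [h1, h2, RingHom.id_apply, smul_pair, map_smul, map_smul]
        congr 1 <;> module }
  set M := 3 * |σ| * ‖V‖ + |μ - 1| with hM
  have hM0 : 0 ≤ M := by positivity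
  have hbd (c : ℝ) (hc : |c| ≤ 3 * |σ|) (y : Ell2) : ‖c • V y - (μ - 1) • y‖ ≤ M * ‖y‖ := by
    calc ‖c • V y - (μ - 1) • y‖ ≤ |c| * ‖V y‖ + |μ - 1| * ‖y‖ := by
          refine (norm_sub_le _ _).trans_eq ?_
          rw [norm_smul, norm_smul, Real.norm_eq_abs, Real.norm_eq_abs]
      _ ≤ 3 * |σ| * (‖V‖ * ‖y‖) + |μ - 1| * ‖y‖ := by
          gcongr
          exact V.le_opNorm y
      _ = M * ‖y‖ := by rw [hM]; ring
  refine ⟨P₀.mkContinuous M fun x => ?_, P₀.mkContinuous_norm_le hM0 _, fun B C => rfl⟩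
  have h1 := hbd σ (by have := abs_nonneg σ; linarith) x.snd
  have h2 := hbd (3 * σ) (by rw [abs_mul]; norm_num) x.fst
  refine abs_le_of_sq_le_sq' ?_ (by positivity) |>.2
  rw [mul_pow, WithLp.prod_norm_sq_eq_of_L2, WithLp.prod_norm_sq_eq_of_L2]
  change ‖σ • V x.snd - (μ - 1) • x.snd‖ ^ 2 + ‖(3 * σ) • V x.fst - (μ - 1) • x.fst‖ ^ 2 ≤ _
  have h3 := pow_le_pow_left₀ (norm_nonneg _) h1 2
  have h4 := pow_le_pow_left₀ (norm_nonneg _) h2 2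
  linarith

/-- The linear problem in mode coordinates is a bounded perturbation of `diag(freq)`. -/
theorem exists_mode_coordinates : ∃ e : Ell2Pair ≃ₗᵢ[ℝ] L2 Mode, ∀ σ μ (V : Ell2 →L[ℝ] Ell2),
    ∃ R : L2 Mode →L[ℝ] L2 Mode, ‖R‖ ≤ 3 * |σ| * ‖V‖ + |μ - 1| ∧
      (∀ x z, HamActs σ μ V x z ↔ Acts freq R (e x) (e z)) ∧
      R (ev (.inl 0)) (.inl 0) + R (ev (.inl 1)) (.inl 1) = 2 * σ * (V (ev 2) 2 - V (ev 0) 0) := by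
  obtain ⟨b, hb⟩ := exists_modeBasis
  refine ⟨b.repr, fun σ μ V => ?_⟩
  obtain ⟨P, hPn, hP⟩ := exists_perturbation σ μ V
  have hcoord (x : Ell2Pair) (i : Mode) :
      b.repr x i = (√2)⁻¹ * (x.fst (site i) + sgn i * x.snd (site i)) := by
    rw [b.repr_apply_apply, hb, ← inner_modeVec, pair_fst_snd]
  have h2 : (√2)⁻¹ * (√2)⁻¹ = (1 / 2 : ℝ) := by
    rw [← mul_inv, Real.mul_self_sqrt zero_le_two, one_div]
  have hs : (√2)⁻¹ ≠ (0 : ℝ) := by positivity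
  let R : L2 Mode →L[ℝ] L2 Mode :=
    (b.repr : Ell2Pair →L[ℝ] L2 Mode) ∘L P ∘L (b.repr.symm : L2 Mode →L[ℝ] Ell2Pair)
  have hR (x : Ell2Pair) : R (b.repr x) = b.repr (P x) := by
    change b.repr (P (b.repr.symm (b.repr x))) = _
    rw [b.repr.symm_apply_apply]
  have hRe (i : Mode) : R (ev i) = b.repr (P (modeVec i)) := by
    rw [← hR, ← hb, b.repr_self]; rfl
  refine ⟨R, ?_, fun x z => ?_, ?_⟩
  · refine (R.opNorm_le_bound (norm_nonneg P) fun y => ?_).trans hPn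
    change ‖b.repr (P (b.repr.symm y))‖ ≤ _
    rw [b.repr.norm_map, ← b.repr.symm.norm_map y]
    exact P.le_opNorm _
  · have hPx : P x = pair (σ • V x.snd - (μ - 1) • x.snd)
        ((3 * σ) • V x.fst - (μ - 1) • x.fst) := hP _ _
    have key (i : Mode) : (freq i : ℝ) * b.repr x i + R (b.repr x) i =
        (√2)⁻¹ * (((site i - μ) * x.snd (site i) + σ * V x.snd (site i)) +
          sgn i * ((site i - μ) * x.fst (site i) + 3 * σ * V x.fst (site i))) := by
      have h3 : (sgn i : ℝ) * sgn i = 1 := by exact_mod_cast sgn_sq i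
      rw [hR, hPx, hcoord, hcoord, freq]
      simp only [pair_fst, pair_snd, lp.coeFn_sub, Pi.sub_apply, lp.coeFn_smul, Pi.smul_apply, smul_eq_mul]
      push_cast
      linear_combination (√2)⁻¹ * (site i - 1) * x.snd (site i) * h3
    constructor
    · intro h i
      rw [key, hcoord, (h _).1, (h _).2]
    · intro h n
      obtain ⟨i, hi, hi'⟩ := exists_mode n true
      obtain ⟨j, hj, hj'⟩ := exists_mode n false
      have e1 := h i
      have e2 := h j
      rw [key, hcoord] at e1 e2
      have e1' := mul_left_cancel₀ hs e1
      have e2' := mul_left_cancel₀ hs e2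
      rw [hi, hi'] at e1'
      rw [hj, hj'] at e2'
      simp only [if_true, Bool.false_eq_true, if_false] at e1' e2'
      push_cast at e1' e2'
      constructor <;> linarith
  -- The diagonal entry at a mode of level `n` is `sgn · (2σ Vₙₙ - (μ - 1))`. The two modes of
  -- frequency one have opposite signs, so the shift `μ - 1` cancels.
  · rw [hRe, hRe, modeVec, modeVec, hP, hP, hcoord, hcoord]
    have s0 : site (.inl 0) = 0 := rfl
    have s1 : site (.inl 1) = 2 := rfl
    have g0 : sgn (.inl 0) = -1 := rfl
    have g1 : sgn (.inl 1) = 1 := rfl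
    simp only [s0, s1, g0, g1, pair_fst, pair_snd, lp.coeFn_sub, Pi.sub_apply, lp.coeFn_smul, Pi.smul_apply,
      smul_eq_mul, map_smul, ev_self]
    push_cast
    linear_combination (4 * σ * (V (ev 2) 2 - V (ev 0) 0)) * h2

/-- The spectral theorem for small potentials. -/
theorem exists_spectral_threshold : ∃ δ > 0, ∃ c > 0, ∀ (σ μ M : ℝ) (V : Ell2 →L[ℝ] Ell2)
    (B₀ C₀ A A' : Ell2), 3 * |σ| * ‖V‖ + |μ - 1| ≤ M → M < δ →
    c * M ^ 2 < |2 * σ * (V (ev 2) 2 - V (ev 0) 0)| →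
    pair B₀ C₀ ≠ 0 → HamActs σ μ V (pair B₀ C₀) ((1 : ℝ) • pair B₀ C₀) → A ≠ 0 → A' ≠ 0 →
    HamActs σ μ V (pair 0 A) 0 → HamActs σ μ V (pair A' 0) (pair 0 A) →
    ∃ (Ω : ℕ → ℝ) (B C : ℕ → Ell2), Function.Injective Ω ∧ (∀ m, 0 < Ω m) ∧
      (∀ m, pair (B m) (C m) ≠ 0) ∧
      (∀ m, HamActs σ μ V (pair (B m) (C m)) (Ω m • pair (B m) (C m))) ∧
      (∀ ν x, 0 < ν → x ≠ 0 → HamActs σ μ V x (ν • x) →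
        ∃ m, ν = Ω m ∧ ∃ c : ℝ, x = c • pair (B m) (C m)) ∧
      IsScaledRieszBasis (completeSet B C A A') := by
  obtain ⟨e, he⟩ := exists_mode_coordinates
  obtain ⟨δ, hδ, c, hc, H⟩ := exists_block_diagonalisation freq
  -- The bound `δ` allows block diagonalisation, `1/2` bounds `‖R‖`, and `1/(2c)` gives `‖D‖ < 1/2`.
  -- The constant `2c` accounts for the two diagonal corrections from `RX`, each at most `c M²`.
  refine ⟨min δ (min (1 / 2) (1 / (2 * c))), by positivity, 2 * c, by positivity, ?_⟩
  intro σ μ M V B₀ C₀ A A' hM hMδ htr hBC hdip hA hA' hker hker'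
  obtain ⟨R, hRn, hR, hRt⟩ := he σ μ V
  have hRM : ‖R‖ ≤ M := hRn.trans hM
  have hM0 : 0 ≤ M := (norm_nonneg R).trans hRM
  obtain ⟨X, D, hX, hXR, hDR, hoff, hon, hconj⟩ :=
    H R (hRM.trans_lt (hMδ.trans_le (min_le_left _ _)))
  have hM1 : M < 1 / 2 := hMδ.trans_le ((min_le_right _ _).trans (min_le_left _ _))
  have hM2 : c * M < 1 / 2 := by
    have := hMδ.trans_le ((min_le_right _ _).trans (min_le_right _ _))
    rw [lt_div_iff₀ (by positivity)] at this
    linarith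
  have hcR : c * ‖R‖ ≤ c * M := by gcongr
  have hbd : BlockDiag freq R X D :=
    ⟨hoff, hconj, hRM.trans_lt hM1, (hDR.trans hcR).trans_lt hM2, hX⟩
  have hRX (i : Mode) : |R (X (ev i)) i| ≤ M * (c * M) := by
    have h1 := (abs_apply_le (R (X (ev i))) i).trans (R.le_opNorm _)
    have h2 := X.le_opNorm (ev i)
    rw [norm_ev, mul_one] at h2
    calc _ ≤ ‖R‖ * ‖X (ev i)‖ := h1
      _ ≤ M * (c * M) := by
        gcongr
        exact h2.trans (hXR.trans hcR)
  -- The trace of `D` is the first-order trace of `R` up to `2c M²`, which the hypothesis makes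
  -- smaller.
  have ht : D (ev (.inl 0)) (.inl 0) + D (ev (.inl 1)) (.inl 1) ≠ 0 := by
    intro h0
    rw [hon _ _ rfl, hon _ _ rfl] at h0
    have h1 : 2 * σ * (V (ev 2) 2 - V (ev 0) 0) =
        -(R (X (ev (.inl 0))) (.inl 0) + R (X (ev (.inl 1))) (.inl 1)) := by
      rw [← hRt]; linarith
    rw [h1, abs_neg] at htr
    have h2 := abs_add_le (R (X (ev (.inl 0))) (.inl 0)) (R (X (ev (.inl 1))) (.inl 1))
    have h3 := hRX (.inl 0)
    have h4 := hRX (.inl 1)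
    nlinarith
  obtain ⟨Ω, u, hΩ, hu⟩ := exists_positive_modes hbd (x₀ := e (pair B₀ C₀))
    (by simpa using hBC) (by rw [← map_smul]; exact (hR _ _).1 hdip) ht
  let B : ℕ → Ell2 := fun m => (e.symm (u m)).fst
  let C : ℕ → Ell2 := fun m => (e.symm (u m)).snd
  have heBC (m : ℕ) : e (pair (B m) (C m)) = u m := e.apply_symm_apply (u m)
  have hacts (m : ℕ) : HamActs σ μ V (pair (B m) (C m)) (Ω m • pair (B m) (C m)) := by
    rw [hR, map_smul, heBC]
    exact (hu m).2.1
  have hne (m : ℕ) : pair (B m) (C m) ≠ 0 := by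
    intro h0
    apply (hu m).1
    rw [← heBC, h0, map_zero]
  have hsys : IsModeSystem R Ω (fun i => e (completeSet B C A A' i)) := by
    refine ⟨fun i => ?_, fun m => (hu m).2.2, hΩ, fun m => ?_, fun m => ?_, ?_, ?_⟩
    · have : completeSet B C A A' i ≠ 0 := by
        rcases i with m | m | i
        · exact hne m
        · intro h0
          have h1 := pair_eq_zero.1 h0
          exact hne m (pair_eq_zero.2 ⟨h1.1, neg_eq_zero.1 h1.2⟩)
        · fin_cases i
          · exact fun h0 => hA (pair_eq_zero.1 h0).2
          · exact fun h0 => hA' (pair_eq_zero.1 h0).1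
      simpa using this
    · rw [← map_smul, ← hR]
      exact hacts m
    · rw [← map_smul, ← hR]
      exact (hacts m).reflect
    · have := (hR _ _).1 hker
      rwa [map_zero] at this
    · exact (hR _ _).1 hker'
  refine ⟨Ω, B, C, hsys.injective, hsys.pos_of_close, hne, hacts, fun ν x hν hx hxν => ?_,
    (hsys.isScaledRieszBasis hbd).of_isometry e⟩
  obtain ⟨m, hm, c, hc⟩ := hsys.exhaust hbd (x := e x) hν (by simpa using hx)
    (by rw [← map_smul, ← hR]; exact hxν)
  refine ⟨m, hm, c, e.injective ?_⟩
  rw [hc, map_smul]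
  rfl

end Hamiltonian
end DarkSoliton

namespace DarkSoliton

/-! ### Orthogonality, change of listing, and smallness along the family. -/

section Conclusions

open Filter Topology

/-- The equation expresses `(1 + n) xₙ` through elements of `l²`, so solutions lie in the domain
automatically. -/
theorem memWeighted_one {μ c : ℝ} {V : Ell2 →L[ℝ] Ell2} {x z : Ell2}
    (h : ∀ n : ℕ, (n - μ) * x n + c * V x n = z n) : MemWeighted 1 x := by
  refine (hasSum_sq (z + (1 + μ) • x - c • V x)).summable.congr fun n => ?_
  have h1 : (z + (1 + μ) • x - c • V x : Ell2) n = (1 + n) * x n := by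
    simp only [lp.coeFn_sub, lp.coeFn_add, Pi.sub_apply, Pi.add_apply, lp.coeFn_smul,
      Pi.smul_apply, smul_eq_mul, ← h n]
    ring
  rw [h1, sq_abs, mul_one, Real.rpow_two, mul_pow]

/-- The operators of the linear problem are symmetric. -/
theorem inner_symm_of_eq {μ c : ℝ} {V : Ell2 →L[ℝ] Ell2}
    (hV : ∀ x y, inner ℝ (V x) y = inner ℝ x (V y)) {x y z w : Ell2}
    (hx : ∀ n : ℕ, (n - μ) * x n + c * V x n = z n)
    (hy : ∀ n : ℕ, (n - μ) * y n + c * V y n = w n) :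
    inner ℝ z y = inner ℝ x w := by
  have h1 : inner ℝ (z - c • V x) y = inner ℝ x (w - c • V y) := by
    rw [lp.inner_eq_tsum, lp.inner_eq_tsum]
    refine tsum_congr fun n => ?_
    simp only [lp.coeFn_sub, Pi.sub_apply, lp.coeFn_smul, Pi.smul_apply, smul_eq_mul, ← hx n,
      ← hy n, add_sub_cancel_right, RCLike.inner_apply, conj_trivial]
    ring
  rw [inner_sub_left, inner_sub_right, inner_smul_left, inner_smul_right, hV, conj_trivial] at h1
  linarith

theorem IsScaledRieszBasis.eq_zero {ι E : Type*} [NormedAddCommGroup E] [InnerProductSpace ℝ E]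
    {v : ι → E} (hv : IsScaledRieszBasis v) {x : E} (hx : ∀ i, inner ℝ x (v i) = 0) : x = 0 := by
  obtain ⟨b, hb⟩ := hv.isUnconditionalBasis
  have h1 := (innerSL ℝ x).hasSum (b.expansion x)
  have hb' (i : ι) : b.basis i = v i := hb i
  simp only [map_smul, innerSL_apply_apply, hb', hx, smul_zero] at h1
  have h2 : inner ℝ x x = (0 : ℝ) := h1.unique hasSum_zero
  exact inner_self_eq_zero.1 h2

theorem isEigenvector_iff {A : ℕ → ℝ} {a : Ell2} (hA : ∀ n, A n = wt n * a n) {σ μ Ω : ℝ}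
    {B C : Ell2} : IsEigenvector σ A μ Ω B C ↔
      pair B C ≠ 0 ∧ HamActs σ μ (pot a a) (pair B C) (Ω • pair B C) := by
  constructor
  · intro h
    exact ⟨h.ne_zero, fun n => ⟨by rw [pair_snd, ← Lminus_eq_pot hA]; exact h.right_eq n,
      by rw [pair_fst, ← Lplus_eq_pot hA]; exact h.left_eq n⟩⟩
  · rintro ⟨h0, h⟩
    have h1 (n : ℕ) : (n - μ) * C n + σ * pot a a C n = (Ω • B : Ell2) n := (h n).1
    have h2 (n : ℕ) : (n - μ) * B n + 3 * σ * pot a a B n = (Ω • C : Ell2) n := (h n).2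
    exact ⟨h0, memWeighted_one h2, memWeighted_one h1,
      fun n => by rw [Lplus_eq_pot hA]; exact h2 n, fun n => by rw [Lminus_eq_pot hA]; exact h1 n⟩

variable {σ μ : ℝ} {V : Ell2 →L[ℝ] Ell2} {A A' : Ell2}

/-- Any listing of the eigenvectors yields a scaled Riesz basis, once one listing does. -/
theorem isScaledRieszBasis_of_listing {Ω₀ Ω : ℕ → ℝ} {B₀ C₀ B C : ℕ → Ell2}
    (hbasis : IsScaledRieszBasis (completeSet B₀ C₀ A A'))
    (hΩ : Function.Injective Ω) (hΩ₀ : Function.Injective Ω₀) (hsub : Set.range Ω₀ ⊆ Set.range Ω)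
    (hne : ∀ m, pair (B m) (C m) ≠ 0)
    (h : ∀ m, ∃ k, Ω m = Ω₀ k ∧ ∃ c : ℝ, pair (B m) (C m) = c • pair (B₀ k) (C₀ k)) :
    IsScaledRieszBasis (completeSet B C A A') := by
  choose p hp c hc using h
  have hpb : Function.Bijective p := by
    refine ⟨fun m k hmk => hΩ (by rw [hp, hp, hmk]), fun k => ?_⟩
    obtain ⟨m, hm⟩ := hsub ⟨k, rfl⟩
    exact ⟨m, hΩ₀ (by rw [← hp, hm])⟩
  let e := Equiv.ofBijective p hpb
  have hc0 (m : ℕ) : c m ≠ 0 := fun h0 => hne m (by rw [hc, h0, zero_smul])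
  refine (hbasis.reindex (Equiv.sumCongr e (Equiv.sumCongr e (Equiv.refl (Fin 2))))).smul
    (c := Sum.elim c (Sum.elim c fun _ => 1)) ?_ ?_
  · rintro (m | m | i)
    exacts [hc0 m, hc0 m, one_ne_zero]
  · rintro (m | m | i)
    · exact hc m
    · have h1 : B m = c m • B₀ (p m) := congrArg (fun x : Ell2Pair => x.fst) (hc m)
      have h2 : C m = c m • C₀ (p m) := congrArg (fun x : Ell2Pair => x.snd) (hc m)
      change pair (B m) (-C m) = c m • pair (B₀ (p m)) (-C₀ (p m))
      rw [smul_pair, smul_neg, ← h1, ← h2]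
    · exact (one_smul ℝ _).symm

/-- Symmetry of `L₋` and `L₊` gives `ν⟨B, C'⟩ = ν'⟨C, B'⟩` and `ν⟨C, B'⟩ = ν'⟨B, C'⟩`, hence `(ν² -
ν'²)⟨B, C'⟩ = 0`. -/
theorem HamActs.orthogonal (hV : ∀ x y, inner ℝ (V x) y = inner ℝ x (V y)) {B C B' C' : Ell2}
    {ν ν' : ℝ} (h : HamActs σ μ V (pair B C) (ν • pair B C))
    (h' : HamActs σ μ V (pair B' C') (ν' • pair B' C')) (hν : 0 < ν) (hν' : 0 < ν')
    (hne : ν ≠ ν') : inner ℝ B C' = 0 := by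
  have h1 := inner_symm_of_eq hV (z := ν • B) (w := ν' • B') (fun n => (h n).1) (fun n => (h' n).1)
  have h2 := inner_symm_of_eq hV (z := ν • C) (w := ν' • C') (fun n => (h n).2) (fun n => (h' n).2)
  simp only [pair_fst, pair_snd, inner_smul_left, inner_smul_right, conj_trivial] at h1 h2
  have h3 : ((ν - ν') * (ν + ν')) * inner ℝ B C' = 0 := by
    linear_combination ν * h1 + ν' * h2
  have h4 : (ν - ν') * (ν + ν') ≠ 0 := mul_ne_zero (sub_ne_zero.2 hne) (by positivity)
  exact (mul_eq_zero.1 h3).resolve_left h4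

theorem HamActs.orthogonal_ker (hV : ∀ x y, inner ℝ (V x) y = inner ℝ x (V y)) {B C : Ell2}
    {ν : ℝ} (h : HamActs σ μ V (pair B C) (ν • pair B C)) (hν : 0 < ν)
    (hker : HamActs σ μ V (pair 0 A) 0) : inner ℝ B A = 0 := by
  have h1 := inner_symm_of_eq hV (z := ν • B) (w := 0) (fun n => (h n).1) (fun n => (hker n).1)
  simpa [pair_snd, inner_smul_left, hν.ne'] using h1

theorem HamActs.orthogonal_gen_ker (hV : ∀ x y, inner ℝ (V x) y = inner ℝ x (V y)) {B C : Ell2}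
    {ν : ℝ} (h : HamActs σ μ V (pair B C) (ν • pair B C)) (hν : 0 < ν)
    (hker : HamActs σ μ V (pair 0 A) 0) (hker' : HamActs σ μ V (pair A' 0) (pair 0 A)) :
    inner ℝ C A' = 0 := by
  have h1 := inner_symm_of_eq hV (z := ν • C) (w := A) (fun n => (h n).2) (fun n => (hker' n).2)
  rw [pair_fst, pair_fst, h.orthogonal_ker hV hν hker] at h1
  simpa [inner_smul_left, hν.ne'] using h1

/-- If the product vanished, `[C_m, B_m]` would be orthogonal to every member of the basis and hence
zero. -/
theorem inner_ne_zero_of_basis (hV : ∀ x y, inner ℝ (V x) y = inner ℝ x (V y)) {Ω : ℕ → ℝ}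
    {B C : ℕ → Ell2} (hbasis : IsScaledRieszBasis (completeSet B C A A'))
    (hΩ : Function.Injective Ω) (hpos : ∀ m, 0 < Ω m) (hne : ∀ m, pair (B m) (C m) ≠ 0)
    (h : ∀ m, HamActs σ μ V (pair (B m) (C m)) (Ω m • pair (B m) (C m)))
    (hker : HamActs σ μ V (pair 0 A) 0) (hker' : HamActs σ μ V (pair A' 0) (pair 0 A)) (m : ℕ) :
    inner ℝ (B m) (C m) ≠ 0 := by
  intro h0
  have hall (j k : ℕ) (hjk : j = m ∨ k = m) : inner ℝ (B j) (C k) = 0 := by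
    by_cases hj : j = k
    · have hk : k = m := hjk.elim (fun h => hj ▸ h) id
      rw [hj, hk, h0]
    · exact (h j).orthogonal hV (h k) (hpos j) (hpos k) fun h => hj (hΩ h)
  have h1 : pair (C m) (B m) = 0 := hbasis.eq_zero (by
    rintro (k | k | i)
    · change inner ℝ (pair (C m) (B m)) (pair (B k) (C k)) = 0
      rw [inner_pair, hall m k (.inl rfl), real_inner_comm, hall k m (.inr rfl), add_zero]
    · change inner ℝ (pair (C m) (B m)) (pair (B k) (-C k)) = 0
      rw [inner_pair, inner_neg_right, hall m k (.inl rfl), real_inner_comm, hall k m (.inr rfl)]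
      simp
    · fin_cases i
      · change inner ℝ (pair (C m) (B m)) (pair 0 A) = 0
        rw [inner_pair, inner_zero_right, (h m).orthogonal_ker hV (hpos m) hker, add_zero]
      · change inner ℝ (pair (C m) (B m)) (pair A' 0) = 0
        rw [inner_pair, inner_zero_right, (h m).orthogonal_gen_ker hV (hpos m) hker hker', add_zero])
  obtain ⟨hc, hb⟩ := pair_eq_zero.1 h1
  exact hne m (pair_eq_zero.2 ⟨hb, hc⟩)

/-- If both the derivative and the position part vanish, so does the raising part, which is
injective. -/
theorem dipole_ne_zero {a : Ell2} (ha : a ≠ 0) : pair (derOp a) (-posOp a) ≠ 0 := by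
  intro h
  obtain ⟨h1, h2⟩ := pair_eq_zero.1 h
  rw [neg_eq_zero] at h2
  apply ha
  ext n
  have e1 : lowOp a (n + 1) - raiseOp a (n + 1) = 0 := congrArg (fun y : Ell2 => y (n + 1)) h1
  have e2 : lowOp a (n + 1) + raiseOp a (n + 1) = 0 := congrArg (fun y : Ell2 => y (n + 1)) h2
  have e3 : raiseOp a (n + 1) = 0 := by linarith
  rw [raiseOp_apply, Nat.add_sub_cancel] at e3
  have h3 : lad (n + 1) * wt n ≠ 0 := by
    refine mul_ne_zero (Real.sqrt_pos.2 ?_).ne' (wt_pos n).ne'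
    positivity
  simpa [h3] using e3

theorem HamActs.dipole {a : Ell2}
    (h : ∀ n : ℕ, (μ - n) * (wt n * a n) - σ * cubic a n = 0) :
    HamActs σ μ (pot a a) (pair (derOp a) (-posOp a)) ((1 : ℝ) • pair (derOp a) (-posOp a)) := by
  intro n
  obtain ⟨h1, h2⟩ := dipole_mode h n
  rw [one_smul, pair_fst, pair_snd, map_neg, lp.coeFn_neg, lp.coeFn_neg, Pi.neg_apply, Pi.neg_apply]
  exact ⟨by linarith, h1⟩

/-- Size of the perturbation and splitting of the double eigenvalue along a family. -/
theorem eventually_small {σ : ℝ} (hσ : σ ≠ 0) {W : ℝ → Ell2} {μ : ℝ → ℝ} {δ c : ℝ} (hδ : 0 < δ)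
    (hW : Tendsto (fun ε => ε⁻¹ • W ε) (𝓝[≠] 0) (𝓝 wev))
    (hμ : Tendsto (fun ε => (ε ^ 2)⁻¹ * (μ ε - 1)) (𝓝[≠] 0) (𝓝 (σ * (3 / √(32 * Real.pi))))) :
    ∀ᶠ ε in 𝓝[≠] 0, ∃ M, 3 * |σ| * ‖pot (W ε) (W ε)‖ + |μ ε - 1| ≤ M ∧ M < δ ∧
      c * M ^ 2 < |2 * σ * (pot (W ε) (W ε) (ev 2) 2 - pot (W ε) (W ε) (ev 0) 0)| := by
  have hV := tendsto_pot_scaled hW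
  have hsplit : Tendsto (fun ε => |2 * σ * (((ε ^ 2)⁻¹ • pot (W ε) (W ε)) (ev 2) 2 -
      ((ε ^ 2)⁻¹ • pot (W ε) (W ε)) (ev 0) 0)|) (𝓝[≠] 0)
      (𝓝 |2 * σ * (pot wev wev (ev 2) 2 - pot wev wev (ev 0) 0)|) := by
    have hc : Continuous fun T : Ell2 →L[ℝ] Ell2 =>
        |2 * σ * (T (ev 2) 2 - T (ev 0) 0)| := by
      simp_rw [← coordCLM_apply]; fun_prop
    exact (hc.tendsto _).comp hV
  have hne : 0 < |2 * σ * (pot wev wev (ev 2) 2 - pot wev wev (ev 0) 0)| := by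
    rw [pot_wev, pot_wev, K_2211_sub_K_0011]
    have := Real.pi_pos
    positivity
  set s := |2 * σ * (pot wev wev (ev 2) 2 - pot wev wev (ev 0) 0)| with hs
  have hsize := (hV.norm.const_mul (3 * |σ|)).add hμ.abs
  set L := 3 * |σ| * ‖pot wev wev‖ + |σ * (3 / √(32 * Real.pi))| with hL
  have hsq : Tendsto (fun ε : ℝ => ε ^ 2) (𝓝[≠] 0) (𝓝 0) := by
    have h3 : Continuous fun ε : ℝ => ε ^ 2 := by fun_prop
    have h4 := h3.tendsto 0
    rw [zero_pow two_ne_zero] at h4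
    exact h4.mono_left nhdsWithin_le_nhds
  have hM1 := hsq.const_mul (L + 1)
  have hM2 := hsq.const_mul (c * (L + 1) ^ 2)
  rw [mul_zero] at hM1 hM2
  filter_upwards [hsize.eventually_lt_const (lt_add_one L), hM1.eventually_lt_const hδ,
    hM2.eventually_lt_const (half_pos hne), hsplit.eventually_const_lt (half_lt_self hne),
    self_mem_nhdsWithin] with ε h1 h2 h3 h4 h5
  have hε : 0 < ε ^ 2 := by
    have : ε ≠ 0 := h5
    positivity
  -- `L` is the limit of the perturbation bound divided by `ε²`. Then `M²` is `O(ε⁴)`, while the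
  -- splitting is eventually at least `(s/2)ε²`.
  refine ⟨(L + 1) * ε ^ 2, ?_, h2, ?_⟩
  · have e1 : 3 * |σ| * ‖(ε ^ 2)⁻¹ • pot (W ε) (W ε)‖ + |(ε ^ 2)⁻¹ * (μ ε - 1)| =
        (ε ^ 2)⁻¹ * (3 * |σ| * ‖pot (W ε) (W ε)‖ + |μ ε - 1|) := by
      rw [norm_smul, norm_inv, abs_mul, abs_inv, Real.norm_eq_abs, abs_of_pos hε]; ring
    rw [e1, inv_mul_lt_iff₀ hε] at h1
    linarith
  · have e1 : 2 * σ * (((ε ^ 2)⁻¹ • pot (W ε) (W ε)) (ev 2) 2 -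
        ((ε ^ 2)⁻¹ • pot (W ε) (W ε)) (ev 0) 0) =
        (ε ^ 2)⁻¹ * (2 * σ * (pot (W ε) (W ε) (ev 2) 2 - pot (W ε) (W ε) (ev 0) 0)) := by
      simp only [smul_apply, lp.coeFn_smul, Pi.smul_apply, smul_eq_mul]
      ring
    rw [e1, abs_mul, abs_inv, abs_of_pos hε, lt_inv_mul_iff₀ hε] at h4
    calc c * ((L + 1) * ε ^ 2) ^ 2 = ε ^ 2 * (c * (L + 1) ^ 2 * ε ^ 2) := by ring
      _ < ε ^ 2 * (s / 2) := by gcongr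
      _ < _ := h4

end Conclusions
end DarkSoliton

namespace DarkSoliton

/-! ### Transfer of the derivative to the original coordinates. -/

section Derivative

open Filter Topology

/-- The derivative of the family in weighted coordinates. -/
theorem hasDerivAt_of_weighted {A W : ℝ → Ell2} {ε : ℝ} (h : ∀ᶠ t in 𝓝 ε, A t = wtOp (W t))
    (hW : DifferentiableAt ℝ W ε) : HasDerivAt A (wtOp (deriv W ε)) ε :=
  (wtOp.hasFDerivAt.comp_hasDerivAt ε hW.hasDerivAt).congr_of_eventuallyEq h

end Derivative
end DarkSoliton

/-! ### Assembly of the theorem. -/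

theorem mainTheorem6 (σ : ℝ) (hσ : σ ≠ 0) :
    (∃ (A : ℝ → DarkSoliton.Ell2) (μ : ℝ → ℝ), DarkSoliton.IsDarkSolitonFamily σ A μ) ∧
    ∀ (A : ℝ → DarkSoliton.Ell2) (μ : ℝ → ℝ), DarkSoliton.IsDarkSolitonFamily σ A μ →
      ∃ ε₀ > 0, ∀ ε : ℝ, 0 < |ε| → |ε| < ε₀ →
        -- `L₋ A = 0` and `L₊ ∂_μ A = A`, with `∂_μ A` well defined
        (DarkSoliton.MemWeighted 1 (A ε) ∧
          (∀ n, DarkSoliton.Lminus σ (A ε) (μ ε) (A ε) n = 0) ∧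
          DifferentiableAt ℝ A ε ∧ DifferentiableAt ℝ μ ε ∧ deriv μ ε ≠ 0 ∧
          DarkSoliton.MemWeighted 1 (DarkSoliton.dMu A μ ε) ∧
          (∀ n, DarkSoliton.Lplus σ (A ε) (μ ε) (DarkSoliton.dMu A μ ε) n = A ε n)) ∧
        inner ℝ (A ε) (DarkSoliton.dMu A μ ε) ≠ 0 ∧
        (∃ Ω : ℕ → ℝ, DarkSoliton.ListsPosEigenvalues σ (A ε) (μ ε) Ω) ∧
        ∀ (Ω : ℕ → ℝ) (B C : ℕ → DarkSoliton.Ell2),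
          DarkSoliton.ListsPosEigenvalues σ (A ε) (μ ε) Ω →
          (∀ m, DarkSoliton.IsEigenvector σ (A ε) (μ ε) (Ω m) (B m) (C m)) →
            (∀ m m', m' ≠ m → inner ℝ (B m') (C m) = 0) ∧
            (∀ m, inner ℝ (B m) (C m) ≠ 0) ∧
            (∀ m, ∀ k ∈ ({DarkSoliton.pair 0 (A ε),
                DarkSoliton.pair (DarkSoliton.dMu A μ ε) 0} : Set DarkSoliton.Ell2Pair),
              DarkSoliton.symp (DarkSoliton.pair (B m) (C m)) k = 0 ∧
              DarkSoliton.symp (DarkSoliton.pair (B m) (-C m)) k = 0) ∧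
            DarkSoliton.IsUnconditionalBasis
              (DarkSoliton.completeSet B C (A ε) (DarkSoliton.dMu A μ ε)) ∧
            DarkSoliton.IsRieszBasis (fun i =>
              ‖DarkSoliton.completeSet B C (A ε) (DarkSoliton.dMu A μ ε) i‖⁻¹ •
                DarkSoliton.completeSet B C (A ε) (DarkSoliton.dMu A μ ε) i) := by
  refine ⟨DarkSoliton.exists_darkSolitonFamily σ, fun A μ hfam => ?_⟩
  obtain ⟨δ, hδ, c, -, H⟩ := DarkSoliton.exists_spectral_threshold
  obtain ⟨W, hev, hW, hW', hμ⟩ := hfam.exists_weighted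
  have hall := (hev.eventually_nhds.filter_mono nhdsWithin_le_nhds).and
    ((DarkSoliton.IsDarkSolitonFamily.nondegenerate hσ (hev.mono fun t ht => ht.2) hW hW' hμ).and
      (DarkSoliton.eventually_small hσ (c := c) hδ hW hμ))
  obtain ⟨ε₀, hε₀, hball⟩ := Metric.eventually_nhds_iff.1 (eventually_nhdsWithin_iff.1 hall)
  refine ⟨ε₀, hε₀, fun ε hpos hlt => ?_⟩
  obtain ⟨hloc, ⟨hμ', hinner⟩, M, hM, hMδ, hsplit⟩ :=
    hball (by simpa using hlt) (abs_pos.1 hpos)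
  obtain ⟨hAW, hWd, hμd, hst⟩ := hloc.self_of_nhds
  set a := W ε
  have hA : ∀ n, A ε n = DarkSoliton.wt n * a n := fun n => by rw [hAW, DarkSoliton.wtOp_apply]
  have hAd := DarkSoliton.hasDerivAt_of_weighted (hloc.mono fun t ht => ht.1) hWd
  have hA' : DarkSoliton.dMu A μ ε = (deriv μ ε)⁻¹ • DarkSoliton.wtOp (deriv W ε) := by
    rw [DarkSoliton.dMu, hAd.deriv]
  have hminus : ∀ n : ℕ, (n - μ ε) * A ε n + σ * DarkSoliton.pot a a (A ε) n =
      (0 : DarkSoliton.Ell2) n := fun n => by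
    have h1 := hst n
    rw [DarkSoliton.cubic, ← hAW, ← hA] at h1
    rw [lp.coeFn_zero, Pi.zero_apply]
    linarith
  have hplus : ∀ n : ℕ, (n - μ ε) * DarkSoliton.dMu A μ ε n +
      3 * σ * DarkSoliton.pot a a (DarkSoliton.dMu A μ ε) n = A ε n := fun n => by
    have h1 := DarkSoliton.linearised_equation (hloc.mono fun t ht => ht.2.2.2) hWd hμd n
    rw [hA', map_smul, hA]
    simp only [lp.coeFn_smul, Pi.smul_apply, smul_eq_mul, DarkSoliton.wtOp_apply]
    have h2 : (deriv μ ε)⁻¹ * deriv μ ε = 1 := inv_mul_cancel₀ hμ'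
    linear_combination (deriv μ ε)⁻¹ * h1 + DarkSoliton.wt n * a n * h2
  have hinner' : inner ℝ (A ε) (DarkSoliton.dMu A μ ε) ≠ 0 := by
    rw [hA', hAW, inner_smul_right]
    exact mul_ne_zero (inv_ne_zero hμ') hinner
  have hV : ∀ x y, inner ℝ (DarkSoliton.pot a a x) y = inner ℝ x (DarkSoliton.pot a a y) :=
    fun x y => by rw [DarkSoliton.inner_pot_symm]
  have hker : DarkSoliton.HamActs σ (μ ε) (DarkSoliton.pot a a) (DarkSoliton.pair 0 (A ε)) 0 :=
    fun n => ⟨hminus n, by simp [DarkSoliton.pair_fst]⟩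
  have hker' : DarkSoliton.HamActs σ (μ ε) (DarkSoliton.pot a a)
      (DarkSoliton.pair (DarkSoliton.dMu A μ ε) 0) (DarkSoliton.pair 0 (A ε)) :=
    fun n => ⟨by simp [DarkSoliton.pair_fst, DarkSoliton.pair_snd], hplus n⟩
  have ha0 : a ≠ 0 := fun h => hinner (by rw [h, map_zero, inner_zero_left])
  obtain ⟨Ω₀, B₀, C₀, hΩ₀, hpos₀, hne₀, hacts₀, hexh, hbasis₀⟩ :=
    H σ (μ ε) M (DarkSoliton.pot a a) _ _ (A ε) (DarkSoliton.dMu A μ ε) hM hMδ hsplit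
      (DarkSoliton.dipole_ne_zero ha0) (DarkSoliton.HamActs.dipole hst)
      (fun h => hinner' (by rw [h, inner_zero_left]))
      (fun h => hinner' (by rw [h, inner_zero_right])) hker hker'
  have hrange : Set.range Ω₀ = DarkSoliton.posEigenvalues σ (A ε) (μ ε) := by
    ext ν
    constructor
    · rintro ⟨m, rfl⟩
      exact ⟨hpos₀ m, B₀ m, C₀ m, (DarkSoliton.isEigenvector_iff hA).2 ⟨hne₀ m, hacts₀ m⟩⟩
    · rintro ⟨hν, B, C, hBC⟩
      obtain ⟨h0, h1⟩ := (DarkSoliton.isEigenvector_iff hA).1 hBC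
      obtain ⟨m, hm, -⟩ := hexh ν _ hν h0 h1
      exact ⟨m, hm.symm⟩
  refine ⟨⟨DarkSoliton.memWeighted_one hminus, fun n => ?_, hAd.differentiableAt, hμd, hμ',
    DarkSoliton.memWeighted_one hplus, fun n => ?_⟩, hinner', ⟨Ω₀, hΩ₀, hrange⟩, ?_⟩
  · rw [DarkSoliton.Lminus_eq_pot hA]
    exact hminus n
  · rw [DarkSoliton.Lplus_eq_pot hA]
    exact hplus n
  intro Ω B C hlist heig
  have hne : ∀ m, DarkSoliton.pair (B m) (C m) ≠ 0 := fun m => (heig m).ne_zero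
  have hacts := fun m => ((DarkSoliton.isEigenvector_iff hA).1 (heig m)).2
  have hΩpos : ∀ m, 0 < Ω m := fun m => by
    have h1 : Ω m ∈ DarkSoliton.posEigenvalues σ (A ε) (μ ε) := hlist.2 ▸ ⟨m, rfl⟩
    exact h1.1
  -- Each positive eigenspace is spanned by one constructed eigenvector, so an arbitrary listing
  -- differs from the constructed one by a permutation and nonzero scalars.
  have hbasis := DarkSoliton.isScaledRieszBasis_of_listing hbasis₀ hlist.1 hΩ₀
    (hrange.trans hlist.2.symm).le hne fun m => hexh (Ω m) _ (hΩpos m) (hne m) (hacts m)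
  refine ⟨fun m m' hmm => ?_, fun m => ?_, fun m k hk => ?_, hbasis.isUnconditionalBasis,
    hbasis.isRieszBasis⟩
  · exact (hacts m').orthogonal hV (hacts m) (hΩpos m') (hΩpos m) fun h => hmm (hlist.1 h)
  · exact DarkSoliton.inner_ne_zero_of_basis hV hbasis hlist.1 hΩpos hne hacts hker hker' m
  · have h1 := (hacts m).orthogonal_ker hV (hΩpos m) hker
    have h2 := (hacts m).orthogonal_gen_ker hV (hΩpos m) hker hker'
    rcases hk with rfl | hk
    · simp [DarkSoliton.symp, DarkSoliton.pair_fst, DarkSoliton.pair_snd, h1]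
    · rw [Set.mem_singleton_iff.1 hk]
      simp [DarkSoliton.symp, DarkSoliton.pair_fst, DarkSoliton.pair_snd, h2]
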